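/- **Theorem 2.3.** Let $0\le\rho_x,\rho_y<1$ and $-1\le\rho_{xy}\le1$ satisfy $$2\rho_x^2(1+2|\rho_{xy}|)<1,\qquad 2\rho_y^2(1+2|\rho_{xy}|)<1,\qquad 2\rho_x\rho_y(3\rho_{xy}^2+2|\rho_{xy}|+1)<1 .$$ Then there is $\theta\in(0,1)$, depending only on $\rho_x,\rho_y,\rho_{xy}$, with the following property. Let $T>0$, $\mu_x,\mu_y,x_0,y_0\in\mathbb R$, and let $M^x,M^y$ be standard Brownian motions forming a two-dimensional Brownian motion with correlation $\rho_{xy}$. Let $$v(T,x,y)=\frac{1}{2\pi\sqrt{(1-\rho_x)(1-\rho_y)}\,T}\exp\Big(-\frac{(x-x_0-\mu_xT-\sqrt{\rho_x}M^x_T)^2}{2(1-\rho_x)T}-\frac{(y-y_0-\mu_yT-\sqrt{\rho_y}M^y_T)^2}{2(1-\rho_y)T}\Big),$$ the exact solution at time $T$ of $$dv=\Big(-\mu_xv_x-\mu_yv_y+\tfrac12\big(v_{xx}+2\sqrt{\rho_x\rho_y}\rho_{xy}v_{xy}+v_{yy}\big)\Big)dt-\sqrt{\rho_x}\,v_x\,dM^x_t-\sqrt{\rho_y}\,v_y\,dM^y_t$$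 with $v(0,x,y)=\delta(x-x_0)\delta(y-y_0)$. For $N\ge1$, $k=T/N$ and mesh sizes $h_x,h_y>0$ such that $i_0=x_0/h_x$ and $j_0=y_0/h_y$ are integers, let $V^n=(V^n_{i,j})_{i,j\in\mathbb Z}$, $n\ge0$, be the square-summable grid functions defined by the ADI-factorised implicit Milstein scheme: $V^0_{i,j}=h_x^{-1}h_y^{-1}$ if $(i,j)=(i_0,j_0)$, $V^0_{i,j}=0$ otherwise, and $$\Big(I+\tfrac{\mu_xk}{2h_x}D_x-\tfrac{k}{2h_x^2}D_{xx}\Big)\Big(I+\tfrac{\mu_yk}{2h_y}D_y-\tfrac{k}{2h_y^2}D_{yy}\Big)V^{n+1}$$ $$=\Big(I-\tfrac{\sqrt{\rho_xk}Z_n}{2h_x}D_x-\tfrac{\sqrt{\rho_yk}\widetilde Z_n}{2h_y}D_y+\tfrac{\rho_xk(Z_n^2-1)}{8h_x^2}D_x^2+\tfrac{\rho_yk(\widetilde Z_n^2-1)}{8h_y^2}D_y^2+\tfrac{\sqrt{\rho_x\rho_y}kZ_n\widetilde Z_n}{4h_xh_y}D_{xy}\Big)V^n ,$$ where $Z_n=(M^x_{(n+1)k}-M^x_{nk})/\sqrt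 k$, $\widetilde Z_n=(M^y_{(n+1)k}-M^y_{nk})/\sqrt k$, $(D_xV)_{i,j}=V_{i+1,j}-V_{i-1,j}$, $(D_{xx}V)_{i,j}=V_{i+1,j}-2V_{i,j}+V_{i-1,j}$, $D_y$ and $D_{yy}$ are the same in $j$, and $(D_{xy}V)_{i,j}=V_{i+1,j+1}-V_{i-1,j+1}-V_{i+1,j-1}+V_{i-1,j-1}$. Then there are random variables $E_1(x,y)=E_1^{(k)}(x,y)$, $E_2(x,y)$, $E_3(x,y)$, $(x,y)\in\mathbb R^2$, where $E_1$ may depend on $k$ but not on $h_x,h_y$, and $E_2,E_3$ depend on none of $k,h_x,h_y$, with first and second moments bounded uniformly in $x,y$ (and $k$), such that for all $\beta,C_0>0$ the following holds. For all $N,h_x,h_y$ as above that satisfy the timestep condition $$\theta^{T/k}\le2^{-C_0}\,\min\{h_x,h_y\}^{4+\beta},$$ and all $i,j\in\mathbb Z$, with $x_i=ih_x$, $y_j=jh_y$, almost surely $$V^N_{i,j}-v(T,x_i,y_j)=k\,E_1(x_i,y_j)+h_x^2\,E_2(x_i,y_j)+h_y^2\,E_3(x_i,y_j)+r\,R_{i,j},$$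 where $r=r(k,h_x,h_y)$ is deterministic with $r/(k+h_x^2+h_y^2)\to0$ as $k,h_x,h_y\to0$ subject to these conditions, and the random variables $R_{i,j}=R_{i,j}(k,h_x,h_y)$ have first and second moments bounded uniformly in $i,j,k,h_x,h_y$. -/

import Mathlib

open MeasureTheory ProbabilityTheory Filter Topology Asymptotics
open scoped NNReal

noncomputable section

namespace ZakaiADI

/-- Real-valued functions on the infinite two-dimensional grid; `V i j` lives at `(i * hx, j * hy)`. -/
abbrev Grid : Type := ℤ → ℤ → ℝ

/-- First-order central difference in `x` (unscaled). -/
def Dx (V : Grid) : Grid := fun i j => V (i + 1) j - V (i - 1) j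

/-- First-order central difference in `y` (unscaled). -/
def Dy (V : Grid) : Grid := fun i j => V i (j + 1) - V i (j - 1)

/-- Second-order central difference in `x` (unscaled). -/
def Dxx (V : Grid) : Grid := fun i j => V (i + 1) j - 2 * V i j + V (i - 1) j

/-- Second-order central difference in `y` (unscaled). -/
def Dyy (V : Grid) : Grid := fun i j => V i (j + 1) - 2 * V i j + V i (j - 1)

/-- Mixed second-order difference (unscaled). -/
def Dxy (V : Grid) : Grid := fun i j =>
  V (i + 1) (j + 1) - V (i - 1) (j + 1) - V (i + 1) (j - 1) + V (i - 1) (j - 1)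

/-- The implicit factor `I + μ k / (2 h) Dx - k / (2 h ^ 2) Dxx`. -/
def implicitX (μ k h : ℝ) (V : Grid) : Grid := fun i j =>
  V i j + μ * k / (2 * h) * Dx V i j - k / (2 * h ^ 2) * Dxx V i j

/-- The implicit factor `I + μ k / (2 h) Dy - k / (2 h ^ 2) Dyy`. -/
def implicitY (μ k h : ℝ) (V : Grid) : Grid := fun i j =>
  V i j + μ * k / (2 * h) * Dy V i j - k / (2 * h ^ 2) * Dyy V i j

/-- The explicit Milstein operator of one time step, where `√k * zx` and `√k * zy` are the
increments of the two correlated Brownian motions over that step. -/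
def milsteinRhs (ρx ρy k hx hy zx zy : ℝ) (V : Grid) : Grid := fun i j =>
  V i j
    - √(ρx * k) * zx / (2 * hx) * Dx V i j
    - √(ρy * k) * zy / (2 * hy) * Dy V i j
    + ρx * k * (zx ^ 2 - 1) / (8 * hx ^ 2) * Dx (Dx V) i j
    + ρy * k * (zy ^ 2 - 1) / (8 * hy ^ 2) * Dy (Dy V) i j
    + √(ρx * ρy) * k * zx * zy / (4 * hx * hy) * Dxy V i j

/-- One path `n ↦ V n` of the ADI-factorised implicit Milstein scheme with Dirac initial data at the
grid point closest to `(x₀, y₀)`, driven by the normalised increments `zx n`, `zy n`. On the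
infinite grid a solution of the implicit equations is pinned down by square summability; without
it one could add exponentially growing solutions of the homogeneous difference equation. -/
structure IsADIPath (μx μy ρx ρy x₀ y₀ k hx hy : ℝ) (zx zy : ℕ → ℝ) (V : ℕ → Grid) : Prop where
  init : ∀ i j : ℤ, V 0 i j =
    if i = round (x₀ / hx) ∧ j = round (y₀ / hy) then hx⁻¹ * hy⁻¹ else 0
  step : ∀ (n : ℕ) (i j : ℤ),
    implicitX μx k hx (implicitY μy k hy (V (n + 1))) i j =
      milsteinRhs ρx ρy k hx hy (zx n) (zy n) (V n) i j
  summable : ∀ n : ℕ, Summable fun p : ℤ × ℤ => V n p.1 p.2 ^ 2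

/-- `(Mx, My)` is a two-dimensional Brownian motion whose components are standard Brownian motions
with correlation `ρ`. -/
structure IsCorrelatedBrownian {Ω : Type*} [MeasurableSpace Ω] (P : Measure Ω) (ρ : ℝ)
    (Mx My : ℝ≥0 → Ω → ℝ) : Prop where
  brownian_x : IsBrownianReal Mx P
  brownian_y : IsBrownianReal My P
  jointly_gaussian : IsGaussianProcess (Sum.elim Mx My) P
  covariance_xy : ∀ s t : ℝ≥0, covariance (Mx s) (My t) P = ρ * (min s t : ℝ≥0)

/-- The normalised increment `(M ((n + 1) k) - M (n k)) / √k` of a process. -/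
def normIncrement {Ω : Type*} (M : ℝ≥0 → Ω → ℝ) (k : ℝ) (ω : Ω) (n : ℕ) : ℝ :=
  (M (((n : ℝ) + 1) * k).toNNReal ω - M ((n : ℝ) * k).toNNReal ω) / √k

/-- The exact solution at time `T`, position `(x, y)`, of
`dv = (-μx v_x - μy v_y + (v_xx + 2 √(ρx ρy) ρxy v_xy + v_yy) / 2) dt - √ρx v_x dMx - √ρy v_y dMy`
with initial condition the Dirac mass at `(x₀, y₀)`; `mx`, `my` are the values of the
driving Brownian motions at time `T`. -/
def exactSolution (μx μy ρx ρy x₀ y₀ T mx my x y : ℝ) : ℝ :=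
  Real.exp (-(x - x₀ - μx * T - √ρx * mx) ^ 2 / (2 * (1 - ρx) * T)
      - (y - y₀ - μy * T - √ρy * my) ^ 2 / (2 * (1 - ρy) * T))
    / (2 * Real.pi * √((1 - ρx) * (1 - ρy)) * T)

/-- A family of random variables has uniformly bounded first and second moments. -/
def BoundedMoments {Ω ι : Type*} [MeasurableSpace Ω] (P : Measure Ω) (F : ι → Ω → ℝ) : Prop :=
  ∃ C : ℝ, ∀ a : ι, MemLp (F a) 2 P ∧ ∫ ω, |F a ω| ∂P ≤ C ∧ ∫ ω, F a ω ^ 2 ∂P ≤ C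

/-- The admissible discretisations `(N, hx, hy)`: `N ≥ 1` time steps, positive mesh sizes for which
`x₀` and `y₀` are grid points, and the timestep condition
`θ ^ (T / k) = θ ^ N ≤ 2 ^ (-C₀) * (min hx hy) ^ (4 + β)`. -/
def admissible (x₀ y₀ θ β C₀ : ℝ) : Set (ℕ × ℝ × ℝ) :=
  {d | 0 < d.1 ∧ 0 < d.2.1 ∧ 0 < d.2.2 ∧
    (∃ i : ℤ, x₀ = i * d.2.1) ∧ (∃ j : ℤ, y₀ = j * d.2.2) ∧
    θ ^ d.1 ≤ (2 : ℝ) ^ (-C₀) * (min d.2.1 d.2.2) ^ (4 + β)}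

/-- Simultaneous refinement `N → ∞`, `hx → 0+`, `hy → 0+` within the admissible discretisations. -/
def refinement (x₀ y₀ θ β C₀ : ℝ) : Filter (ℕ × ℝ × ℝ) :=
  (atTop ×ˢ (𝓝[>] (0 : ℝ) ×ˢ 𝓝[>] (0 : ℝ))) ⊓ 𝓟 (admissible x₀ y₀ θ β C₀)

end ZakaiADI

end

noncomputable section

namespace ZakaiADI

/-! The Fourier transform diagonalises both the scheme and the equation. At a fixed frequency one
step multiplies by a random factor, `ratF` for the scheme and `expF` for the equation, and both are
driven by the same Gaussian increments, independent from step to step. The scheme is the inverse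
transform, over the frequency box of the grid, of the product of the factors `ratF` at the discrete
symbols `symH` (`IsADIPath.eq_gridFT`; square summability gives uniqueness by an energy argument).
The exact solution is the integral over the whole plane of the product of the factors `expF` at the
continuous symbols `symZ` (`exactSolution_eq_integral`, `stepProd_expF_eq`). Products are compared
frequency by frequency in mean square, and the frequency is then integrated out by Minkowski's
inequality (`lintegral_sq_lintegral_le`). Fourier phases have modulus one, so all bounds are uniform
in the space variables.

Stability. The three hypotheses on the correlations say exactly enough for `numerator_le`: the
second moment of `ratF` is at most `(1 + lam * W) / (1 + W)` with some `lam < 1` and `W` the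
frequency `excess`. This gives Gaussian decay in frequency when `W ≤ 1`, and the contraction factor
`(1 + lam) / 2` otherwise. The square root of that factor is `θ`.

Consistency. At low frequency `ratF - expF` has a mean of order `k ^ 2` and a second moment of order
`k ^ 3`, the Milstein situation. The discrete Gronwall estimate `GaussSteps.sqLe_duhamel` uses
independence to treat the mean and the fluctuation separately, so the global time error is of order
`k` and keeps the Gaussian decay. The density of `E₁` is this error divided by `k`, taken at the
continuous symbols so that the mesh sizes do not enter, and cut off at low frequency. The densities
of `E₂` and `E₃` come from expanding the exact exponential in `hx ^ 2` and `hy ^ 2`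
(`norm_expF_symH_taylor_le`). Moving the time error from `symH` to `symZ` costs a second difference
of products, of order `k * (hx ^ 2 + hy ^ 2)` by `LowPair.sqLe_mixed_error`.

Remainder. Where a frequency is not low, or lies outside the box, the mesh parameter times a power
of the frequency is bounded below, so every term with Gaussian decay is already of second order in
the mesh parameter. What is left is the scheme at unresolved frequencies of the box, whose root mean
square is at most a Gaussian term plus a multiple of `θ ^ N`. The box has area `4 * π ^ 2 / (hx *
hy)`, and the timestep condition makes `θ ^ N / (hx * hy)` negligible (`rate_div_mesh_le`).
`densityBound_remainder` collects the four frequency regimes. -/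

/-- The fourth moment of a centred Gaussian law. -/
lemma integral_pow_four_gaussianReal (v : ℝ≥0) : ∫ x, x ^ 4 ∂(gaussianReal 0 v) = 3 * (v : ℝ) ^ 2 := by
  have h0 : (0 : ℝ) ∈ interior (integrableExpSet id (gaussianReal 0 v)) := by
    simp [integrableExpSet_id_gaussianReal]
  have h := iteratedDeriv_mgf_zero h0 4
  simp only [Pi.pow_apply, id] at h
  rw [← h, mgf_id_gaussianReal]
  have e0 : (fun t : ℝ => Real.exp (0 * t + v * t ^ 2 / 2)) = fun t => 1 * Real.exp (v * t ^ 2 / 2) := by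
    ext t; simp
  have key : ∀ (p q : ℝ → ℝ), (∀ t, HasDerivAt p (q t - v * t * p t) t) →
      deriv (fun t : ℝ => p t * Real.exp (v * t ^ 2 / 2)) = fun t => q t * Real.exp (v * t ^ 2 / 2) := by
    intro p q hp
    ext t
    have h1 : HasDerivAt (fun t : ℝ => v * t ^ 2 / 2) (v * t) t := by
      have := ((hasDerivAt_pow 2 t).const_mul (v : ℝ)).div_const 2
      exact this.congr_deriv (by push_cast; ring)
    have := ((hp t).mul h1.exp).deriv
    rw [show (fun t : ℝ => p t * Real.exp (v * t ^ 2 / 2)) = p * fun t => Real.exp (v * t ^ 2 / 2) from rfl,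
      this]
    ring
  rw [e0, iteratedDeriv_eq_iterate]
  simp only [Function.iterate_succ, Function.iterate_zero, Function.comp, id]
  rw [key (fun _ => 1) (fun t => v * t) (fun t => by simpa using hasDerivAt_const t (1 : ℝ)),
    key (fun t => v * t) (fun t => v + v ^ 2 * t ^ 2) (fun t => by
      have := (hasDerivAt_id t).const_mul (v : ℝ)
      exact this.congr_deriv (by ring)),
    key (fun t => v + v ^ 2 * t ^ 2) (fun t => 3 * v ^ 2 * t + v ^ 3 * t ^ 3) (fun t => by
      have := ((hasDerivAt_pow 2 t).const_mul ((v : ℝ) ^ 2)).const_add (v : ℝ)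
      exact this.congr_deriv (by push_cast; ring)),
    key (fun t => 3 * v ^ 2 * t + v ^ 3 * t ^ 3) (fun t => 3 * v ^ 2 + 6 * v ^ 3 * t ^ 2 + v ^ 4 * t ^ 4)
      (fun t => by
        have := ((hasDerivAt_id t).const_mul (3 * (v : ℝ) ^ 2)).add
          ((hasDerivAt_pow 3 t).const_mul ((v : ℝ) ^ 3))
        exact this.congr_deriv (by push_cast; ring))]
  simp

/-! ### Correlated Gaussian pairs and their moments -/

/-- Laws on `ℝ × ℝ` of a centred Gaussian pair with unit variances and correlation `ρ`. -/
structure CorrGauss (ρ : ℝ) (ν : Measure (ℝ × ℝ)) : Prop where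
  prob : IsProbabilityMeasure ν
  law : ∀ a b : ℝ, ν.map (fun z => a * z.1 + b * z.2) =
    gaussianReal 0 (a ^ 2 + b ^ 2 + 2 * a * b * ρ).toNNReal

/-- The form equals `(1 + ρ) / 2 * (a + b) ^ 2 + (1 - ρ) / 2 * (a - b) ^ 2`. It makes the truncation
`toNNReal` in the variance harmless. -/
lemma corr_quadratic_nonneg {ρ : ℝ} (h1 : -1 ≤ ρ) (h2 : ρ ≤ 1) (a b : ℝ) :
    0 ≤ a ^ 2 + b ^ 2 + 2 * a * b * ρ := by
  nlinarith [mul_nonneg (sub_nonneg.2 h2) (sq_nonneg (a - b)),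
    mul_nonneg (by linarith : 0 ≤ 1 + ρ) (sq_nonneg (a + b)), sq_nonneg (a - b), sq_nonneg (a + b)]

namespace CorrGauss

variable {ρ : ℝ} {ν : Measure (ℝ × ℝ)}

/-- Functions of one linear combination see only a one-dimensional Gaussian law. The mean, variance,
fourth moment and characteristic function below are all obtained by this transfer. -/
lemma integral_comp {E : Type*} [NormedAddCommGroup E] [NormedSpace ℝ E] (h : CorrGauss ρ ν)
    (a b : ℝ) (f : ℝ → E) (hf : Continuous f) :
    ∫ z, f (a * z.1 + b * z.2) ∂ν = ∫ x, f x ∂(gaussianReal 0 (a ^ 2 + b ^ 2 + 2 * a * b * ρ).toNNReal) := by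
  rw [← h.law a b, integral_map]
  · fun_prop
  · exact hf.aestronglyMeasurable

lemma memLp_lin (h : CorrGauss ρ ν) (a b : ℝ) (p : ℝ≥0) :
    MemLp (fun z : ℝ × ℝ => a * z.1 + b * z.2) p ν := by
  have := memLp_id_gaussianReal (μ := 0) (v := (a ^ 2 + b ^ 2 + 2 * a * b * ρ).toNNReal) p
  rw [← h.law a b] at this
  exact (memLp_map_measure_iff this.1 (by fun_prop)).1 this

lemma integrable_lin_pow (h : CorrGauss ρ ν) (a b : ℝ) (n : ℕ) :
    Integrable (fun z : ℝ × ℝ => (a * z.1 + b * z.2) ^ n) ν := by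
  have := h.prob
  rcases Nat.eq_zero_or_pos n with rfl | hn
  · simp
  have h1 := (h.memLp_lin a b n).integrable_norm_pow (by simpa using hn.ne')
  refine h1.mono (by fun_prop) (ae_of_all _ fun z => ?_)
  simp

lemma integral_lin (h : CorrGauss ρ ν) (a b : ℝ) : ∫ z, (a * z.1 + b * z.2) ∂ν = 0 := by
  rw [h.integral_comp a b (fun x => x) continuous_id, integral_id_gaussianReal]

lemma integral_lin_sq (h : CorrGauss ρ ν) (h1 : -1 ≤ ρ) (h2 : ρ ≤ 1) (a b : ℝ) :
    ∫ z, (a * z.1 + b * z.2) ^ 2 ∂ν = a ^ 2 + b ^ 2 + 2 * a * b * ρ := by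
  rw [h.integral_comp a b (fun x => x ^ 2) (by fun_prop)]
  have := variance_fun_id_gaussianReal (μ := 0) (v := (a ^ 2 + b ^ 2 + 2 * a * b * ρ).toNNReal)
  rw [variance_of_integral_eq_zero (by fun_prop) integral_id_gaussianReal] at this
  rw [this, Real.coe_toNNReal _ (corr_quadratic_nonneg h1 h2 a b)]

lemma integral_lin_pow_four (h : CorrGauss ρ ν) (h1 : -1 ≤ ρ) (h2 : ρ ≤ 1) (a b : ℝ) :
    ∫ z, (a * z.1 + b * z.2) ^ 4 ∂ν = 3 * (a ^ 2 + b ^ 2 + 2 * a * b * ρ) ^ 2 := by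
  rw [h.integral_comp a b (fun x => x ^ 4) (by fun_prop), integral_pow_four_gaussianReal,
    Real.coe_toNNReal _ (corr_quadratic_nonneg h1 h2 a b)]

lemma integral_cexp_lin (h : CorrGauss ρ ν) (h1 : -1 ≤ ρ) (h2 : ρ ≤ 1) (a b : ℝ) :
    ∫ z, Complex.exp (-Complex.I * (a * z.1 + b * z.2 : ℝ)) ∂ν =
      Complex.exp (-(a ^ 2 + b ^ 2 + 2 * a * b * ρ : ℝ) / 2) := by
  have hc : Continuous fun x : ℝ => Complex.exp (-Complex.I * x) := by fun_prop
  rw [h.integral_comp a b (fun x => Complex.exp (-Complex.I * x)) hc]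
  have := charFun_gaussianReal (μ := 0) (v := (a ^ 2 + b ^ 2 + 2 * a * b * ρ).toNNReal) (-1)
  rw [charFun_apply_real] at this
  rw [Real.coe_toNNReal _ (corr_quadratic_nonneg h1 h2 a b)] at this
  convert this using 2
  · ext x; congr 1; push_cast; ring
  · push_cast; ring

/-- A moment constant valid for every `CorrGauss` law. -/
def momentConst : ℝ := 3 ^ 5 * (1 + 2 * ∫ x, x ^ 6 ∂(gaussianReal 0 1))

lemma integral_gauss_six_nonneg : 0 ≤ ∫ x, x ^ 6 ∂(gaussianReal 0 1) :=
  integral_nonneg fun x => by positivity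

lemma one_le_momentConst : 1 ≤ momentConst := by
  have := integral_gauss_six_nonneg
  unfold momentConst; nlinarith

/-- Convexity of the sixth power on three equally weighted points. The sixth moment is what squaring
a cubic bound in the noise requires. -/
lemma one_add_abs_pow_le (z : ℝ × ℝ) :
    (1 + |z.1| + |z.2|) ^ 6 ≤ 3 ^ 5 * (1 + z.1 ^ 6 + z.2 ^ 6) := by
  have h3 := Real.pow_arith_mean_le_arith_mean_pow (Finset.univ : Finset (Fin 3)) (fun _ => (1/3 : ℝ))
    ![1, |z.1|, |z.2|] (by simp) (by simp) (by
      intro i _; fin_cases i <;> simp) 6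
  simp [Fin.sum_univ_three] at h3
  have e1 : |z.1| ^ 6 = z.1 ^ 6 := Even.pow_abs (by decide) _
  have e2 : |z.2| ^ 6 = z.2 ^ 6 := Even.pow_abs (by decide) _
  rw [e1, e2] at h3
  have e3 : (3⁻¹ + 3⁻¹ * |z.1| + 3⁻¹ * |z.2|) ^ 6 = (1 + |z.1| + |z.2|) ^ 6 / 3 ^ 6 := by
    rw [← div_pow]; congr 1; ring
  rw [e3, div_le_iff₀ (by norm_num)] at h3
  linarith

lemma integrable_poly_bound (h : CorrGauss ρ ν) :
    Integrable (fun z : ℝ × ℝ => 3 ^ 5 * (1 + z.1 ^ 6 + z.2 ^ 6)) ν := by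
  have := h.prob
  have h1 := h.integrable_lin_pow 1 0 6
  have h2 := h.integrable_lin_pow 0 1 6
  simp only [one_mul, zero_mul, add_zero, zero_add] at h1 h2
  exact (((integrable_const 1).add h1).add h2).const_mul _

lemma integrable_one_add_abs_pow (h : CorrGauss ρ ν) :
    Integrable (fun z : ℝ × ℝ => (1 + |z.1| + |z.2|) ^ 6) ν := by
  refine h.integrable_poly_bound.mono (by fun_prop) (ae_of_all _ fun z => ?_)
  rw [Real.norm_of_nonneg (by positivity), Real.norm_of_nonneg (by positivity)]
  exact one_add_abs_pow_le z

lemma integral_one_add_abs_pow_le (h : CorrGauss ρ ν) :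
    ∫ z, (1 + |z.1| + |z.2|) ^ 6 ∂ν ≤ momentConst := by
  have := h.prob
  refine (integral_mono h.integrable_one_add_abs_pow h.integrable_poly_bound
    one_add_abs_pow_le).trans ?_
  have h1 := h.integrable_lin_pow 1 0 6
  have h2 := h.integrable_lin_pow 0 1 6
  have e1 := h.integral_comp 1 0 (fun x => x ^ 6) (by fun_prop)
  have e2 := h.integral_comp 0 1 (fun x => x ^ 6) (by fun_prop)
  simp at h1 h2 e1 e2
  have e3 : ∫ z : ℝ × ℝ, (1 + z.1 ^ 6 + z.2 ^ 6) ∂ν = 1 + (∫ z : ℝ × ℝ, z.1 ^ 6 ∂ν) + ∫ z : ℝ × ℝ, z.2 ^ 6 ∂ν := by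
    rw [integral_add (by exact (integrable_const 1).add h1) h2, integral_add (integrable_const 1) h1]
    simp
  rw [integral_const_mul, e3, e1, e2]
  simp [momentConst]
  linarith

end CorrGauss

/-! ### Filtration of an independent sequence of steps -/

/-- The σ-algebra generated by the first `n` steps of a sequence. -/
@[reducible]
def past {Ω : Type*} (Z : ℕ → Ω → ℝ × ℝ) (n : ℕ) : MeasurableSpace Ω :=
  MeasurableSpace.comap (fun ω (m : Fin n) => Z m ω) inferInstance

/-- A sequence of independent correlated Gaussian pairs. -/
structure GaussSteps {Ω : Type*} [MeasurableSpace Ω] (P : Measure Ω) (ρ : ℝ)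
    (Z : ℕ → Ω → ℝ × ℝ) : Prop where
  meas : ∀ n, Measurable (Z n)
  law : ∀ n, CorrGauss ρ (P.map (Z n))
  indep : ∀ n, Indep (past Z n) (MeasurableSpace.comap (Z n) inferInstance) P

section Past

variable {Ω : Type*} {Z : ℕ → Ω → ℝ × ℝ}

lemma past_mono {m n : ℕ} (h : m ≤ n) : past Z m ≤ past Z n := by
  have : (fun ω (i : Fin m) => Z i ω) =
      (fun (x : Fin n → ℝ × ℝ) (i : Fin m) => x (Fin.castLE h i)) ∘ fun ω (i : Fin n) => Z i ω := by
    ext <;> simp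
  unfold past
  rw [this, ← MeasurableSpace.comap_comp]
  apply MeasurableSpace.comap_mono
  exact Measurable.comap_le (by fun_prop)

lemma measurable_past (n : ℕ) : Measurable[past Z (n + 1)] (Z n) := by
  have : Z n = (fun x : Fin (n + 1) → ℝ × ℝ => x (Fin.last n)) ∘ fun ω (i : Fin (n + 1)) => Z i ω := by
    ext <;> simp
  rw [this]
  exact (measurable_pi_apply _).comp (comap_measurable _)

lemma past_le [m : MeasurableSpace Ω] (h : ∀ n, Measurable (Z n)) (n : ℕ) : past Z n ≤ m :=
  Measurable.comap_le (measurable_pi_lambda _ fun i => h i)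

end Past

/-! ### Normalised increments of the correlated Brownian motion -/

section Brownian

variable {Ω : Type*} [MeasurableSpace Ω] {P : Measure Ω} {ρ : ℝ}

/-- The increment process, indexed by step and component. -/
def incr (Mx My : ℝ≥0 → Ω → ℝ) (k : ℝ) (a : ℕ × Bool) (ω : Ω) : ℝ :=
  normIncrement (if a.2 then My else Mx) k ω a.1

variable {Mx My : ℝ≥0 → Ω → ℝ}

/-- Each increment is a linear functional of the joint process at two times. Joint Gaussianity of
the whole family is what later turns vanishing covariance into independence. -/
lemma isGaussianProcess_incr (hB : IsCorrelatedBrownian P ρ Mx My) (k : ℝ) :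
    IsGaussianProcess (incr Mx My k) P := by
  refine hB.jointly_gaussian.of_isGaussianProcess fun a => ?_
  let ι : ℝ≥0 → ℝ≥0 ⊕ ℝ≥0 := fun t => if a.2 then Sum.inr t else Sum.inl t
  let t1 := (((a.1 : ℝ) + 1) * k).toNNReal
  let t0 := ((a.1 : ℝ) * k).toNNReal
  classical
  let I : Finset (ℝ≥0 ⊕ ℝ≥0) := {ι t1, ι t0}
  refine ⟨I, (√k)⁻¹ • (ContinuousLinearMap.proj (R := ℝ) (φ := fun _ : I => ℝ) ⟨ι t1, by simp [I]⟩ -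
    ContinuousLinearMap.proj (R := ℝ) (φ := fun _ : I => ℝ) ⟨ι t0, by simp [I]⟩), fun ω => ?_⟩
  rcases a with ⟨n, b⟩
  cases b <;> simp [incr, normIncrement, ι, t1, t0, Finset.restrict] <;> ring

lemma memLp_incr (h : IsCorrelatedBrownian P ρ Mx My) (k : ℝ) (a : ℕ × Bool) :
    MemLp (incr Mx My k a) 2 P :=
  ((isGaussianProcess_incr h k).hasGaussianLaw_eval a).memLp_two

lemma covariance_component (h : IsCorrelatedBrownian P ρ Mx My) (b b' : Bool) (s t : ℝ≥0) :
    cov[(if b then My else Mx) s, (if b' then My else Mx) t; P] =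
      (if b = b' then 1 else ρ) * (min s t : ℝ≥0) := by
  cases b <;> cases b'
  · simpa using h.brownian_x.toIsPreBrownianReal.covariance_eval s t
  · simpa using h.covariance_xy s t
  · have := h.covariance_xy t s
    rw [covariance_comm, min_comm] at this
    simpa using this
  · simpa using h.brownian_y.toIsPreBrownianReal.covariance_eval s t

lemma memLp_component (hB : IsCorrelatedBrownian P ρ Mx My) (b : Bool) (s : ℝ≥0) :
    MemLp ((if b then My else Mx) s) 2 P := by
  cases b
  · exact (hB.brownian_x.toIsPreBrownianReal.isGaussianProcess.hasGaussianLaw_eval s).memLp_two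
  · exact (hB.brownian_y.toIsPreBrownianReal.isGaussianProcess.hasGaussianLaw_eval s).memLp_two

lemma integral_incr (h : IsCorrelatedBrownian P ρ Mx My) (k : ℝ) (a : ℕ × Bool) :
    ∫ ω, incr Mx My k a ω ∂P = 0 := by
  have : ∀ (s : ℝ≥0), ∫ ω, (if a.2 then My else Mx) s ω ∂P = 0 := by
    intro s
    cases a.2
    · exact h.brownian_x.toIsPreBrownianReal.integral_eval s
    · exact h.brownian_y.toIsPreBrownianReal.integral_eval s
  have hp := h.jointly_gaussian.isProbabilityMeasure
  unfold incr normIncrement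
  rw [integral_div, integral_sub, this, this]
  · simp
  · exact (memLp_component h a.2 _).integrable (by norm_num)
  · exact (memLp_component h a.2 _).integrable (by norm_num)

lemma covariance_incr (h : IsCorrelatedBrownian P ρ Mx My) {k : ℝ} (hk : 0 < k) (m n : ℕ) (b b' : Bool) :
    cov[incr Mx My k (m, b), incr Mx My k (n, b'); P] =
      if m = n then (if b = b' then 1 else ρ) else 0 := by
  have hp := h.jointly_gaussian.isProbabilityMeasure
  have e : ∀ a : ℕ × Bool, incr Mx My k a = fun ω => (√k)⁻¹ *
      ((if a.2 then My else Mx) (((a.1 : ℝ) + 1) * k).toNNReal -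
        (if a.2 then My else Mx) ((a.1 : ℝ) * k).toNNReal) ω := by
    intro a; ext ω; simp only [incr, normIncrement, Pi.sub_apply]; ring
  have hM := fun b s => memLp_component h b s
  rw [e, e, covariance_const_mul_left, covariance_const_mul_right, covariance_sub_left (hM _ _) (hM _ _)
    ((hM _ _).sub (hM _ _)), covariance_sub_right (hM _ _) (hM _ _) (hM _ _),
    covariance_sub_right (hM _ _) (hM _ _) (hM _ _)]
  simp only [covariance_component h]
  have mono : ∀ x y : ℝ, x ≤ y → min x.toNNReal y.toNNReal = x.toNNReal := fun x y hxy =>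
    min_eq_left (Real.toNNReal_le_toNNReal hxy)
  have mono' : ∀ x y : ℝ, y ≤ x → min x.toNNReal y.toNNReal = y.toNNReal := fun x y hxy =>
    min_eq_right (Real.toNNReal_le_toNNReal hxy)
  have cm : ∀ n : ℕ, (((n : ℝ) * k).toNNReal : ℝ) = n * k := fun n =>
    Real.coe_toNNReal _ (by positivity)
  have cm1 : ∀ n : ℕ, ((((n : ℝ) + 1) * k).toNNReal : ℝ) = (n + 1) * k := fun n =>
    Real.coe_toNNReal _ (by positivity)
  have hs : (√k)⁻¹ * ((√k)⁻¹ * k) = 1 := by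
    have : √k * √k = k := Real.mul_self_sqrt hk.le
    have h0 : √k ≠ 0 := (Real.sqrt_pos.2 hk).ne'
    field_simp; nlinarith
  -- For different steps the time intervals do not overlap and the four minima cancel in pairs. For
  -- equal steps they leave the length `k`, which the two factors `(√k)⁻¹` normalise to one.
  rcases lt_trichotomy m n with hmn | rfl | hmn
  · have h1 : (m : ℝ) + 1 ≤ n := by exact_mod_cast hmn
    rw [mono _ _ (by nlinarith), mono _ _ (by nlinarith), mono _ _ (by nlinarith), mono _ _ (by nlinarith)]
    simp [hmn.ne]
  · rw [mono _ _ le_rfl, mono' _ _ (by nlinarith), mono _ _ (by nlinarith), mono _ _ le_rfl, cm, cm1]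
    simp only [if_true]
    linear_combination (if b = b' then (1 : ℝ) else ρ) * hs
  · have h1 : (n : ℝ) + 1 ≤ m := by exact_mod_cast hmn
    rw [mono' _ _ (by nlinarith), mono' _ _ (by nlinarith), mono' _ _ (by nlinarith),
      mono' _ _ (by nlinarith)]
    simp [hmn.ne']

/-- The pairs of normalised increments of a correlated Brownian motion, up to modification, are
independent correlated Gaussian pairs. -/
lemma exists_gaussSteps (h : IsCorrelatedBrownian P ρ Mx My) {k : ℝ} (hk : 0 < k) :
    ∃ Z : ℕ → Ω → ℝ × ℝ, GaussSteps P ρ Z ∧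
      ∀ᵐ ω ∂P, ∀ n, Z n ω = (normIncrement Mx k ω n, normIncrement My k ω n) := by
  have hp := h.jointly_gaussian.isProbabilityMeasure
  have hG := isGaussianProcess_incr h k
  have hm : ∀ n, AEMeasurable (fun ω => (incr Mx My k (n, false) ω, incr Mx My k (n, true) ω)) P :=
    fun n => (hG.aemeasurable _).prodMk (hG.aemeasurable _)
  -- Measurability is available only up to null sets, while conditioning on `past` needs measurable
  -- maps, hence the passage to measurable versions.
  refine ⟨fun n => (hm n).mk, ⟨fun n => (hm n).measurable_mk, fun n => ?_, fun n => ?_⟩, ?_⟩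
  · refine ⟨Measure.isProbabilityMeasure_map (hm n).measurable_mk.aemeasurable, fun a b => ?_⟩
    rw [Measure.map_map (by fun_prop) (hm n).measurable_mk]
    have e1 : ((fun z : ℝ × ℝ => a * z.1 + b * z.2) ∘ (hm n).mk) =ᵐ[P]
        fun ω => a * incr Mx My k (n, false) ω + b * incr Mx My k (n, true) ω := by
      filter_upwards [(hm n).ae_eq_mk] with ω hω
      simp [← hω]
    rw [Measure.map_congr e1]
    have hG2 : HasGaussianLaw (fun ω => a * incr Mx My k (n, false) ω + b * incr Mx My k (n, true) ω) P := by
      have := (hG.hasGaussianLaw_prodMk (s := (n, false)) (t := (n, true))).map_fun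
        (a • ContinuousLinearMap.fst ℝ ℝ ℝ + b • ContinuousLinearMap.snd ℝ ℝ ℝ)
      simpa using this
    rw [hG2.map_eq_gaussianReal]
    have i1 := (memLp_incr h k (n, false))
    have i2 := (memLp_incr h k (n, true))
    congr 2
    · rw [integral_add ((i1.integrable (by norm_num)).const_mul _) ((i2.integrable (by norm_num)).const_mul _),
        integral_const_mul, integral_const_mul, integral_incr h, integral_incr h]
      simp
    · rw [variance_fun_add (i1.const_mul a) (i2.const_mul b), variance_const_mul, variance_const_mul,
        covariance_const_mul_left, covariance_const_mul_right, covariance_incr h hk,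
        ← covariance_self i1.aemeasurable, ← covariance_self i2.aemeasurable, covariance_incr h hk,
        covariance_incr h hk]
      simp; ring
  -- Jointly Gaussian families with zero cross-covariance are independent; this is applied to the
  -- whole past at once against both components of the current step.
  · have key : IndepFun (fun ω (s : Fin n × Bool) => incr Mx My k ((s.1 : ℕ), s.2) ω)
        (fun ω (b : Bool) => incr Mx My k (n, b) ω) P := by
      refine IsGaussianProcess.indepFun_of_covariance_eq_zero ?_ (fun s => hG.aemeasurable _)
        (fun b => hG.aemeasurable _) fun s b => ?_
      · have := hG.comp_right (Sum.elim (fun s : Fin n × Bool => ((s.1 : ℕ), s.2)) fun b : Bool => (n, b))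
        have e : (incr Mx My k ∘ Sum.elim (fun s : Fin n × Bool => ((s.1 : ℕ), s.2)) fun b : Bool => (n, b)) =
            Sum.elim (fun s : Fin n × Bool => incr Mx My k ((s.1 : ℕ), s.2)) fun b => incr Mx My k (n, b) := by
          ext s ω
          cases s <;> rfl
        rw [e] at this
        exact this
      · rw [covariance_incr h hk]
        simp [s.1.2.ne]
    have k2 := key.comp (φ := fun x (m : Fin n) => (x (m, false), x (m, true)))
      (ψ := fun x => (x false, x true)) (by fun_prop) (by fun_prop)
    have k3 := k2.congr (f' := fun ω (m : Fin n) => (hm m).mk _ ω) (g' := (hm n).mk) (by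
      have : ∀ᵐ ω ∂P, ∀ m : Fin n, (incr Mx My k ((m : ℕ), false) ω, incr Mx My k ((m : ℕ), true) ω) =
          (hm m).mk _ ω := ae_all_iff.2 fun m => (hm m).ae_eq_mk
      filter_upwards [this] with ω hω
      ext1 m
      exact hω m) (by
      filter_upwards [(hm n).ae_eq_mk] with ω hω
      exact hω)
    exact (IndepFun_iff_Indep _ _ _).1 k3
  · rw [ae_all_iff]
    intro n
    filter_upwards [(hm n).ae_eq_mk] with ω hω
    rw [← hω]
    simp [incr]

/-- Telescoping. The identity is almost sure because the path starts at zero only almost surely. -/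
lemma sum_normIncrement (hx : IsBrownianReal Mx P) {T : ℝ} (hT : 0 < T) {N : ℕ} (hN : 0 < N) :
    ∀ᵐ ω ∂P, √(T / N) * ∑ n ∈ Finset.range N, normIncrement Mx (T / N) ω n = Mx T.toNNReal ω := by
  filter_upwards [hx.toIsPreBrownianReal.eval_zero_ae_eq_zero] with ω hω
  have hN' : (0 : ℝ) < N := by exact_mod_cast hN
  have h0 : √(T / N) ≠ 0 := (Real.sqrt_pos.2 (by positivity)).ne'
  have e : ∀ n : ℕ, √(T / N) * normIncrement Mx (T / N) ω n =
      Mx (((n + 1 : ℕ) : ℝ) * (T / N)).toNNReal ω - Mx ((n : ℝ) * (T / N)).toNNReal ω := by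
    intro n
    unfold normIncrement
    push_cast
    field_simp
  rw [Finset.mul_sum, Finset.sum_congr rfl fun n _ => e n,
    Finset.sum_range_sub (fun n : ℕ => Mx ((n : ℝ) * (T / N)).toNNReal ω)]
  have : (N : ℝ) * (T / N) = T := by field_simp
  simp [this, hω]

end Brownian

/-! ### Deterministic comparison of one rational and one exponential step: gradients -/

/-- One step of the rational amplification factor. -/
def ratStep (u κ y w : ℂ) : ℂ := (1 + u + u ^ 2 / 2 + κ) * ((1 + y) * (1 + w))⁻¹

/-- One step of the exact amplification factor. -/
def expStep (u κ y w : ℂ) : ℂ := Complex.exp (u + κ - y - w)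

lemma norm_exp_I_sub_one_le (α : ℝ) : ‖Complex.exp (-Complex.I * α) - 1‖ ≤ |α| := by
  have := Real.norm_exp_I_mul_ofReal_sub_one_le (x := -α)
  simpa using this

/-- The mean value inequality on `[0, 1]`, with the first-order bound `norm_exp_I_sub_one_le`
controlling the derivative. -/
lemma norm_exp_I_sub_one_sub_le (α : ℝ) :
    ‖Complex.exp (-Complex.I * α) - 1 - (-Complex.I * α)‖ ≤ |α| ^ 2 := by
  have hd : ∀ t : ℝ, HasDerivAt (fun t : ℝ => Complex.exp (-Complex.I * (α * t)) - 1 - (-Complex.I * (α * t)))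
      (-Complex.I * α * (Complex.exp (-Complex.I * ((α * t : ℝ) : ℂ)) - 1)) t := by
    intro t
    have h1 : HasDerivAt (fun t : ℝ => -Complex.I * (α * (t : ℂ))) (-Complex.I * α) t := by
      have := ((hasDerivAt_id t).ofReal_comp.const_mul (α : ℂ)).const_mul (-Complex.I)
      simpa using this
    have := (h1.cexp.sub_const 1).sub h1
    refine this.congr_deriv ?_
    push_cast; ring
  have := norm_image_sub_le_of_norm_deriv_le_segment_01' (fun t _ => (hd t).hasDerivWithinAt)
    (C := |α| ^ 2) (fun t ht => by
      rw [norm_mul]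
      have h1 := norm_exp_I_sub_one_le (α * t)
      have h2 : |α * t| ≤ |α| := by
        rw [abs_mul, abs_of_nonneg ht.1]
        exact mul_le_of_le_one_right (abs_nonneg _) ht.2.le
      have h3 : ‖-Complex.I * (α : ℂ)‖ = |α| := by simp
      rw [h3, sq]
      exact mul_le_mul_of_nonneg_left (h1.trans h2) (abs_nonneg _))
  simpa using this

lemma norm_inv_one_add_le {ε : ℝ} (h1 : ε ≤ 1 / 4) {y : ℂ} (hy : ‖y‖ ≤ ε) :
    1 + y ≠ 0 ∧ ‖(1 + y)⁻¹‖ ≤ 4 / 3 := by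
  have h : 3 / 4 ≤ ‖1 + y‖ := by
    have := norm_sub_le (1 + y) y
    simp at this
    linarith
  refine ⟨fun h0 => ?_, ?_⟩
  · rw [h0] at h; norm_num at h
  · rw [norm_inv]
    calc ‖1 + y‖⁻¹ ≤ (3 / 4 : ℝ)⁻¹ := inv_anti₀ (by norm_num) h
      _ = 4 / 3 := by norm_num

section Gradient

variable {ℓ r α : ℝ} {κ y w : ℂ}

/-- Smallness of the parameters of a step at scale `ℓ`, with random amplitude `r`. -/
structure StepSmall (ℓ r α : ℝ) (κ y w : ℂ) : Prop where
  a : |α| ≤ ℓ * r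
  k : ‖κ‖ ≤ ℓ ^ 2
  y : ‖y‖ ≤ ℓ ^ 2
  w : ‖w‖ ≤ ℓ ^ 2

lemma norm_inv_one_add_sub_one_le {ε : ℝ} (h1 : ε ≤ 1 / 4) (hy : ‖y‖ ≤ ε) :
    ‖(1 + y)⁻¹ - 1‖ ≤ 4 / 3 * ε := by
  obtain ⟨h0, hi⟩ := norm_inv_one_add_le h1 hy
  have : (1 + y)⁻¹ - 1 = -(1 + y)⁻¹ * y := by field_simp; ring
  rw [this, norm_mul, norm_neg]
  exact mul_le_mul hi hy (norm_nonneg _) (by norm_num)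

lemma StepSmall.inv (h : StepSmall ℓ r α κ y w) (h0 : 0 ≤ ℓ) (hl : ℓ ≤ 1 / 2) :
    ‖((1 + y) * (1 + w))⁻¹‖ ≤ 2 ∧ ‖((1 + y) * (1 + w))⁻¹ - 1‖ ≤ 4 * ℓ ^ 2 := by
  have h4 : ℓ ^ 2 ≤ 1 / 4 := by nlinarith
  obtain ⟨_, hy⟩ := norm_inv_one_add_le h4 h.y
  obtain ⟨_, hw⟩ := norm_inv_one_add_le h4 h.w
  rw [mul_inv]
  refine ⟨?_, ?_⟩
  · rw [norm_mul]
    calc _ ≤ (4 / 3 : ℝ) * (4 / 3) := mul_le_mul hy hw (norm_nonneg _) (by norm_num)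
      _ ≤ 2 := by norm_num
  · have e : (1 + y)⁻¹ * (1 + w)⁻¹ - 1 = (1 + y)⁻¹ * ((1 + w)⁻¹ - 1) + ((1 + y)⁻¹ - 1) := by ring
    rw [e]
    refine (norm_add_le _ _).trans ?_
    rw [norm_mul]
    have a1 := norm_inv_one_add_sub_one_le h4 h.y
    have a2 := norm_inv_one_add_sub_one_le h4 h.w
    have := mul_le_mul hy a2 (norm_nonneg _) (by norm_num)
    nlinarith [sq_nonneg ℓ]

/-- The oscillating factor has modulus one and the remaining exponent is of order `ℓ ^ 2`, so it can
be dropped at that cost whatever the random amplitude `r`. -/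
lemma StepSmall.exp (h : StepSmall ℓ r α κ y w) (h0 : 0 ≤ ℓ) (hl : ℓ ≤ 1 / 2) :
    ‖expStep (-Complex.I * α) κ y w - Complex.exp (-Complex.I * α)‖ ≤ 6 * ℓ ^ 2 := by
  have e : expStep (-Complex.I * α) κ y w - Complex.exp (-Complex.I * α) =
      Complex.exp (-Complex.I * α) * (Complex.exp (κ - y - w) - 1) := by
    unfold expStep
    rw [mul_sub, ← Complex.exp_add]; ring_nf
  have h1 : ‖Complex.exp (-Complex.I * α)‖ = 1 := by
    have := Complex.norm_exp_ofReal_mul_I (-α)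
    rw [← this]; congr 2; push_cast; ring
  have h2 : ‖κ - y - w‖ ≤ 3 * ℓ ^ 2 := by
    refine (norm_sub_le _ _).trans ?_
    have := norm_sub_le κ y
    linarith [h.k, h.y, h.w]
  have h3 : ‖κ - y - w‖ ≤ 1 := by nlinarith
  rw [e, norm_mul, h1, one_mul]
  have := Complex.norm_exp_sub_one_le h3
  linarith

lemma StepSmall.numerator_sub_one (h : StepSmall ℓ r α κ y w) :
    ‖(1 + -Complex.I * α + (-Complex.I * α) ^ 2 / 2 + κ) - 1‖ ≤ ℓ * r + ℓ ^ 2 * r ^ 2 + ℓ ^ 2 := by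
  have e : (1 + -Complex.I * α + (-Complex.I * α) ^ 2 / 2 + κ) - 1 =
    -Complex.I * α + (-Complex.I * α) ^ 2 / 2 + κ := by ring
  have hα : ‖-Complex.I * (α : ℂ)‖ ≤ ℓ * r := by simpa using h.a
  rw [e]
  refine (norm_add₃_le).trans ?_
  rw [norm_div, norm_pow]
  have : ‖-Complex.I * (α : ℂ)‖ ^ 2 ≤ (ℓ * r) ^ 2 := pow_le_pow_left₀ (norm_nonneg _) hα 2
  have h2 : ‖(2 : ℂ)‖ = 2 := by simp
  rw [h2]
  nlinarith [h.k, norm_nonneg (-Complex.I * (α : ℂ)), sq_nonneg (ℓ * r)]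

/-- This compares the `u`-derivatives of `ratStep` and `expStep`. The term `u ^ 2 / 2` of the
Milstein numerator makes its derivative `1 + u`, which matches the exponential to first order, so
the discrepancy is quadratic in `ℓ`. Without that term it would be linear. -/
lemma StepSmall.grad_u (h : StepSmall ℓ r α κ y w) (hr : 0 ≤ r) (h0 : 0 ≤ ℓ) (hl : ℓ ≤ 1 / 2) :
    ‖(1 + -Complex.I * α) * ((1 + y) * (1 + w))⁻¹ - expStep (-Complex.I * α) κ y w‖ ≤
      10 * ℓ ^ 2 * (1 + r) ^ 2 := by
  have e : (1 + -Complex.I * α) * ((1 + y) * (1 + w))⁻¹ - expStep (-Complex.I * α) κ y w =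
    (1 + -Complex.I * α) * (((1 + y) * (1 + w))⁻¹ - 1) -
      (Complex.exp (-Complex.I * α) - 1 - (-Complex.I * α)) -
      (expStep (-Complex.I * α) κ y w - Complex.exp (-Complex.I * α)) := by ring
  have hα : ‖-Complex.I * (α : ℂ)‖ ≤ ℓ * r := by simpa using h.a
  have h1 : ‖1 + -Complex.I * (α : ℂ)‖ ≤ 1 + ℓ * r := by
    refine (norm_add_le _ _).trans ?_
    simpa using h.a
  rw [e]
  refine (norm_sub_le _ _).trans ?_
  have h2 := norm_sub_le ((1 + -Complex.I * α) * (((1 + y) * (1 + w))⁻¹ - 1))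
      (Complex.exp (-Complex.I * α) - 1 - (-Complex.I * α))
  rw [norm_mul] at h2
  have h3 := mul_le_mul h1 (h.inv h0 hl).2 (norm_nonneg _) (by positivity)
  have h4 := norm_exp_I_sub_one_sub_le α
  have h5 : |α| ^ 2 ≤ (ℓ * r) ^ 2 := pow_le_pow_left₀ (abs_nonneg _) h.a 2
  have h6 := h.exp h0 hl
  have h7 : (1 + ℓ * r) * (4 * ℓ ^ 2) ≤ (1 + r) * (4 * ℓ ^ 2) := by
    gcongr
    nlinarith
  nlinarith [mul_nonneg (sq_nonneg ℓ) hr, mul_nonneg (sq_nonneg ℓ) (sq_nonneg r)]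

lemma StepSmall.one_sub_exp (h : StepSmall ℓ r α κ y w) (h0 : 0 ≤ ℓ) (hl : ℓ ≤ 1 / 2) :
    ‖1 - expStep (-Complex.I * α) κ y w‖ ≤ ℓ * r + 6 * ℓ ^ 2 := by
  have e : 1 - expStep (-Complex.I * α) κ y w =
    -(Complex.exp (-Complex.I * α) - 1) - (expStep (-Complex.I * α) κ y w - Complex.exp (-Complex.I * α)) := by
    ring
  rw [e]
  refine (norm_sub_le _ _).trans ?_
  rw [norm_neg]
  linarith [norm_exp_I_sub_one_le α, h.exp h0 hl, h.a]

/-- This compares the `κ`-derivatives. First order in `ℓ` is enough, because variations of `κ` carry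
a factor `ℓ ^ 2` themselves. -/
lemma StepSmall.grad_k (h : StepSmall ℓ r α κ y w) (h0 : 0 ≤ ℓ) (hl : ℓ ≤ 1 / 2) :
    ‖((1 + y) * (1 + w))⁻¹ - expStep (-Complex.I * α) κ y w‖ ≤ ℓ * r + 10 * ℓ ^ 2 := by
  have e : ((1 + y) * (1 + w))⁻¹ - expStep (-Complex.I * α) κ y w =
    (((1 + y) * (1 + w))⁻¹ - 1) + (1 - expStep (-Complex.I * α) κ y w) := by ring
  rw [e]
  refine (norm_add_le _ _).trans ?_
  linarith [(h.inv h0 hl).2, h.one_sub_exp h0 hl]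

/-- Up to sign this compares the derivatives in `y` (take `v = y`) or in `w` (take `v = w`); as for
`κ`, first order in `ℓ` suffices. -/
lemma StepSmall.grad_y (h : StepSmall ℓ r α κ y w) (hr : 0 ≤ r) (h0 : 0 ≤ ℓ) (hl : ℓ ≤ 1 / 2)
    {v : ℂ} (hv : ‖v‖ ≤ ℓ ^ 2) :
    ‖ratStep (-Complex.I * α) κ y w * (1 + v)⁻¹ - expStep (-Complex.I * α) κ y w‖ ≤
      16 * ℓ * (r + ℓ) * (1 + r) := by
  have h4 : ℓ ^ 2 ≤ 1 / 4 := by nlinarith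
  obtain ⟨_, hi⟩ := norm_inv_one_add_le h4 hv
  have hi1 := norm_inv_one_add_sub_one_le h4 hv
  obtain ⟨hG, hG1⟩ := h.inv h0 hl
  set G := ((1 + y) * (1 + w))⁻¹
  set N := 1 + -Complex.I * α + (-Complex.I * α) ^ 2 / 2 + κ with hN
  have e : ratStep (-Complex.I * α) κ y w * (1 + v)⁻¹ - expStep (-Complex.I * α) κ y w =
      (N - 1) * (G * (1 + v)⁻¹) + ((G - 1) * (1 + v)⁻¹ + ((1 + v)⁻¹ - 1)) +
        (1 - expStep (-Complex.I * α) κ y w) := by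
    unfold ratStep; ring
  rw [e]
  refine (norm_add₃_le).trans ?_
  have b1 : ‖(N - 1) * (G * (1 + v)⁻¹)‖ ≤ (ℓ * r + ℓ ^ 2 * r ^ 2 + ℓ ^ 2) * 3 := by
    rw [norm_mul, norm_mul]
    have : ‖G‖ * ‖(1 + v)⁻¹‖ ≤ 3 := by
      calc _ ≤ (2 : ℝ) * (4 / 3) := mul_le_mul hG hi (norm_nonneg _) (by norm_num)
        _ ≤ 3 := by norm_num
    exact mul_le_mul (h.numerator_sub_one) this (by positivity) (by positivity)
  have b2 : ‖(G - 1) * (1 + v)⁻¹ + ((1 + v)⁻¹ - 1)‖ ≤ 7 * ℓ ^ 2 := by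
    refine (norm_add_le _ _).trans ?_
    rw [norm_mul]
    have := mul_le_mul hG1 hi (norm_nonneg _) (by positivity)
    nlinarith [sq_nonneg ℓ]
  have b3 := h.one_sub_exp h0 hl
  have c1 : ℓ ^ 2 * r ^ 2 ≤ ℓ * r ^ 2 := by
    have : ℓ ^ 2 ≤ ℓ := by nlinarith
    exact mul_le_mul_of_nonneg_right this (sq_nonneg r)
  nlinarith [mul_nonneg h0 hr, mul_nonneg h0 (sq_nonneg r), mul_nonneg (sq_nonneg ℓ) hr]

lemma StepSmall.norm_rat_num (h : StepSmall ℓ r α κ y w) (hr : 0 ≤ r) (h0 : 0 ≤ ℓ) (hl : ℓ ≤ 1 / 2) :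
    ‖ratStep (-Complex.I * α) κ y w‖ ≤ 4 * (1 + r) ^ 2 := by
  have h1 := h.numerator_sub_one
  set N := 1 + -Complex.I * α + (-Complex.I * α) ^ 2 / 2 + κ with hN
  have h2 : ‖N‖ ≤ 2 * (1 + r) ^ 2 := by
    have : ‖N‖ ≤ ‖N - 1‖ + ‖(1 : ℂ)‖ := by simpa using norm_add_le (N - 1) 1
    rw [norm_one] at this
    have c0 : ℓ ^ 2 ≤ 1 / 4 := by nlinarith
    have c1 : ℓ ^ 2 * r ^ 2 ≤ 1 / 4 * r ^ 2 := mul_le_mul_of_nonneg_right c0 (sq_nonneg r)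
    have c2 : ℓ * r ≤ 1 / 2 * r := mul_le_mul_of_nonneg_right hl hr
    nlinarith [sq_nonneg r]
  unfold ratStep
  rw [norm_mul]
  calc _ ≤ 2 * (1 + r) ^ 2 * 2 := mul_le_mul h2 (h.inv h0 hl).1 (norm_nonneg _) (by positivity)
    _ = _ := by ring

end Gradient

/-! ### Differences of steps and of defects along a segment of parameters -/

/-- Closeness of two step parameters at relative distance `d`. -/
structure StepNear (ℓ r d α α' : ℝ) (κ y w κ' y' w' : ℂ) : Prop where
  small : StepSmall ℓ r α κ y w
  small' : StepSmall ℓ r α' κ' y' w'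
  a : |α - α'| ≤ ℓ * d * r
  k : ‖κ - κ'‖ ≤ ℓ ^ 2 * d
  y : ‖y - y'‖ ≤ ℓ ^ 2 * d
  w : ‖w - w'‖ ≤ ℓ ^ 2 * d

lemma norm_segment_le {E : Type*} [NormedAddCommGroup E] [NormedSpace ℝ E] {x x' : E} {b t : ℝ}
    (hx : ‖x‖ ≤ b) (hx' : ‖x'‖ ≤ b) (h0 : 0 ≤ t) (h1 : t ≤ 1) : ‖x' + t • (x - x')‖ ≤ b := by
  have e : x' + t • (x - x') = (1 - t) • x' + t • x := by
    rw [smul_sub, sub_smul, one_smul]; abel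
  rw [e]
  refine (norm_add_le _ _).trans ?_
  rw [norm_smul, norm_smul, Real.norm_of_nonneg h0, Real.norm_of_nonneg (by linarith)]
  nlinarith

section Segment

variable {ℓ r d α α' : ℝ} {κ y w κ' y' w' : ℂ}

lemma StepNear.segment (h : StepNear ℓ r d α α' κ y w κ' y' w') {t : ℝ} (h0 : 0 ≤ t) (h1 : t ≤ 1) :
    StepSmall ℓ r (α' + t * (α - α')) (κ' + t * (κ - κ')) (y' + t * (y - y')) (w' + t * (w - w')) where
  a := norm_segment_le (E := ℝ) h.small.a h.small'.a h0 h1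
  k := by simpa using norm_segment_le h.small.k h.small'.k h0 h1
  y := by simpa using norm_segment_le h.small.y h.small'.y h0 h1
  w := by simpa using norm_segment_le h.small.w h.small'.w h0 h1

lemma hasDerivAt_line (x x' : ℂ) (t : ℝ) :
    HasDerivAt (fun t : ℝ => x' + (t : ℂ) * (x - x')) (x - x') t := by
  have := ((hasDerivAt_id t).ofReal_comp.mul_const (x - x')).const_add x'
  simpa using this

lemma hasDerivAt_ratStep (u u' κ κ' y y' w w' : ℂ) (t : ℝ) (hy : 1 + (y' + t * (y - y')) ≠ 0)
    (hw : 1 + (w' + t * (w - w')) ≠ 0) :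
    HasDerivAt (fun t : ℝ => ratStep (u' + t * (u - u')) (κ' + t * (κ - κ')) (y' + t * (y - y'))
        (w' + t * (w - w')))
      ((u - u') * ((1 + (u' + t * (u - u'))) * ((1 + (y' + t * (y - y'))) * (1 + (w' + t * (w - w'))))⁻¹)
        + (κ - κ') * ((1 + (y' + t * (y - y'))) * (1 + (w' + t * (w - w'))))⁻¹
        - (y - y') * (ratStep (u' + t * (u - u')) (κ' + t * (κ - κ')) (y' + t * (y - y'))
          (w' + t * (w - w')) * (1 + (y' + t * (y - y')))⁻¹)
        - (w - w') * (ratStep (u' + t * (u - u')) (κ' + t * (κ - κ')) (y' + t * (y - y'))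
          (w' + t * (w - w')) * (1 + (w' + t * (w - w')))⁻¹)) t := by
  have hu := hasDerivAt_line u u' t
  have hk := hasDerivAt_line κ κ' t
  have hY := (hasDerivAt_line y y' t).const_add 1
  have hW := (hasDerivAt_line w w' t).const_add 1
  have hn := ((hu.const_add 1).add ((hu.pow 2).div_const 2)).add hk
  have := hn.mul ((hY.mul hW).inv (mul_ne_zero hy hw))
  refine this.congr_deriv ?_
  unfold ratStep
  simp only [Pi.add_apply, Pi.mul_apply, Pi.pow_apply, Pi.inv_apply]
  field_simp
  ring

lemma hasDerivAt_expStep (u u' κ κ' y y' w w' : ℂ) (t : ℝ) :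
    HasDerivAt (fun t : ℝ => expStep (u' + t * (u - u')) (κ' + t * (κ - κ')) (y' + t * (y - y'))
        (w' + t * (w - w')))
      (((u - u') + (κ - κ') - (y - y') - (w - w')) *
        expStep (u' + t * (u - u')) (κ' + t * (κ - κ')) (y' + t * (y - y')) (w' + t * (w - w'))) t := by
  have := (((hasDerivAt_line u u' t).add (hasDerivAt_line κ κ' t)).sub (hasDerivAt_line y y' t)).sub
    (hasDerivAt_line w w' t)
  refine this.cexp.congr_deriv ?_
  unfold expStep
  simp only [Pi.add_apply, Pi.sub_apply]
  ring

lemma segment_I (α α' t : ℝ) : -Complex.I * (α' : ℂ) + t * (-Complex.I * α - -Complex.I * α') =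
    -Complex.I * ((α' + t * (α - α') : ℝ) : ℂ) := by push_cast; ring

lemma norm_combination_le {p q s t a b c e : ℂ} {P Q S A B : ℝ} (hp : ‖p‖ ≤ P) (hq : ‖q‖ ≤ Q)
    (hs : ‖s‖ ≤ Q) (ht : ‖t‖ ≤ Q) (ha : ‖a‖ ≤ A) (hb : ‖b‖ ≤ B) (hc : ‖c‖ ≤ S) (he : ‖e‖ ≤ S) :
    ‖p * a + q * b - s * c - t * e‖ ≤ P * A + Q * B + Q * S + Q * S := by
  have hP := (norm_nonneg _).trans hp
  have hQ := (norm_nonneg _).trans hq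
  refine (norm_sub_le _ _).trans (add_le_add ((norm_sub_le _ _).trans (add_le_add
    ((norm_add_le _ _).trans (add_le_add ?_ ?_)) ?_)) ?_) <;> rw [norm_mul] <;> gcongr

lemma norm_I_sub (α α' : ℝ) : ‖-Complex.I * (α : ℂ) - -Complex.I * α'‖ = |α - α'| := by
  rw [← mul_sub, ← Complex.ofReal_sub, norm_mul, norm_neg, Complex.norm_I, one_mul, Complex.norm_real,
    Real.norm_eq_abs]

/-- Mean value inequality on the segment between the two parameter tuples. The factor `r + ℓ` lets
one estimate serve twice: it is of order `ℓ` for a random step and of order `ℓ ^ 2` for a mean step,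
where `r = 0`. -/
lemma StepNear.ratStep_sub_le (h : StepNear ℓ r d α α' κ y w κ' y' w') (hr : 0 ≤ r) (hd : 0 ≤ d)
    (h0 : 0 ≤ ℓ) (hl : ℓ ≤ 1 / 2) :
    ‖ratStep (-Complex.I * α) κ y w - ratStep (-Complex.I * α') κ' y' w'‖ ≤
      20 * ℓ * d * (r + ℓ) * (1 + r) ^ 2 := by
  have h4 : ℓ ^ 2 ≤ 1 / 4 := by nlinarith
  have key := norm_image_sub_le_of_norm_deriv_le_segment_01' (fun t ht =>
    (hasDerivAt_ratStep (-Complex.I * α) (-Complex.I * α') κ κ' y y' w w' t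
      (norm_inv_one_add_le h4 (h.segment ht.1 ht.2).y).1
      (norm_inv_one_add_le h4 (h.segment ht.1 ht.2).w).1).hasDerivWithinAt)
    (C := 20 * ℓ * d * (r + ℓ) * (1 + r) ^ 2) (fun t ht => by
      have hs := h.segment ht.1 ht.2.le
      simp only [segment_I]
      have i1 := hs.inv h0 hl
      have n1 := hs.norm_rat_num hr h0 hl
      have hα : ‖1 + -Complex.I * ((α' + t * (α - α') : ℝ) : ℂ)‖ ≤ 1 + r := by
        refine (norm_add_le _ _).trans ?_
        have := hs.a
        simp only [norm_one, norm_mul, norm_neg, Complex.norm_I, one_mul, Complex.norm_real,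
          Real.norm_eq_abs]
        nlinarith
      refine (norm_combination_le ((norm_I_sub α α').le.trans h.a) h.k h.y h.w (A := (1 + r) * 2) (B := 2)
        (S := 4 * (1 + r) ^ 2 * (4 / 3)) ?_ i1.1 ?_ ?_).trans ?_
      · rw [norm_mul]
        exact mul_le_mul hα i1.1 (norm_nonneg _) (by positivity)
      · rw [norm_mul]
        exact mul_le_mul n1 (norm_inv_one_add_le h4 hs.y).2 (norm_nonneg _) (by positivity)
      · rw [norm_mul]
        exact mul_le_mul n1 (norm_inv_one_add_le h4 hs.w).2 (norm_nonneg _) (by positivity)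
      · have e1 : ℓ * d * r * ((1 + r) * 2) ≤ 20 * (ℓ * d * r * (1 + r) ^ 2) := by
          have : (1 + r) * 2 ≤ 20 * (1 + r) ^ 2 := by nlinarith
          have := mul_le_mul_of_nonneg_left this (by positivity : 0 ≤ ℓ * d * r)
          linarith
        have e2 : ℓ ^ 2 * d * 2 ≤ 2 * (ℓ ^ 2 * d * (1 + r) ^ 2) := by
          have : (1 : ℝ) ≤ (1 + r) ^ 2 := by nlinarith
          have := mul_le_mul_of_nonneg_left this (by positivity : 0 ≤ 2 * (ℓ ^ 2 * d))
          linarith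
        have e3 : 0 ≤ ℓ ^ 2 * d * (1 + r) ^ 2 := by positivity
        nlinarith)
  simpa using key

/-- The same segment argument applied to `ratStep - expStep`, whose gradient is small by `grad_u`,
`grad_k` and `grad_y`. Two powers of `ℓ` are gained over `ratStep_sub_le`, which amounts to one
power of `k`. -/
lemma StepNear.defect_sub_le (h : StepNear ℓ r d α α' κ y w κ' y' w') (hr : 0 ≤ r) (hd : 0 ≤ d)
    (h0 : 0 ≤ ℓ) (hl : ℓ ≤ 1 / 2) :
    ‖(ratStep (-Complex.I * α) κ y w - expStep (-Complex.I * α) κ y w) -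
      (ratStep (-Complex.I * α') κ' y' w' - expStep (-Complex.I * α') κ' y' w')‖ ≤
      52 * ℓ ^ 3 * d * (r + ℓ) * (1 + r) ^ 2 := by
  have h4 : ℓ ^ 2 ≤ 1 / 4 := by nlinarith
  have key := norm_image_sub_le_of_norm_deriv_le_segment_01' (fun t ht =>
    ((hasDerivAt_ratStep (-Complex.I * α) (-Complex.I * α') κ κ' y y' w w' t
      (norm_inv_one_add_le h4 (h.segment ht.1 ht.2).y).1
      (norm_inv_one_add_le h4 (h.segment ht.1 ht.2).w).1).sub
      (hasDerivAt_expStep (-Complex.I * α) (-Complex.I * α') κ κ' y y' w w' t)).hasDerivWithinAt)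
    (C := 52 * ℓ ^ 3 * d * (r + ℓ) * (1 + r) ^ 2) (fun t ht => by
      have hs := h.segment ht.1 ht.2.le
      simp only [segment_I]
      have g1 := hs.grad_u hr h0 hl
      have g2 := hs.grad_k h0 hl
      have g3 := hs.grad_y hr h0 hl hs.y
      have g4 := hs.grad_y hr h0 hl hs.w
      have := norm_combination_le ((norm_I_sub α α').le.trans h.a) h.k h.y h.w g1 g2 g3 g4
      refine (le_of_eq ?_).trans (this.trans ?_)
      · congr 1; ring
      · have e2 : ℓ ^ 2 * d * (ℓ * r + 10 * ℓ ^ 2) ≤ 10 * (ℓ ^ 3 * d * (r + ℓ) * (1 + r) ^ 2) := by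
          have a1 : (1 : ℝ) ≤ (1 + r) ^ 2 := by nlinarith
          have := mul_le_mul_of_nonneg_left a1 (by positivity : 0 ≤ 10 * (ℓ ^ 3 * d * (r + ℓ)))
          nlinarith [(by positivity : 0 ≤ ℓ ^ 3 * d * r)]
        have e3 : ℓ ^ 2 * d * (16 * ℓ * (r + ℓ) * (1 + r)) ≤ 16 * (ℓ ^ 3 * d * (r + ℓ) * (1 + r) ^ 2) := by
          have a1 : 1 + r ≤ (1 + r) ^ 2 := by nlinarith
          have := mul_le_mul_of_nonneg_left a1 (by positivity : 0 ≤ 16 * (ℓ ^ 3 * d * (r + ℓ)))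
          nlinarith
        have e1 : ℓ * d * r * (10 * ℓ ^ 2 * (1 + r) ^ 2) ≤ 10 * (ℓ ^ 3 * d * (r + ℓ) * (1 + r) ^ 2) := by
          have := (by positivity : 0 ≤ ℓ ^ 3 * d * ℓ * (1 + r) ^ 2)
          nlinarith
        linarith)
  simpa using key

end Segment

/-! ### Amplification factors at a frequency and their moments -/

/-- The coefficients of the equation. -/
structure Coeffs where
  (μx μy ρx ρy ρ : ℝ)

/-- The standing ranges of the correlation parameters. -/
structure Coeffs.Valid (M : Coeffs) : Prop where
  x0 : 0 ≤ M.ρx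
  x1 : M.ρx < 1
  y0 : 0 ≤ M.ρy
  y1 : M.ρy < 1
  c0 : -1 ≤ M.ρ
  c1 : M.ρ ≤ 1

/-- Symbols of the first-order (`s`, `t`) and negated second-order (`σ`, `τ`) differences. -/
structure Sym where
  (s t σ τ : ℝ)

/-- The random phase of one step. -/
def noise (M : Coeffs) (k : ℝ) (p : Sym) (z : ℝ × ℝ) : ℝ :=
  √k * (√M.ρx * p.s) * z.1 + √k * (√M.ρy * p.t) * z.2

/-- The Itô correction of one step. -/
def itoCorr (M : Coeffs) (k : ℝ) (p : Sym) : ℝ := k / 2 * (M.ρx * p.s ^ 2 + M.ρy * p.t ^ 2)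

/-- The mean exponent of one step apart from the drift. -/
def crossCorr (M : Coeffs) (k : ℝ) (p : Sym) : ℝ := -(k * (M.ρ * (√M.ρx * √M.ρy * (p.s * p.t))))

/-- The symbol of an implicit factor minus one. -/
def impl (μ k s σ : ℝ) : ℂ := k * (σ / 2 + Complex.I * (μ * s))

/-- The amplification factor of the scheme in one step. -/
def ratF (M : Coeffs) (k : ℝ) (p : Sym) (z : ℝ × ℝ) : ℂ :=
  ratStep (-Complex.I * noise M k p z) (itoCorr M k p) (impl M.μx k p.s p.σ) (impl M.μy k p.t p.τ)

/-- The amplification factor of the equation in one step. -/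
def expF (M : Coeffs) (k : ℝ) (p : Sym) (z : ℝ × ℝ) : ℂ :=
  expStep (-Complex.I * noise M k p z) (itoCorr M k p) (impl M.μx k p.s p.σ) (impl M.μy k p.t p.τ)

@[fun_prop]
lemma measurable_noise (M : Coeffs) (k : ℝ) (p : Sym) : Measurable (noise M k p) := by
  unfold noise; fun_prop

@[fun_prop]
lemma measurable_ratF (M : Coeffs) (k : ℝ) (p : Sym) : Measurable (ratF M k p) := by
  unfold ratF ratStep; fun_prop

@[fun_prop]
lemma measurable_expF (M : Coeffs) (k : ℝ) (p : Sym) : Measurable (expF M k p) := by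
  unfold expF expStep; fun_prop

lemma norm_expF_eq (M : Coeffs) (k : ℝ) (p : Sym) (z : ℝ × ℝ) :
    ‖expF M k p z‖ = Real.exp (k / 2 * (M.ρx * p.s ^ 2 + M.ρy * p.t ^ 2) - k / 2 * (p.σ + p.τ)) := by
  unfold expF expStep impl itoCorr
  rw [Complex.norm_exp]
  congr 1
  simp [-Complex.ofReal_pow]
  ring

lemma norm_expF_sq (M : Coeffs) (k : ℝ) (p : Sym) (z : ℝ × ℝ) :
    ‖expF M k p z‖ ^ 2 = Real.exp (k * (M.ρx * p.s ^ 2 + M.ρy * p.t ^ 2) - k * (p.σ + p.τ)) := by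
  rw [norm_expF_eq, ← Real.exp_nat_mul]
  congr 1
  push_cast
  ring

section Mean

variable {M : Coeffs} {ν : Measure (ℝ × ℝ)}

/-- The variance of the random phase. The cross term separates from the Itô correction, so that
averaging one step leaves only `crossCorr`. -/
lemma noise_sq_add (hM : M.Valid) {k : ℝ} (hk : 0 ≤ k) (p : Sym) :
    (√k * (√M.ρx * p.s)) ^ 2 + (√k * (√M.ρy * p.t)) ^ 2 +
      2 * (√k * (√M.ρx * p.s)) * (√k * (√M.ρy * p.t)) * M.ρ =
      2 * itoCorr M k p - 2 * crossCorr M k p := by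
  have h1 : √k ^ 2 = k := Real.sq_sqrt hk
  have h2 : √M.ρx ^ 2 = M.ρx := Real.sq_sqrt hM.x0
  have h3 : √M.ρy ^ 2 = M.ρy := Real.sq_sqrt hM.y0
  unfold itoCorr crossCorr
  simp only [mul_pow, h1, h2, h3]
  linear_combination 2 * (√M.ρx * p.s) * (√M.ρy * p.t) * M.ρ * h1

lemma integral_noise (hν : CorrGauss M.ρ ν) (k : ℝ) (p : Sym) : ∫ z, noise M k p z ∂ν = 0 :=
  hν.integral_lin _ _

lemma integrable_noise_pow (hν : CorrGauss M.ρ ν) (k : ℝ) (p : Sym) (n : ℕ) :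
    Integrable (fun z => noise M k p z ^ n) ν :=
  hν.integrable_lin_pow _ _ n

lemma integrable_noise (hν : CorrGauss M.ρ ν) (k : ℝ) (p : Sym) : Integrable (noise M k p) ν := by
  simpa using integrable_noise_pow hν k p 1

lemma integral_noise_sq (hM : M.Valid) (hν : CorrGauss M.ρ ν) {k : ℝ} (hk : 0 ≤ k) (p : Sym) :
    ∫ z, noise M k p z ^ 2 ∂ν = 2 * itoCorr M k p - 2 * crossCorr M k p := by
  rw [← noise_sq_add hM hk]
  exact hν.integral_lin_sq hM.c0 hM.c1 _ _

lemma integral_noise_pow_four (hM : M.Valid) (hν : CorrGauss M.ρ ν) {k : ℝ} (hk : 0 ≤ k) (p : Sym) :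
    ∫ z, noise M k p z ^ 4 ∂ν = 3 * (2 * itoCorr M k p - 2 * crossCorr M k p) ^ 2 := by
  rw [← noise_sq_add hM hk]
  exact hν.integral_lin_pow_four hM.c0 hM.c1 _ _

lemma integrable_ratF (hν : CorrGauss M.ρ ν) (k : ℝ) (p : Sym) : Integrable (ratF M k p) ν := by
  have := hν.prob
  have h1 := (integrable_noise hν k p).ofReal (𝕜 := ℂ)
  have h2 := (integrable_noise_pow hν k p 2).ofReal (𝕜 := ℂ)
  have := ((((integrable_const (1 : ℂ)).add (h1.const_mul (-Complex.I))).add (h2.const_mul (-1 / 2))).add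
    (integrable_const ((itoCorr M k p : ℝ) : ℂ))).mul_const
      ((1 + impl M.μx k p.s p.σ) * (1 + impl M.μy k p.t p.τ))⁻¹
  refine this.congr (ae_of_all _ fun z => ?_)
  simp only [ratF, ratStep, Pi.add_apply]
  push_cast
  congr 3
  ring_nf
  simp; ring

/-- Averaging cancels the Itô correction against the mean of half the squared phase. What remains is
a noise-free step of the same rational form with `crossCorr` in place of `itoCorr`. Since
`integral_expF` produces the same parameters in the exponential step, mean defects are instances of
the deterministic estimates with `r = 0`. -/
lemma integral_ratF (hM : M.Valid) (hν : CorrGauss M.ρ ν) {k : ℝ} (hk : 0 ≤ k) (p : Sym) :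
    ∫ z, ratF M k p z ∂ν =
      ratStep (-Complex.I * (0 : ℝ)) (crossCorr M k p) (impl M.μx k p.s p.σ) (impl M.μy k p.t p.τ) := by
  have := hν.prob
  have h1 : Integrable (fun z => (noise M k p z : ℂ)) ν := (integrable_noise hν k p).ofReal
  have h2 : Integrable (fun z => ((noise M k p z ^ 2 : ℝ) : ℂ)) ν := (integrable_noise_pow hν k p 2).ofReal
  have e : ∀ z, ratF M k p z = (((1 + itoCorr M k p : ℝ) : ℂ) + (-Complex.I) * (noise M k p z : ℂ) +
      (-1 / 2) * ((noise M k p z ^ 2 : ℝ) : ℂ)) *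
      ((1 + impl M.μx k p.s p.σ) * (1 + impl M.μy k p.t p.τ))⁻¹ := by
    intro z
    simp only [ratF, ratStep]
    push_cast
    congr 1
    ring_nf
    simp; ring
  simp only [e]
  have i1 : Integrable (fun z => ((1 + itoCorr M k p : ℝ) : ℂ) + (-Complex.I) * (noise M k p z : ℂ)) ν :=
    (integrable_const _).add (h1.const_mul _)
  have e1 : ∫ z, (noise M k p z : ℂ) ∂ν = 0 := by
    rw [integral_complex_ofReal, integral_noise hν, Complex.ofReal_zero]
  have e2 : ∫ z, ((noise M k p z ^ 2 : ℝ) : ℂ) ∂ν = ((2 * itoCorr M k p - 2 * crossCorr M k p : ℝ) : ℂ) := by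
    rw [integral_complex_ofReal, integral_noise_sq hM hν hk]
  rw [integral_mul_const, integral_add i1 (h2.const_mul _), integral_add (integrable_const _) (h1.const_mul _),
    integral_const_mul, integral_const_mul, e1, e2]
  simp [ratStep]
  left; ring

lemma integrable_expF (hν : CorrGauss M.ρ ν) (k : ℝ) (p : Sym) : Integrable (expF M k p) ν := by
  have := hν.prob
  refine (integrable_const (Real.exp (k / 2 * (M.ρx * p.s ^ 2 + M.ρy * p.t ^ 2) - k / 2 * (p.σ + p.τ)))).mono'
    (by fun_prop) (ae_of_all _ fun z => (norm_expF_eq M k p z).le)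

lemma integral_expF (hM : M.Valid) (hν : CorrGauss M.ρ ν) {k : ℝ} (hk : 0 ≤ k) (p : Sym) :
    ∫ z, expF M k p z ∂ν =
      expStep (-Complex.I * (0 : ℝ)) (crossCorr M k p) (impl M.μx k p.s p.σ) (impl M.μy k p.t p.τ) := by
  have e : ∀ z, expF M k p z = Complex.exp (-Complex.I * (noise M k p z : ℝ)) *
      Complex.exp (itoCorr M k p - impl M.μx k p.s p.σ - impl M.μy k p.t p.τ) := by
    intro z
    rw [← Complex.exp_add]
    unfold expF expStep
    congr 1; ring
  simp only [e]
  have h := hν.integral_cexp_lin hM.c0 hM.c1 (√k * (√M.ρx * p.s)) (√k * (√M.ρy * p.t))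
  rw [noise_sq_add hM hk] at h
  rw [integral_mul_const]
  unfold noise
  rw [h, ← Complex.exp_add]
  unfold expStep
  congr 1; push_cast; ring

lemma norm_one_add_impl_sq (μ k s σ : ℝ) : ‖1 + impl μ k s σ‖ ^ 2 = (1 + k * σ / 2) ^ 2 + (k * (μ * s)) ^ 2 := by
  rw [← Complex.normSq_eq_norm_sq, Complex.normSq_apply]
  simp [impl]
  ring

lemma norm_ratF_sq (M : Coeffs) (k : ℝ) (p : Sym) (z : ℝ × ℝ) :
    ‖ratF M k p z‖ ^ 2 = ((1 + itoCorr M k p) ^ 2 - itoCorr M k p * noise M k p z ^ 2 +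
      noise M k p z ^ 4 / 4) *
      (‖1 + impl M.μx k p.s p.σ‖ ^ 2 * ‖1 + impl M.μy k p.t p.τ‖ ^ 2)⁻¹ := by
  unfold ratF ratStep
  rw [norm_mul, norm_inv, norm_mul, mul_pow, inv_pow, mul_pow ‖1 + impl _ _ _ _‖, ← Complex.normSq_eq_norm_sq,
    Complex.normSq_apply]
  congr 1
  simp [sq]
  ring

lemma integrable_norm_ratF_sq (hν : CorrGauss M.ρ ν) (k : ℝ) (p : Sym) :
    Integrable (fun z => ‖ratF M k p z‖ ^ 2) ν := by
  have := hν.prob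
  simp only [norm_ratF_sq]
  exact (((integrable_const _).sub ((integrable_noise_pow hν k p 2).const_mul _)).add
    ((integrable_noise_pow hν k p 4).div_const 4)).mul_const _

lemma integral_norm_ratF_sq (hM : M.Valid) (hν : CorrGauss M.ρ ν) {k : ℝ} (hk : 0 ≤ k) (p : Sym) :
    ∫ z, ‖ratF M k p z‖ ^ 2 ∂ν = ((1 + itoCorr M k p) ^ 2
      - itoCorr M k p * (2 * itoCorr M k p - 2 * crossCorr M k p)
      + 3 * (itoCorr M k p - crossCorr M k p) ^ 2) *
      (‖1 + impl M.μx k p.s p.σ‖ ^ 2 * ‖1 + impl M.μy k p.t p.τ‖ ^ 2)⁻¹ := by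
  have := hν.prob
  simp only [norm_ratF_sq]
  have i2 := integrable_noise_pow hν k p 2
  have i4 := integrable_noise_pow hν k p 4
  have i0 : Integrable (fun z => (1 + itoCorr M k p) ^ 2 - itoCorr M k p * noise M k p z ^ 2) ν :=
    (integrable_const _).sub (i2.const_mul _)
  rw [integral_mul_const, integral_add i0 (i4.div_const 4), integral_sub (integrable_const _) (i2.const_mul _),
    integral_const_mul, integral_div, integral_noise_sq hM hν hk, integral_noise_pow_four hM hν hk]
  simp
  left; ring

end Mean

/-! ### Mean-square stability of one step -/

/-- The frequency excess entering the mean-square stability bound. -/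
def excess (k : ℝ) (p : Sym) : ℝ :=
  k * p.σ + k * p.τ + (k * p.σ) ^ 2 / 4 + (k * p.τ) ^ 2 / 4 + k * p.σ * (k * p.τ)

/-- Mean-square stability of the scheme with the rate `lam`. -/
structure StableRate (lam ρx ρy ρ : ℝ) : Prop where
  pos : 0 < lam
  lt : lam < 1
  x : ρx ≤ lam
  y : ρy ≤ lam
  xx : 2 * ρx ^ 2 * (1 + 2 * |ρ|) ≤ lam
  yy : 2 * ρy ^ 2 * (1 + 2 * |ρ|) ≤ lam
  xy : 2 * ρx * ρy * (3 * ρ ^ 2 + 2 * |ρ| + 1) ≤ lam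

lemma exists_stableRate {ρx ρy ρ : ℝ} (hx : ρx < 1) (hy : ρy < 1)
    (h1 : 2 * ρx ^ 2 * (1 + 2 * |ρ|) < 1) (h2 : 2 * ρy ^ 2 * (1 + 2 * |ρ|) < 1)
    (h3 : 2 * ρx * ρy * (3 * ρ ^ 2 + 2 * |ρ| + 1) < 1) : ∃ lam, StableRate lam ρx ρy ρ := by
  -- The entry `1 / 2` serves only to make the rate positive.
  refine ⟨max (1 / 2) (max ρx (max ρy (max (2 * ρx ^ 2 * (1 + 2 * |ρ|)) (max (2 * ρy ^ 2 * (1 + 2 * |ρ|))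
    (2 * ρx * ρy * (3 * ρ ^ 2 + 2 * |ρ| + 1)))))), ?_, ?_, ?_, ?_, ?_, ?_, ?_⟩
  · exact lt_max_of_lt_left (by norm_num)
  · simp only [max_lt_iff]
    exact ⟨by norm_num, hx, hy, h1, h2, h3⟩
  all_goals simp only [le_max_iff]
  · exact Or.inr (Or.inl le_rfl)
  · exact Or.inr (Or.inr (Or.inl le_rfl))
  · exact Or.inr (Or.inr (Or.inr (Or.inl le_rfl)))
  · exact Or.inr (Or.inr (Or.inr (Or.inr (Or.inl le_rfl))))
  · exact Or.inr (Or.inr (Or.inr (Or.inr (Or.inr le_rfl))))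

section Stability

variable {M : Coeffs} {ν : Measure (ℝ × ℝ)} {lam : ℝ} {k : ℝ} {p : Sym}

lemma excess_nonneg (hk : 0 ≤ k) (hs : p.s ^ 2 ≤ p.σ) (ht : p.t ^ 2 ≤ p.τ) :
    k * p.σ + k * p.τ ≤ excess k p ∧ 0 ≤ k * p.σ + k * p.τ := by
  have h1 : 0 ≤ k * p.σ := mul_nonneg hk ((sq_nonneg _).trans hs)
  have h2 : 0 ≤ k * p.τ := mul_nonneg hk ((sq_nonneg _).trans ht)
  unfold excess
  constructor <;> nlinarith [mul_nonneg h1 h2]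

/-- With `A`, `B` the squared standard deviations contributed by the two noises, the left side is a
polynomial in `A` and `B` plus cross terms. Bounding twice the covariance by `|ρ| * (A + B)`, then
`A` by `ρx * k * σ` and `B` by `ρy * k * τ`, each monomial matches one monomial of `excess`, with
the coefficient bounded by one field of `StableRate`. -/
lemma numerator_le (hM : M.Valid) (hl : StableRate lam M.ρx M.ρy M.ρ) (hk : 0 ≤ k)
    (hs : p.s ^ 2 ≤ p.σ) (ht : p.t ^ 2 ≤ p.τ) :
    (1 + itoCorr M k p) ^ 2 - itoCorr M k p * (2 * itoCorr M k p - 2 * crossCorr M k p)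
      + 3 * (itoCorr M k p - crossCorr M k p) ^ 2
      ≤ 1 + lam * excess k p := by
  set x := √k * (√M.ρx * p.s) with hx
  set y := √k * (√M.ρy * p.t) with hy
  have h1 : √k ^ 2 = k := Real.sq_sqrt hk
  have h2 : √M.ρx ^ 2 = M.ρx := Real.sq_sqrt hM.x0
  have h3 : √M.ρy ^ 2 = M.ρy := Real.sq_sqrt hM.y0
  have ea : x ^ 2 = M.ρx * (k * p.s ^ 2) := by rw [hx, mul_pow, mul_pow, h1, h2]; ring
  have eb : y ^ 2 = M.ρy * (k * p.t ^ 2) := by rw [hy, mul_pow, mul_pow, h1, h3]; ring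
  have ei : itoCorr M k p = (x ^ 2 + y ^ 2) / 2 := by rw [ea, eb]; unfold itoCorr; ring
  have ec : crossCorr M k p = -(x * y * M.ρ) := by
    unfold crossCorr; rw [hx, hy]
    linear_combination (√M.ρx * p.s) * (√M.ρy * p.t) * M.ρ * h1
  set X := k * p.σ with hX
  set Y := k * p.τ with hY
  have hX0 : k * p.s ^ 2 ≤ X := mul_le_mul_of_nonneg_left hs hk
  have hY0 : k * p.t ^ 2 ≤ Y := mul_le_mul_of_nonneg_left ht hk
  have pX : 0 ≤ X := le_trans (by positivity) hX0
  have pY : 0 ≤ Y := le_trans (by positivity) hY0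
  have hA : x ^ 2 ≤ M.ρx * X := by rw [ea]; exact mul_le_mul_of_nonneg_left hX0 hM.x0
  have hB : y ^ 2 ≤ M.ρy * Y := by rw [eb]; exact mul_le_mul_of_nonneg_left hY0 hM.y0
  set A := x ^ 2 with hAd
  set B := y ^ 2 with hBd
  have pA : 0 ≤ A := sq_nonneg x
  have pB : 0 ≤ B := sq_nonneg y
  have hr := abs_nonneg M.ρ
  have cross : 2 * (x * y * M.ρ) ≤ |M.ρ| * (A + B) := by
    have e1 : x * y * M.ρ ≤ |x * y| * |M.ρ| := by rw [← abs_mul]; exact le_abs_self _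
    have e2 : 2 * |x * y| ≤ A + B := by
      rw [abs_mul]; nlinarith [sq_nonneg (|x| - |y|), sq_abs x, sq_abs y]
    nlinarith
  have main : (1 + itoCorr M k p) ^ 2 - itoCorr M k p * (2 * itoCorr M k p - 2 * crossCorr M k p)
      + 3 * (itoCorr M k p - crossCorr M k p) ^ 2 =
      1 + A + B + (A ^ 2 + B ^ 2) / 2 + A * B + (2 * (x * y * M.ρ)) * (A + B) + 3 * (A * B) * M.ρ ^ 2 := by
    rw [ei, ec, hAd, hBd]; ring
  rw [main]
  have c1 := mul_le_mul_of_nonneg_right cross (add_nonneg pA pB)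
  have qA : A ^ 2 ≤ M.ρx ^ 2 * X ^ 2 := by rw [← mul_pow]; exact pow_le_pow_left₀ pA hA 2
  have qB : B ^ 2 ≤ M.ρy ^ 2 * Y ^ 2 := by rw [← mul_pow]; exact pow_le_pow_left₀ pB hB 2
  have qAB : A * B ≤ M.ρx * M.ρy * (X * Y) := by
    calc A * B ≤ (M.ρx * X) * (M.ρy * Y) := mul_le_mul hA hB pB (mul_nonneg hM.x0 pX)
      _ = _ := by ring
  have f1 : M.ρx * X ≤ lam * X := mul_le_mul_of_nonneg_right hl.x pX
  have f2 : M.ρy * Y ≤ lam * Y := mul_le_mul_of_nonneg_right hl.y pY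
  have f3 : A ^ 2 * (1 / 2 + |M.ρ|) ≤ lam * (X ^ 2 / 4) := by
    calc _ ≤ M.ρx ^ 2 * X ^ 2 * (1 / 2 + |M.ρ|) := by gcongr
      _ = (2 * M.ρx ^ 2 * (1 + 2 * |M.ρ|)) * (X ^ 2 / 4) := by ring
      _ ≤ _ := mul_le_mul_of_nonneg_right hl.xx (by positivity)
  have f4 : B ^ 2 * (1 / 2 + |M.ρ|) ≤ lam * (Y ^ 2 / 4) := by
    calc _ ≤ M.ρy ^ 2 * Y ^ 2 * (1 / 2 + |M.ρ|) := by gcongr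
      _ = (2 * M.ρy ^ 2 * (1 + 2 * |M.ρ|)) * (Y ^ 2 / 4) := by ring
      _ ≤ _ := mul_le_mul_of_nonneg_right hl.yy (by positivity)
  -- Only half of the mixed condition is consumed here: the extra factor two enters through a
  -- quantity that is nonnegative.
  have f5 : A * B * (3 * M.ρ ^ 2 + 2 * |M.ρ| + 1) ≤ lam * (X * Y) := by
    calc _ ≤ M.ρx * M.ρy * (X * Y) * (3 * M.ρ ^ 2 + 2 * |M.ρ| + 1) := by gcongr
      _ ≤ (2 * M.ρx * M.ρy * (3 * M.ρ ^ 2 + 2 * |M.ρ| + 1)) * (X * Y) := by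
        have : 0 ≤ M.ρx * M.ρy * (X * Y) * (3 * M.ρ ^ 2 + 2 * |M.ρ| + 1) := by
          have := hM.x0; have := hM.y0; positivity
        linarith
      _ ≤ _ := mul_le_mul_of_nonneg_right hl.xy (by positivity)
  unfold excess
  rw [← hX, ← hY]
  linarith

end Stability

section Stability

variable {M : Coeffs} {ν : Measure (ℝ × ℝ)} {lam : ℝ} {k : ℝ} {p : Sym}

/-- The drift and the monomials of degree three and four only enlarge the denominator, so they are
discarded. The surviving part of the denominator is `1 + excess`, comparable with the bound of
`numerator_le`. -/
lemma integral_norm_ratF_sq_le (hM : M.Valid) (hν : CorrGauss M.ρ ν) (hl : StableRate lam M.ρx M.ρy M.ρ)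
    (hk : 0 ≤ k) (hs : p.s ^ 2 ≤ p.σ) (ht : p.t ^ 2 ≤ p.τ) :
    ∫ z, ‖ratF M k p z‖ ^ 2 ∂ν ≤ (1 + lam * excess k p) / (1 + excess k p) := by
  obtain ⟨h1, h2⟩ := excess_nonneg hk hs ht
  have hX : 0 ≤ k * p.σ := mul_nonneg hk ((sq_nonneg _).trans hs)
  have hY : 0 ≤ k * p.τ := mul_nonneg hk ((sq_nonneg _).trans ht)
  have pe : 0 ≤ excess k p := h2.trans h1
  rw [integral_norm_ratF_sq hM hν hk, div_eq_mul_inv]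
  have hden : 1 + excess k p ≤ ‖1 + impl M.μx k p.s p.σ‖ ^ 2 * ‖1 + impl M.μy k p.t p.τ‖ ^ 2 := by
    rw [norm_one_add_impl_sq, norm_one_add_impl_sq]
    calc 1 + excess k p ≤ (1 + k * p.σ / 2) ^ 2 * (1 + k * p.τ / 2) ^ 2 := by
          have e : (1 + k * p.σ / 2) ^ 2 * (1 + k * p.τ / 2) ^ 2 = 1 + excess k p +
            (k * p.σ) * (k * p.τ) ^ 2 / 4 + (k * p.σ) ^ 2 * (k * p.τ) / 4 + (k * p.σ) ^ 2 * (k * p.τ) ^ 2 / 16 := by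
            unfold excess; ring
          rw [e]
          have : 0 ≤ (k * p.σ) * (k * p.τ) ^ 2 / 4 + (k * p.σ) ^ 2 * (k * p.τ) / 4 +
            (k * p.σ) ^ 2 * (k * p.τ) ^ 2 / 16 := by positivity
          linarith
      _ ≤ _ := by
        gcongr <;> nlinarith [sq_nonneg (k * (M.μx * p.s)), sq_nonneg (k * (M.μy * p.t))]
  have hn := numerator_le hM hl hk hs ht
  have := hl.pos
  exact mul_le_mul hn (inv_anti₀ (by positivity) hden) (by positivity) (by positivity)

/-- The quotient is `1 - (1 - lam) * W / (1 + W)`, and here `1 + W ≤ 2`. -/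
lemma stable_quotient_le (hl0 : 0 < lam) (hl1 : lam < 1) {W : ℝ} (h0 : 0 ≤ W) (h1 : W ≤ 1) :
    (1 + lam * W) / (1 + W) ≤ Real.exp (-((1 - lam) / 2 * W)) := by
  refine le_trans ?_ (Real.add_one_le_exp _)
  rw [div_le_iff₀ (by linarith)]
  nlinarith [mul_nonneg (sub_nonneg.2 hl1.le) h0, mul_nonneg (mul_nonneg (sub_nonneg.2 hl1.le) h0) (sub_nonneg.2 h1)]

/-- The quotient decreases in `W` and takes this value at `W = 1`. This contraction factor, uniform
over high frequencies, is the source of `θ`. -/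
lemma stable_quotient_le' (hl1 : lam < 1) {W : ℝ} (h1 : 1 ≤ W) :
    (1 + lam * W) / (1 + W) ≤ (1 + lam) / 2 := by
  rw [div_le_div_iff₀ (by linarith) (by norm_num)]
  nlinarith [mul_nonneg (sub_nonneg.2 hl1.le) (sub_nonneg.2 h1)]

/-- Low-frequency decay of the second moment of one step of the scheme. -/
lemma integral_norm_ratF_sq_le_exp (hM : M.Valid) (hν : CorrGauss M.ρ ν) (hl : StableRate lam M.ρx M.ρy M.ρ)
    (hk : 0 ≤ k) (hs : p.s ^ 2 ≤ p.σ) (ht : p.t ^ 2 ≤ p.τ) (hW : excess k p ≤ 1) :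
    ∫ z, ‖ratF M k p z‖ ^ 2 ∂ν ≤ Real.exp (-((1 - lam) / 2 * (k * (p.σ + p.τ)))) := by
  obtain ⟨h1, h2⟩ := excess_nonneg hk hs ht
  refine (integral_norm_ratF_sq_le hM hν hl hk hs ht).trans
    ((stable_quotient_le hl.pos hl.lt (h2.trans h1) hW).trans ?_)
  apply Real.exp_le_exp.2
  have := hl.lt
  nlinarith

/-- Decay of the second moment of `N` steps of the scheme, for all frequencies. -/
lemma integral_norm_ratF_sq_pow_le (hM : M.Valid) (hν : CorrGauss M.ρ ν) (hl : StableRate lam M.ρx M.ρy M.ρ)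
    (hk : 0 ≤ k) (hs : p.s ^ 2 ≤ p.σ) (ht : p.t ^ 2 ≤ p.τ) :
    ∫ z, ‖ratF M k p z‖ ^ 2 ∂ν ≤ max (Real.exp (-((1 - lam) / 2 * (k * (p.σ + p.τ))))) ((1 + lam) / 2) := by
  by_cases hW : excess k p ≤ 1
  · exact le_max_of_le_left (integral_norm_ratF_sq_le_exp hM hν hl hk hs ht hW)
  · exact le_max_of_le_right ((integral_norm_ratF_sq_le hM hν hl hk hs ht).trans
      (stable_quotient_le' hl.lt (not_le.1 hW).le))

/-- For the exact evolution the noise enters only as a phase, so the decay holds pathwise and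
follows from `ρx, ρy ≤ lam` alone. -/
lemma norm_expF_sq_le (hl : StableRate lam M.ρx M.ρy M.ρ)
    (hk : 0 ≤ k) (hs : p.s ^ 2 ≤ p.σ) (ht : p.t ^ 2 ≤ p.τ) (z : ℝ × ℝ) :
    ‖expF M k p z‖ ^ 2 ≤ Real.exp (-((1 - lam) / 2 * (k * (p.σ + p.τ)))) := by
  rw [norm_expF_sq]
  apply Real.exp_le_exp.2
  have h1 : M.ρx * p.s ^ 2 ≤ lam * p.σ :=
    mul_le_mul hl.x hs (sq_nonneg _) hl.pos.le
  have h2 : M.ρy * p.t ^ 2 ≤ lam * p.τ :=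
    mul_le_mul hl.y ht (sq_nonneg _) hl.pos.le
  have h3 : 0 ≤ k * (p.σ + p.τ) := mul_nonneg hk (by nlinarith [sq_nonneg p.s, sq_nonneg p.t])
  have h4 : k * (M.ρx * p.s ^ 2 + M.ρy * p.t ^ 2) ≤ k * (lam * (p.σ + p.τ)) :=
    mul_le_mul_of_nonneg_left (by linarith) hk
  have := hl.lt
  nlinarith

end Stability

/-! ### Size of step parameters at frequencies bounded by `L` -/

/-- Symbols attached to frequencies of size at most `L`. -/
structure Sym.Bounded (p : Sym) (L : ℝ) : Prop where
  s : |p.s| ≤ L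
  t : |p.t| ≤ L
  s_sq : p.s ^ 2 ≤ p.σ
  t_sq : p.t ^ 2 ≤ p.τ
  σ : p.σ ≤ L ^ 2
  τ : p.τ ≤ L ^ 2

/-- Symbols at distance at most `e`. -/
structure Sym.Near (p p' : Sym) (e : ℝ) : Prop where
  s : |p.s - p'.s| ≤ e
  t : |p.t - p'.t| ≤ e
  σ : |p.σ - p'.σ| ≤ e
  τ : |p.τ - p'.τ| ≤ e

/-- A bound for the drift coefficients. -/
def Coeffs.size (M : Coeffs) : ℝ := 2 + |M.μx| + |M.μy|

/-- The scale of one step at frequencies of size `L`. -/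
def scale (M : Coeffs) (k L : ℝ) : ℝ := √k * (M.size * L ^ 2)

lemma Coeffs.two_le_size (M : Coeffs) : 2 ≤ M.size := by
  unfold Coeffs.size; linarith [abs_nonneg M.μx, abs_nonneg M.μy]

lemma scale_nonneg (M : Coeffs) (k L : ℝ) : 0 ≤ scale M k L := by
  have := M.two_le_size
  unfold scale; positivity

lemma scale_sq (M : Coeffs) {k : ℝ} (hk : 0 ≤ k) (L : ℝ) : scale M k L ^ 2 = k * (M.size ^ 2 * L ^ 4) := by
  unfold scale; rw [mul_pow, Real.sq_sqrt hk]; ring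

section Small

variable {M : Coeffs} {k L e : ℝ} {p p' : Sym}

lemma abs_noise_sub_le {a b c d r e : ℝ} (hr0 : 0 ≤ a) (hr1 : a ≤ 1) (hs0 : 0 ≤ b) (hs1 : b ≤ 1) (hr : 0 ≤ r)
    (h1 : |c| ≤ e) (h2 : |d| ≤ e) (z : ℝ × ℝ) :
    |r * (a * c) * z.1 + r * (b * d) * z.2| ≤ r * e * (|z.1| + |z.2|) := by
  have he := (abs_nonneg _).trans h1
  refine (abs_add_le _ _).trans ?_
  rw [abs_mul, abs_mul, abs_mul, abs_mul, abs_mul, abs_mul, abs_of_nonneg hr, abs_of_nonneg hr0,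
    abs_of_nonneg hs0]
  have h1' : a * |c| ≤ 1 * e := mul_le_mul hr1 h1 (abs_nonneg _) zero_le_one
  have h2' : b * |d| ≤ 1 * e := mul_le_mul hs1 h2 (abs_nonneg _) zero_le_one
  rw [mul_add]
  gcongr <;> linarith

lemma norm_impl_sub_le {μ k s s' σ σ' e : ℝ} (hk : 0 ≤ k) (hs : |s - s'| ≤ e) (hσ : |σ - σ'| ≤ e) :
    ‖impl μ k s σ - impl μ k s' σ'‖ ≤ k * ((1 + |μ|) * e) := by
  have e1 : impl μ k s σ - impl μ k s' σ' =
      k * (((σ - σ' : ℝ) : ℂ) / 2 + Complex.I * ((μ * (s - s') : ℝ) : ℂ)) := by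
    unfold impl; push_cast; ring
  rw [e1, norm_mul, Complex.norm_real, Real.norm_of_nonneg hk]
  refine mul_le_mul_of_nonneg_left ((norm_add_le _ _).trans ?_) hk
  rw [norm_div, norm_mul, Complex.norm_real, Complex.norm_real, Complex.norm_I, one_mul, norm_mul]
  have he := (abs_nonneg _).trans hs
  have h2 : ‖(2 : ℂ)‖ = 2 := by simp
  rw [h2]
  simp only [Real.norm_eq_abs]
  have := mul_le_mul_of_nonneg_left hs (abs_nonneg μ)
  nlinarith

lemma abs_sub_mul_le {a b c d e L : ℝ} (h1 : |a - c| ≤ e) (h2 : |b - d| ≤ e) (h3 : |b| ≤ L) (h4 : |c| ≤ L) :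
    |a * b - c * d| ≤ 2 * (L * e) := by
  have hL := (abs_nonneg _).trans h3
  have he := (abs_nonneg _).trans h1
  have : a * b - c * d = (a - c) * b + c * (b - d) := by ring
  rw [this]
  refine (abs_add_le _ _).trans ?_
  rw [abs_mul, abs_mul]
  have i1 := mul_le_mul h1 h3 (abs_nonneg _) he
  have i2 := mul_le_mul h4 h2 (abs_nonneg _) hL
  linarith

lemma abs_itoCorr_sub_le (hM : M.Valid) (hk : 0 ≤ k) (hb : p.Bounded L) (hb' : p'.Bounded L) (hn : p.Near p' e) :
    |itoCorr M k p - itoCorr M k p'| ≤ k * (2 * (L * e)) := by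
  have e1 : itoCorr M k p - itoCorr M k p' =
      k * ((M.ρx * (p.s * p.s - p'.s * p'.s) + M.ρy * (p.t * p.t - p'.t * p'.t)) / 2) := by
    unfold itoCorr; ring
  rw [e1, abs_mul, abs_of_nonneg hk]
  refine mul_le_mul_of_nonneg_left ?_ hk
  have a1 := abs_sub_mul_le hn.s hn.s hb.s hb'.s
  have a2 := abs_sub_mul_le hn.t hn.t hb.t hb'.t
  have he := (abs_nonneg _).trans hn.s
  have hL := (abs_nonneg _).trans hb.s
  rw [abs_div, abs_two, div_le_iff₀ (by norm_num)]
  refine (abs_add_le _ _).trans ?_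
  rw [abs_mul, abs_mul, abs_of_nonneg hM.x0, abs_of_nonneg hM.y0]
  have b1 := mul_le_mul hM.x1.le a1 (abs_nonneg _) zero_le_one
  have b2 := mul_le_mul hM.y1.le a2 (abs_nonneg _) zero_le_one
  linarith

lemma abs_crossCorr_sub_le (hM : M.Valid) (hk : 0 ≤ k) (hb : p.Bounded L) (hb' : p'.Bounded L)
    (hn : p.Near p' e) : |crossCorr M k p - crossCorr M k p'| ≤ k * (2 * (L * e)) := by
  have e1 : crossCorr M k p - crossCorr M k p' =
      k * (-(M.ρ * (√M.ρx * √M.ρy * (p.s * p.t - p'.s * p'.t)))) := by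
    unfold crossCorr; ring
  rw [e1, abs_mul, abs_of_nonneg hk, abs_neg]
  refine mul_le_mul_of_nonneg_left ?_ hk
  have a1 := abs_sub_mul_le hn.s hn.t hb.t hb'.s
  rw [abs_mul, abs_mul, abs_mul, abs_of_nonneg (Real.sqrt_nonneg _), abs_of_nonneg (Real.sqrt_nonneg _)]
  have r1 : |M.ρ| ≤ 1 := abs_le.2 ⟨hM.c0, hM.c1⟩
  have r2 : √M.ρx ≤ 1 := Real.sqrt_le_one.2 hM.x1.le
  have r3 : √M.ρy ≤ 1 := Real.sqrt_le_one.2 hM.y1.le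
  have r4 : √M.ρx * √M.ρy ≤ 1 := mul_le_one₀ r2 (Real.sqrt_nonneg _) r3
  have r5 : |M.ρ| * (√M.ρx * √M.ρy) ≤ 1 := mul_le_one₀ r1 (by positivity) r4
  rw [← mul_assoc]
  exact (mul_le_of_le_one_left (abs_nonneg _) r5).trans a1

/-- The zero frequency. -/
def Sym.zero : Sym := ⟨0, 0, 0, 0⟩

lemma noise_sub (M : Coeffs) (k : ℝ) (p p' : Sym) (z : ℝ × ℝ) : noise M k p z - noise M k p' z =
    √k * (√M.ρx * (p.s - p'.s)) * z.1 + √k * (√M.ρy * (p.t - p'.t)) * z.2 := by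
  unfold noise; ring

lemma noise_zero (M : Coeffs) (k : ℝ) (z : ℝ × ℝ) : noise M k Sym.zero z = 0 := by simp [noise, Sym.zero]
lemma itoCorr_zero (M : Coeffs) (k : ℝ) : itoCorr M k Sym.zero = 0 := by simp [itoCorr, Sym.zero]
lemma crossCorr_zero (M : Coeffs) (k : ℝ) : crossCorr M k Sym.zero = 0 := by simp [crossCorr, Sym.zero]
lemma impl_zero (μ k : ℝ) : impl μ k 0 0 = 0 := by simp [impl]

/-- The definition of `scale` is generous so that one quantity dominates the noise with one power,
and the Itô term, the cross term and both implicit factors with two powers, including their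
variation under a change of symbol of size `e`. -/
lemma scale_bounds (hk : 0 ≤ k) (hL : 1 ≤ L) (he : 0 ≤ e) :
    √k * e ≤ scale M k L * e ∧ k * (2 * (L * e)) ≤ scale M k L ^ 2 * e ∧
      k * ((1 + |M.μx|) * e) ≤ scale M k L ^ 2 * e ∧ k * ((1 + |M.μy|) * e) ≤ scale M k L ^ 2 * e := by
  have hK := M.two_le_size
  have hKx : 1 + |M.μx| ≤ M.size := by unfold Coeffs.size; linarith [abs_nonneg M.μy]
  have hKy : 1 + |M.μy| ≤ M.size := by unfold Coeffs.size; linarith [abs_nonneg M.μx]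
  have hL2 : 1 ≤ L ^ 2 := one_le_pow₀ hL
  have hL4 : 1 ≤ L ^ 4 := one_le_pow₀ hL
  have hLL : L ≤ L ^ 4 := by nlinarith [le_self_pow₀ hL (by norm_num : (4 : ℕ) ≠ 0)]
  have hK2 : M.size ≤ M.size ^ 2 := by nlinarith
  rw [scale_sq M hk]
  refine ⟨?_, ?_, ?_, ?_⟩
  · unfold scale
    have : 1 ≤ M.size * L ^ 2 := by nlinarith
    have : √k * 1 ≤ √k * (M.size * L ^ 2) := mul_le_mul_of_nonneg_left this (Real.sqrt_nonneg _)
    rw [mul_one] at this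
    exact mul_le_mul_of_nonneg_right this he
  · have : 2 * L ≤ M.size ^ 2 * L ^ 4 := by nlinarith
    calc k * (2 * (L * e)) = k * (2 * L) * e := by ring
      _ ≤ _ := by gcongr
  · have : 1 + |M.μx| ≤ M.size ^ 2 * L ^ 4 := by nlinarith
    calc _ = k * (1 + |M.μx|) * e := by ring
      _ ≤ _ := by gcongr
  · have : 1 + |M.μy| ≤ M.size ^ 2 * L ^ 4 := by nlinarith
    calc _ = k * (1 + |M.μy|) * e := by ring
      _ ≤ _ := by gcongr

lemma scale_bounds_diam (hk : 0 ≤ k) (hL : 1 ≤ L) :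
    √k * L ≤ scale M k L ∧ k * L ^ 2 ≤ scale M k L ^ 2 ∧
      k * ((1 + |M.μx|) * L ^ 2) ≤ scale M k L ^ 2 ∧ k * ((1 + |M.μy|) * L ^ 2) ≤ scale M k L ^ 2 := by
  have hK := M.two_le_size
  have hKx : 1 + |M.μx| ≤ M.size := by unfold Coeffs.size; linarith [abs_nonneg M.μy]
  have hKy : 1 + |M.μy| ≤ M.size := by unfold Coeffs.size; linarith [abs_nonneg M.μx]
  have hL2 : L ≤ L ^ 2 := by nlinarith
  have hL4 : L ^ 2 ≤ L ^ 4 := by nlinarith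
  have hK2 : M.size ≤ M.size ^ 2 := by nlinarith
  rw [scale_sq M hk]
  unfold scale
  have h1 : 1 * L ^ 2 ≤ M.size ^ 2 * L ^ 4 := by gcongr; nlinarith
  refine ⟨?_, ?_, ?_, ?_⟩
  · gcongr; nlinarith
  · rw [one_mul] at h1; gcongr
  · gcongr; linarith
  · gcongr; linarith

lemma stepSmall (hM : M.Valid) (hk : 0 ≤ k) (hL : 1 ≤ L) (hb : p.Bounded L) (z : ℝ × ℝ) :
    StepSmall (scale M k L) (|z.1| + |z.2|) (noise M k p z) (itoCorr M k p) (impl M.μx k p.s p.σ)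
      (impl M.μy k p.t p.τ) := by
  obtain ⟨h1, h2, h3, h4⟩ := scale_bounds_diam (M := M) hk hL
  have hL0 : 0 ≤ L := by linarith
  have hL2 : L ≤ L ^ 2 := by nlinarith
  have s2 : |p.s| ≤ L ^ 2 := hb.s.trans hL2
  have t2 : |p.t| ≤ L ^ 2 := hb.t.trans hL2
  have σ2 : |p.σ| ≤ L ^ 2 := by rw [abs_of_nonneg ((sq_nonneg _).trans hb.s_sq)]; exact hb.σ
  have τ2 : |p.τ| ≤ L ^ 2 := by rw [abs_of_nonneg ((sq_nonneg _).trans hb.t_sq)]; exact hb.τ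
  constructor
  · refine (abs_noise_sub_le (Real.sqrt_nonneg _) (Real.sqrt_le_one.2 hM.x1.le) (Real.sqrt_nonneg _)
      (Real.sqrt_le_one.2 hM.y1.le) (Real.sqrt_nonneg k) hb.s hb.t z).trans ?_
    gcongr
  · rw [Complex.norm_real, Real.norm_eq_abs]
    unfold itoCorr
    have a1 : M.ρx * p.s ^ 2 ≤ 1 * L ^ 2 := mul_le_mul hM.x1.le (hb.s_sq.trans hb.σ) (sq_nonneg _) zero_le_one
    have a2 : M.ρy * p.t ^ 2 ≤ 1 * L ^ 2 := mul_le_mul hM.y1.le (hb.t_sq.trans hb.τ) (sq_nonneg _) zero_le_one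
    have := hM.x0
    have := hM.y0
    rw [abs_of_nonneg (by positivity)]
    refine le_trans ?_ h2
    nlinarith
  · have := norm_impl_sub_le (μ := M.μx) (s' := 0) (σ' := 0) hk (by simpa using s2) (by simpa using σ2)
    rw [impl_zero, sub_zero] at this
    exact this.trans h3
  · have := norm_impl_sub_le (μ := M.μy) (s' := 0) (σ' := 0) hk (by simpa using t2) (by simpa using τ2)
    rw [impl_zero, sub_zero] at this
    exact this.trans h4

/-- The averaged step carries no noise, hence amplitude `0`; this is what later upgrades `ℓ` to `ℓ ^
2` in the mean estimates. -/
lemma meanSmall (hM : M.Valid) (hk : 0 ≤ k) (hL : 1 ≤ L) (hb : p.Bounded L) :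
    StepSmall (scale M k L) 0 0 (crossCorr M k p) (impl M.μx k p.s p.σ) (impl M.μy k p.t p.τ) := by
  have h := stepSmall hM hk hL hb (0, 0)
  refine ⟨by simp, ?_, h.y, h.w⟩
  obtain ⟨_, h2, _, _⟩ := scale_bounds_diam (M := M) hk hL
  refine le_trans ?_ h2
  rw [Complex.norm_real, Real.norm_eq_abs]
  unfold crossCorr
  have r1 : |M.ρ| ≤ 1 := abs_le.2 ⟨hM.c0, hM.c1⟩
  have r2 : √M.ρx ≤ 1 := Real.sqrt_le_one.2 hM.x1.le
  have r3 : √M.ρy ≤ 1 := Real.sqrt_le_one.2 hM.y1.le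
  have r4 : √M.ρx * √M.ρy ≤ 1 := mul_le_one₀ r2 (Real.sqrt_nonneg _) r3
  have r5 : |M.ρ| * (√M.ρx * √M.ρy) ≤ 1 := mul_le_one₀ r1 (by positivity) r4
  rw [abs_neg, abs_mul, abs_of_nonneg hk, abs_mul, abs_mul, abs_mul, abs_mul,
    abs_of_nonneg (Real.sqrt_nonneg _), abs_of_nonneg (Real.sqrt_nonneg _), ← mul_assoc |M.ρ|]
  refine mul_le_mul_of_nonneg_left ((mul_le_of_le_one_left (by positivity) r5).trans ?_) hk
  rw [sq]
  exact mul_le_mul hb.s hb.t (abs_nonneg _) (by linarith)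

lemma stepNear (hM : M.Valid) (hk : 0 ≤ k) (hL : 1 ≤ L) (hb : p.Bounded L) (hb' : p'.Bounded L)
    (hn : p.Near p' e) (z : ℝ × ℝ) :
    StepNear (scale M k L) (|z.1| + |z.2|) e (noise M k p z) (noise M k p' z) (itoCorr M k p)
      (impl M.μx k p.s p.σ) (impl M.μy k p.t p.τ) (itoCorr M k p') (impl M.μx k p'.s p'.σ)
      (impl M.μy k p'.t p'.τ) := by
  obtain ⟨h1, h2, h3, h4⟩ := scale_bounds (M := M) (L := L) hk hL ((abs_nonneg _).trans hn.s)
  refine ⟨stepSmall hM hk hL hb z, stepSmall hM hk hL hb' z, ?_, ?_, ?_, ?_⟩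
  · rw [noise_sub]
    refine (abs_noise_sub_le (Real.sqrt_nonneg _) (Real.sqrt_le_one.2 hM.x1.le) (Real.sqrt_nonneg _)
      (Real.sqrt_le_one.2 hM.y1.le) (Real.sqrt_nonneg k) hn.s hn.t z).trans ?_
    gcongr
  · rw [← Complex.ofReal_sub, Complex.norm_real, Real.norm_eq_abs]
    exact (abs_itoCorr_sub_le hM hk hb hb' hn).trans h2
  · exact (norm_impl_sub_le hk hn.s hn.σ).trans h3
  · exact (norm_impl_sub_le hk hn.t hn.τ).trans h4

lemma meanNear (hM : M.Valid) (hk : 0 ≤ k) (hL : 1 ≤ L) (hb : p.Bounded L) (hb' : p'.Bounded L)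
    (hn : p.Near p' e) :
    StepNear (scale M k L) 0 e 0 0 (crossCorr M k p)
      (impl M.μx k p.s p.σ) (impl M.μy k p.t p.τ) (crossCorr M k p') (impl M.μx k p'.s p'.σ)
      (impl M.μy k p'.t p'.τ) := by
  have h := stepNear hM hk hL hb hb' hn (0, 0)
  obtain ⟨h1, h2, h3, h4⟩ := scale_bounds (M := M) (L := L) hk hL ((abs_nonneg _).trans hn.s)
  refine ⟨meanSmall hM hk hL hb, meanSmall hM hk hL hb', by simp, ?_, h.y, h.w⟩
  rw [← Complex.ofReal_sub, Complex.norm_real, Real.norm_eq_abs]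
  exact (abs_crossCorr_sub_le hM hk hb hb' hn).trans h2

/-- A small step lies at relative distance one from the trivial step, so bounds for a single step
are the special case of bounds for differences. -/
lemma StepSmall.near_zero {ℓ r α : ℝ} {κ y w : ℂ} (h : StepSmall ℓ r α κ y w) :
    StepNear ℓ r 1 α 0 κ y w 0 0 0 := by
  have hr := (abs_nonneg _).trans h.a
  refine ⟨h, ⟨by simpa using hr, ?_, ?_, ?_⟩, ?_, ?_, ?_, ?_⟩
  · simpa using sq_nonneg ℓ
  · simpa using sq_nonneg ℓ
  · simpa using sq_nonneg ℓ
  · simpa using h.a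
  · simpa using h.k
  · simpa using h.y
  · simpa using h.w

end Small

/-! ### Mean and second moment of one-step differences -/

/-- A step function of size `ε` on the diffusive scale: mean `O(k ε)`, second moment `O(k ε²)`. -/
structure StepSize (ν : Measure (ℝ × ℝ)) (k ε : ℝ) (f : ℝ × ℝ → ℂ) : Prop where
  meas : Measurable f
  int : Integrable (fun z => ‖f z‖ ^ 2) ν
  mean : ‖∫ z, f z ∂ν‖ ≤ k * ε
  sq : ∫ z, ‖f z‖ ^ 2 ∂ν ≤ k * ε ^ 2

section StepSize

variable {M : Coeffs} {ν : Measure (ℝ × ℝ)} {k L d : ℝ} {p p' : Sym}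

lemma secondMoment_of_cubic_bound {ρ : ℝ} (hν : CorrGauss ρ ν) {f : ℝ × ℝ → ℂ} (hf : Measurable f) {b : ℝ}
    (h : ∀ z, ‖f z‖ ≤ b * (1 + (|z.1| + |z.2|)) ^ 3) :
    Integrable (fun z => ‖f z‖ ^ 2) ν ∧ ∫ z, ‖f z‖ ^ 2 ∂ν ≤ b ^ 2 * CorrGauss.momentConst := by
  have hb : ∀ z, ‖f z‖ ^ 2 ≤ b ^ 2 * (1 + |z.1| + |z.2|) ^ 6 := fun z => by
    calc ‖f z‖ ^ 2 ≤ (b * (1 + (|z.1| + |z.2|)) ^ 3) ^ 2 := pow_le_pow_left₀ (norm_nonneg _) (h z) 2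
      _ = _ := by ring
  have hi := hν.integrable_one_add_abs_pow.const_mul (b ^ 2)
  have h1 : Integrable (fun z => ‖f z‖ ^ 2) ν := by
    refine hi.mono' (by fun_prop) (ae_of_all _ fun z => ?_)
    rw [Real.norm_of_nonneg (by positivity)]
    exact hb z
  refine ⟨h1, (integral_mono h1 hi hb).trans ?_⟩
  rw [integral_const_mul]
  exact mul_le_mul_of_nonneg_left hν.integral_one_add_abs_pow_le (sq_nonneg _)

/-- Two symbols whose steps are at relative distance `d`, pathwise and in the mean. -/
structure NearPair (M : Coeffs) (k L d : ℝ) (p p' : Sym) : Prop where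
  step : ∀ z : ℝ × ℝ, StepNear (scale M k L) (|z.1| + |z.2|) d (noise M k p z) (noise M k p' z)
    (itoCorr M k p) (impl M.μx k p.s p.σ) (impl M.μy k p.t p.τ) (itoCorr M k p') (impl M.μx k p'.s p'.σ)
    (impl M.μy k p'.t p'.τ)
  mean : StepNear (scale M k L) 0 d 0 0 (crossCorr M k p)
    (impl M.μx k p.s p.σ) (impl M.μy k p.t p.τ) (crossCorr M k p') (impl M.μx k p'.s p'.σ)
    (impl M.μy k p'.t p'.τ)
  pos : 0 < d

lemma nearPair_of_near (hM : M.Valid) (hk : 0 ≤ k) (hL : 1 ≤ L) (hb : p.Bounded L) (hb' : p'.Bounded L)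
    (hn : p.Near p' d) (hd : 0 < d) : NearPair M k L d p p' :=
  ⟨stepNear hM hk hL hb hb' hn, meanNear hM hk hL hb hb' hn, hd⟩

lemma nearPair_zero (hM : M.Valid) (hk : 0 ≤ k) (hL : 1 ≤ L) (hb : p.Bounded L) :
    NearPair M k L 1 p Sym.zero := by
  refine ⟨fun z => ?_, ?_, one_pos⟩
  · rw [noise_zero, itoCorr_zero]
    simpa [Sym.zero, impl_zero] using (stepSmall hM hk hL hb z).near_zero
  · rw [crossCorr_zero]
    simpa [Sym.zero, impl_zero] using (meanSmall hM hk hL hb).near_zero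

/-- The square of the scale per unit time. -/
def rate (M : Coeffs) (L : ℝ) : ℝ := M.size ^ 2 * L ^ 4

lemma one_le_rate (M : Coeffs) (hL : 1 ≤ L) : 1 ≤ rate M L := by
  have := M.two_le_size
  unfold rate
  exact one_le_mul_of_one_le_of_one_le (one_le_pow₀ (by linarith)) (one_le_pow₀ hL)

lemma cubic_bound (r : ℝ) {ℓ : ℝ} (hl : ℓ ≤ 1 / 2) : (r + ℓ) * (1 + r) ^ 2 ≤ (1 + r) ^ 3 := by
  have : (r + ℓ) * (1 + r) ^ 2 ≤ (1 + r) * (1 + r) ^ 2 :=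
    mul_le_mul_of_nonneg_right (by linarith) (sq_nonneg _)
  linarith [this, (by ring : (1 + r) * (1 + r) ^ 2 = (1 + r) ^ 3)]

/-- The constant in the step estimates. -/
def stepConst : ℝ := 72 * CorrGauss.momentConst

lemma le_stepConst : 72 ≤ stepConst := by
  have := CorrGauss.one_le_momentConst
  unfold stepConst; linarith

lemma le_stepConst_sq : 72 ^ 2 * CorrGauss.momentConst ≤ stepConst ^ 2 := by
  have := CorrGauss.one_le_momentConst
  unfold stepConst; nlinarith

/-- The pathwise bound of order `ℓ * d` yields the second moment, and the noise-free bound of order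
`ℓ ^ 2 * d` yields the mean, with `ℓ ^ 2 = k * rate`. -/
lemma NearPair.ratF_sub (h : NearPair M k L d p p') (hM : M.Valid) (hν : CorrGauss M.ρ ν) (hk : 0 ≤ k)
    (hL : 1 ≤ L) (hl : scale M k L ≤ 1 / 2) :
    StepSize ν k (stepConst * rate M L * d) (fun z => ratF M k p z - ratF M k p' z) := by
  have h0 := scale_nonneg M k L
  have hs := scale_sq M hk L
  have hd := h.pos
  have hm : Measurable fun z => ratF M k p z - ratF M k p' z := by fun_prop
  have hR := one_le_rate M hL
  have hb := secondMoment_of_cubic_bound hν hm (b := 72 * scale M k L * d) fun z => by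
    have hr : 0 ≤ |z.1| + |z.2| := by positivity
    refine ((h.step z).ratStep_sub_le hr hd.le h0 hl).trans ?_
    have := mul_le_mul_of_nonneg_left (cubic_bound (|z.1| + |z.2|) hl) (by positivity : 0 ≤ 20 * scale M k L * d)
    have : 0 ≤ scale M k L * d * (1 + (|z.1| + |z.2|)) ^ 3 := by positivity
    nlinarith
  refine ⟨hm, hb.1, ?_, hb.2.trans ?_⟩
  · rw [integral_sub (integrable_ratF hν _ _) (integrable_ratF hν _ _), integral_ratF hM hν hk,
      integral_ratF hM hν hk]
    refine (h.mean.ratStep_sub_le le_rfl hd.le h0 hl).trans ?_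
    have e : 20 * scale M k L * d * (0 + scale M k L) * (1 + 0) ^ 2 = 20 * (k * rate M L * d) := by
      unfold rate; rw [← mul_assoc] at hs; linear_combination 20 * d * hs
    rw [e]
    have : 0 ≤ k * rate M L * d := by positivity
    nlinarith [le_stepConst]
  · have e : (72 * scale M k L * d) ^ 2 * CorrGauss.momentConst =
      (72 ^ 2 * CorrGauss.momentConst) * (k * rate M L * d ^ 2) := by
      unfold rate; linear_combination 72 ^ 2 * d ^ 2 * CorrGauss.momentConst * hs
    rw [e]
    calc _ ≤ stepConst ^ 2 * (k * (rate M L ^ 2) * d ^ 2) := by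
          gcongr
          · exact le_stepConst_sq
          · nlinarith
      _ = _ := by ring

/-- The mean defect is of order `ℓ ^ 4 * d`, two powers of `k`, and its second moment of order `ℓ ^
6 * d ^ 2`, three powers of `k`. On the diffusive scale this is a step of size proportional to `k`,
which is why the scheme converges with order one in time. -/
lemma NearPair.defect_sub (h : NearPair M k L d p p') (hM : M.Valid) (hν : CorrGauss M.ρ ν) (hk : 0 ≤ k)
    (hL : 1 ≤ L) (hl : scale M k L ≤ 1 / 2) :
    StepSize ν k (stepConst * (k * rate M L ^ 2) * d)
      (fun z => (ratF M k p z - expF M k p z) - (ratF M k p' z - expF M k p' z)) := by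
  have h0 := scale_nonneg M k L
  have hs : scale M k L ^ 2 = k * rate M L := scale_sq M hk L
  have hd := h.pos
  have hm : Measurable fun z => (ratF M k p z - expF M k p z) - (ratF M k p' z - expF M k p' z) := by
    fun_prop
  have hR := one_le_rate M hL
  have hb := secondMoment_of_cubic_bound hν hm (b := 72 * scale M k L ^ 3 * d) fun z => by
    have hr : 0 ≤ |z.1| + |z.2| := by positivity
    refine ((h.step z).defect_sub_le hr hd.le h0 hl).trans ?_
    have := mul_le_mul_of_nonneg_left (cubic_bound (|z.1| + |z.2|) hl) (by positivity : 0 ≤ 52 * scale M k L ^ 3 * d)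
    have : 0 ≤ scale M k L ^ 3 * d * (1 + (|z.1| + |z.2|)) ^ 3 := by positivity
    nlinarith
  refine ⟨hm, hb.1, ?_, hb.2.trans ?_⟩
  · have i1 := integrable_ratF hν k p
    have i2 := integrable_expF hν k p
    have i3 := integrable_ratF hν k p'
    have i4 := integrable_expF hν k p'
    rw [integral_sub (by exact i1.sub i2) (by exact i3.sub i4), integral_sub i1 i2, integral_sub i3 i4,
      integral_ratF hM hν hk, integral_ratF hM hν hk, integral_expF hM hν hk, integral_expF hM hν hk]
    refine (h.mean.defect_sub_le le_rfl hd.le h0 hl).trans ?_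
    have e : 52 * scale M k L ^ 3 * d * (0 + scale M k L) * (1 + 0) ^ 2 = 52 * (k * (k * rate M L ^ 2) * d) := by
      linear_combination 52 * d * (scale M k L ^ 2 + k * rate M L) * hs
    rw [e]
    have : 0 ≤ k * (k * rate M L ^ 2) * d := by positivity
    nlinarith [le_stepConst]
  · have e : (72 * scale M k L ^ 3 * d) ^ 2 * CorrGauss.momentConst =
      (72 ^ 2 * CorrGauss.momentConst) * (k * (k ^ 2 * rate M L ^ 3) * d ^ 2) := by
      have : (scale M k L ^ 2) ^ 3 = (k * rate M L) ^ 3 := by rw [hs]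
      linear_combination 72 ^ 2 * d ^ 2 * CorrGauss.momentConst * this
    rw [e]
    calc _ ≤ stepConst ^ 2 * (k * (k ^ 2 * rate M L ^ 4) * d ^ 2) := by
          gcongr
          · exact le_stepConst_sq
          · norm_num
      _ = _ := by ring

/-- The exponential factor is the rational one minus the defect, so its variation is inherited from
the two preceding estimates. -/
lemma NearPair.expF_sub (h : NearPair M k L d p p') (hM : M.Valid) (hν : CorrGauss M.ρ ν) (hk : 0 ≤ k)
    (hL : 1 ≤ L) (hl : scale M k L ≤ 1 / 2) :
    StepSize ν k (stepConst * rate M L * d) (fun z => expF M k p z - expF M k p' z) := by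
  have h0 := scale_nonneg M k L
  have hs := scale_sq M hk L
  have hd := h.pos
  have hm : Measurable fun z => expF M k p z - expF M k p' z := by fun_prop
  have hR := one_le_rate M hL
  have hl3 : scale M k L ^ 3 ≤ scale M k L := by
    have : scale M k L ^ 2 ≤ 1 := by nlinarith
    calc scale M k L ^ 3 = scale M k L ^ 2 * scale M k L := by ring
      _ ≤ 1 * scale M k L := by gcongr
      _ = _ := one_mul _
  have comb : ∀ {a b a' b' : ℂ} {r : ℝ}, 0 ≤ r →
      ‖a - a'‖ ≤ 20 * scale M k L * d * (r + scale M k L) * (1 + r) ^ 2 →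
      ‖(a - b) - (a' - b')‖ ≤ 52 * scale M k L ^ 3 * d * (r + scale M k L) * (1 + r) ^ 2 →
      ‖b - b'‖ ≤ 72 * scale M k L * d * ((r + scale M k L) * (1 + r) ^ 2) := by
    intro a b a' b' r hr h1 h2
    have e : b - b' = (a - a') - ((a - b) - (a' - b')) := by ring
    rw [e]
    refine (norm_sub_le _ _).trans ?_
    have : scale M k L ^ 3 * (d * (r + scale M k L) * (1 + r) ^ 2) ≤
      scale M k L * (d * (r + scale M k L) * (1 + r) ^ 2) := mul_le_mul_of_nonneg_right hl3 (by positivity)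
    nlinarith
  have hb := secondMoment_of_cubic_bound hν hm (b := 72 * scale M k L * d) fun z => by
    have hr : 0 ≤ |z.1| + |z.2| := by positivity
    refine (comb hr ((h.step z).ratStep_sub_le hr hd.le h0 hl)
      ((h.step z).defect_sub_le hr hd.le h0 hl)).trans ?_
    exact mul_le_mul_of_nonneg_left (cubic_bound (|z.1| + |z.2|) hl) (by positivity)
  refine ⟨hm, hb.1, ?_, hb.2.trans ?_⟩
  · rw [integral_sub (integrable_expF hν _ _) (integrable_expF hν _ _), integral_expF hM hν hk,
      integral_expF hM hν hk]
    refine (comb le_rfl (h.mean.ratStep_sub_le le_rfl hd.le h0 hl)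
      (h.mean.defect_sub_le le_rfl hd.le h0 hl)).trans ?_
    have e : 72 * scale M k L * d * ((0 + scale M k L) * (1 + 0) ^ 2) = 72 * (k * rate M L * d) := by
      unfold rate; linear_combination 72 * d * hs
    rw [e]
    have : 0 ≤ k * rate M L * d := by positivity
    nlinarith [le_stepConst]
  · have e : (72 * scale M k L * d) ^ 2 * CorrGauss.momentConst =
      (72 ^ 2 * CorrGauss.momentConst) * (k * rate M L * d ^ 2) := by
      unfold rate; linear_combination 72 ^ 2 * d ^ 2 * CorrGauss.momentConst * hs
    rw [e]
    calc _ ≤ stepConst ^ 2 * (k * (rate M L ^ 2) * d ^ 2) := by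
          gcongr
          · exact le_stepConst_sq
          · nlinarith
      _ = _ := by ring

lemma ratF_zero (M : Coeffs) (k : ℝ) (z : ℝ × ℝ) : ratF M k Sym.zero z = 1 := by
  unfold ratF; rw [noise_zero, itoCorr_zero]; simp [Sym.zero, impl_zero, ratStep]

lemma expF_zero (M : Coeffs) (k : ℝ) (z : ℝ × ℝ) : expF M k Sym.zero z = 1 := by
  unfold expF; rw [noise_zero, itoCorr_zero]; simp [Sym.zero, impl_zero, expStep]

end StepSize

/-! ### Products of independent steps and discrete Gronwall in mean square -/

/-- Second-moment bounds. -/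
def SqLe {Ω : Type*} [MeasurableSpace Ω] (P : Measure Ω) (f : Ω → ℂ) (B : ℝ) : Prop :=
  Integrable (fun ω => ‖f ω‖ ^ 2) P ∧ ∫ ω, ‖f ω‖ ^ 2 ∂P ≤ B

section Products

variable {Ω : Type*} {Z : ℕ → Ω → ℝ × ℝ}

/-- The product of the first `n` values of a step function. -/
def stepProd (C : ℝ × ℝ → ℂ) (Z : ℕ → Ω → ℝ × ℝ) : ℕ → Ω → ℂ
  | 0 => fun _ => 1
  | n + 1 => fun ω => C (Z n ω) * stepProd C Z n ω

/-- The solution of the recursion `Δ (n + 1) = C Δ n + p Y n` started from zero. -/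
def duhamel (C p : ℝ × ℝ → ℂ) (Y : ℕ → Ω → ℂ) (Z : ℕ → Ω → ℝ × ℝ) : ℕ → Ω → ℂ
  | 0 => fun _ => 0
  | n + 1 => fun ω => C (Z n ω) * duhamel C p Y Z n ω + p (Z n ω) * Y n ω

lemma measurable_past_stepProd {C : ℝ × ℝ → ℂ} (hC : Measurable C) (n : ℕ) :
    Measurable[past Z n] (stepProd C Z n) := by
  induction n with
  | zero => exact measurable_const
  | succ n ih =>
    exact (hC.comp (measurable_past n)).mul (ih.mono (past_mono n.le_succ) le_rfl)

lemma measurable_past_duhamel {C p : ℝ × ℝ → ℂ} (hC : Measurable C) (hp : Measurable p) {Y : ℕ → Ω → ℂ}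
    (hY : ∀ n, Measurable[past Z n] (Y n)) (n : ℕ) : Measurable[past Z n] (duhamel C p Y Z n) := by
  induction n with
  | zero => exact measurable_const
  | succ n ih =>
    exact ((hC.comp (measurable_past n)).mul (ih.mono (past_mono n.le_succ) le_rfl)).add
      ((hp.comp (measurable_past n)).mul ((hY n).mono (past_mono n.le_succ) le_rfl))

end Products

section Gronwall

variable {Ω : Type*} [mΩ : MeasurableSpace Ω] {P : Measure Ω} {ρ : ℝ} {Z : ℕ → Ω → ℝ × ℝ}

lemma SqLe.mono {f : Ω → ℂ} {A B : ℝ} (h : SqLe P f A) (hAB : A ≤ B) : SqLe P f B :=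
  ⟨h.1, h.2.trans hAB⟩

lemma norm_add_sq_le_two (a b : ℂ) : ‖a + b‖ ^ 2 ≤ 2 * (‖a‖ ^ 2 + ‖b‖ ^ 2) := by
  have := pow_le_pow_left₀ (norm_nonneg _) (norm_add_le a b) 2
  nlinarith [sq_nonneg (‖a‖ - ‖b‖)]

lemma SqLe.add {f g : Ω → ℂ} {A B : ℝ} (hf : SqLe P f A) (hg : SqLe P g B)
    (mf : AEStronglyMeasurable f P) (mg : AEStronglyMeasurable g P) :
    SqLe P (fun ω => f ω + g ω) (2 * (A + B)) := by
  have hi2 : Integrable (fun ω => 2 * (‖f ω‖ ^ 2 + ‖g ω‖ ^ 2)) P := (hf.1.add hg.1).const_mul 2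
  have hi : Integrable (fun ω => ‖f ω + g ω‖ ^ 2) P := by
    refine hi2.mono' ((mf.add mg).norm.pow 2) (ae_of_all _ fun ω => ?_)
    rw [Real.norm_of_nonneg (by positivity)]
    exact norm_add_sq_le_two _ _
  refine ⟨hi, (integral_mono hi hi2 fun ω => norm_add_sq_le_two _ _).trans ?_⟩
  rw [integral_const_mul, integral_add hf.1 hg.1]
  linarith [hf.2, hg.2]

lemma SqLe.const_mul {f : Ω → ℂ} {A : ℝ} (hf : SqLe P f A) (c : ℂ) :
    SqLe P (fun ω => c * f ω) (‖c‖ ^ 2 * A) := by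
  simp only [SqLe, norm_mul, mul_pow]
  refine ⟨hf.1.const_mul _, ?_⟩
  rw [integral_const_mul]
  exact mul_le_mul_of_nonneg_left hf.2 (by positivity)

lemma GaussSteps.indepFun (h : GaussSteps P ρ Z) {β : Type*} [MeasurableSpace β] {n : ℕ} {f : Ω → β}
    (hf : Measurable[past Z n] f) : IndepFun (Z n) f P := by
  refine IndepFun.symm ?_
  rw [IndepFun_iff_Indep]
  exact indep_of_indep_of_le_left (h.indep n) hf.comap_le

lemma GaussSteps.integral_mul_indep {𝕜 : Type*} [RCLike 𝕜] (h : GaussSteps P ρ Z) {n : ℕ}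
    {g : ℝ × ℝ → 𝕜} (hg : Measurable g) {f : Ω → 𝕜} (hf : Measurable[past Z n] f) :
    ∫ ω, g (Z n ω) * f ω ∂P = (∫ z, g z ∂(P.map (Z n))) * ∫ ω, f ω ∂P := by
  have hi := h.indepFun hf
  have hf' : Measurable f := hf.mono (past_le h.meas n) le_rfl
  have := hi.integral_fun_comp_mul_comp (f := g) (g := id) (h.meas n).aemeasurable hf'.aemeasurable
    hg.aestronglyMeasurable measurable_id.aestronglyMeasurable
  simp only [id] at this
  rw [this, integral_map (h.meas n).aemeasurable hg.aestronglyMeasurable]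

lemma GaussSteps.integrable_mul_indep {𝕜 : Type*} [RCLike 𝕜] (h : GaussSteps P ρ Z) {n : ℕ}
    {g : ℝ × ℝ → 𝕜} (hg : Measurable g) (hgi : Integrable g (P.map (Z n))) {f : Ω → 𝕜}
    (hf : Measurable[past Z n] f) (hfi : Integrable f P) :
    Integrable (fun ω => g (Z n ω) * f ω) P := by
  have hi := (h.indepFun hf).comp hg measurable_id
  exact hi.integrable_mul ((integrable_map_measure hgi.1 (h.meas n).aemeasurable).1 hgi) hfi

/-- The current step is independent of the past, so second moments multiply. -/
lemma GaussSteps.sqLe_stepProd [IsProbabilityMeasure P] (h : GaussSteps P ρ Z) {C : ℝ × ℝ → ℂ}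
    (hC : Measurable C) {q : ℝ} (hq : 0 ≤ q) (hi : ∀ n, Integrable (fun z => ‖C z‖ ^ 2) (P.map (Z n)))
    (hle : ∀ n, ∫ z, ‖C z‖ ^ 2 ∂(P.map (Z n)) ≤ q) (n : ℕ) : SqLe P (stepProd C Z n) (q ^ n) := by
  induction n with
  | zero => simp [SqLe, stepProd]
  | succ n ih =>
    have hm : Measurable[past Z n] fun ω => ‖stepProd C Z n ω‖ ^ 2 :=
      (measurable_norm.comp (measurable_past_stepProd hC n)).pow_const 2
    have hc : Measurable fun z => ‖C z‖ ^ 2 := by fun_prop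
    simp only [SqLe, stepProd, norm_mul, mul_pow]
    refine ⟨h.integrable_mul_indep hc (hi n) hm ih.1, ?_⟩
    rw [h.integral_mul_indep hc hm, pow_succ']
    exact mul_le_mul (hle n) ih.2 (integral_nonneg fun _ => by positivity) hq

lemma re_cross (a b c d : ℂ) : ‖a * b + c * d‖ ^ 2 = ‖a‖ ^ 2 * ‖b‖ ^ 2 + ‖c‖ ^ 2 * ‖d‖ ^ 2 +
    2 * (((starRingEnd ℂ) a * c) * ((starRingEnd ℂ) b * d)).re := by
  have := Complex.normSq_add (c * d) (a * b)
  rw [add_comm (c * d)] at this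
  simp only [Complex.normSq_eq_norm_sq, map_mul] at this
  rw [this]
  ring_nf

/-- Discrete Gronwall estimate in mean square. -/
lemma GaussSteps.sqLe_duhamel [IsProbabilityMeasure P] (h : GaussSteps P ρ Z) {C p : ℝ × ℝ → ℂ} {Y : ℕ → Ω → ℂ}
    {N : ℕ} {k q κ ε y : ℝ} (hk : 0 ≤ k) (hq : 1 ≤ 2 * q) (hκ : 0 < κ) (hε : 0 < ε)
    (hCi : ∀ n, Integrable (fun z => ‖C z‖ ^ 2) (P.map (Z n)))
    (hCq : ∀ n, ∫ z, ‖C z‖ ^ 2 ∂(P.map (Z n)) ≤ q) (hC : Measurable C)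
    (hC1 : ∀ n, StepSize (P.map (Z n)) k κ fun z => C z - 1) (hp : ∀ n, StepSize (P.map (Z n)) k ε p)
    (hYm : ∀ n, Measurable[past Z n] (Y n)) (hY : ∀ n < N, SqLe P (Y n) (y * q ^ n)) (hy : 0 ≤ y)
    (n : ℕ) (hn : n ≤ N) :
    SqLe P (duhamel C p Y Z n)
      (Real.exp (2 * (k * n)) * (2 * (k * n)) * (ε ^ 2 * ((1 + κ) ^ 2 + 1)) * y * q ^ n) := by
  have hpm := (hp 0).meas
  induction n with
  | zero => simp [SqLe, duhamel]
  | succ n ih =>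
    have ih := ih (by omega)
    have hY := hY n (by omega)
    have : IsProbabilityMeasure (P.map (Z n)) := (h.law n).prob
    set ν := P.map (Z n) with hν
    set D := duhamel C p Y Z n with hD
    have mD : Measurable[past Z n] D := measurable_past_duhamel hC hpm hYm n
    have le := past_le h.meas n
    have mD' : Measurable D := mD.mono le le_rfl
    have mY' : Measurable (Y n) := (hYm n).mono le le_rfl
    have m1 : Measurable[past Z n] fun ω => ‖D ω‖ ^ 2 := (measurable_norm.comp mD).pow_const 2
    have m2 : Measurable[past Z n] fun ω => ‖Y n ω‖ ^ 2 := (measurable_norm.comp (hYm n)).pow_const 2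
    have m3 : Measurable[past Z n] fun ω => (starRingEnd ℂ) (D ω) * Y n ω :=
      (Complex.continuous_conj.measurable.comp mD).mul (hYm n)
    have g1 : Measurable fun z => ‖C z‖ ^ 2 := by fun_prop
    have g2 : Measurable fun z => ‖p z‖ ^ 2 := by fun_prop
    have g3 : Measurable fun z => (starRingEnd ℂ) (C z) * p z :=
      (Complex.continuous_conj.measurable.comp hC).mul hpm
    have ic : Integrable (fun z => (starRingEnd ℂ) (C z) * p z) ν := by
      refine ((hCi n).add (hp n).int).mono' g3.aestronglyMeasurable (ae_of_all _ fun z => ?_)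
      simp only [norm_mul, RCLike.norm_conj, Pi.add_apply]
      nlinarith [sq_nonneg (‖C z‖ - ‖p z‖), sq_nonneg ‖C z‖, sq_nonneg ‖p z‖]
    have iy : Integrable (fun ω => (starRingEnd ℂ) (D ω) * Y n ω) P := by
      refine (ih.1.add hY.1).mono' (m3.mono le le_rfl).aestronglyMeasurable (ae_of_all _ fun ω => ?_)
      simp only [norm_mul, RCLike.norm_conj, Pi.add_apply]
      nlinarith [sq_nonneg (‖D ω‖ - ‖Y n ω‖), sq_nonneg ‖D ω‖, sq_nonneg ‖Y n ω‖]
    have I1 := h.integrable_mul_indep g1 (hCi n) m1 ih.1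
    have I2 := h.integrable_mul_indep g2 (hp n).int m2 hY.1
    have I3 := h.integrable_mul_indep g3 ic m3 iy
    -- Expand the square of the recursion. Each of the three terms is a function of the current step
    -- times a function of the past, so its expectation factorises.
    have e : ∀ ω, ‖duhamel C p Y Z (n + 1) ω‖ ^ 2 = ‖C (Z n ω)‖ ^ 2 * ‖D ω‖ ^ 2 + ‖p (Z n ω)‖ ^ 2 * ‖Y n ω‖ ^ 2 +
        2 * (((starRingEnd ℂ) (C (Z n ω)) * p (Z n ω)) * ((starRingEnd ℂ) (D ω) * Y n ω)).re := fun ω =>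
      re_cross _ _ _ _
    have I12 : Integrable (fun ω => ‖C (Z n ω)‖ ^ 2 * ‖D ω‖ ^ 2 + ‖p (Z n ω)‖ ^ 2 * ‖Y n ω‖ ^ 2) P := I1.add I2
    have I3' : Integrable (fun ω => 2 * (((starRingEnd ℂ) (C (Z n ω)) * p (Z n ω)) *
        ((starRingEnd ℂ) (D ω) * Y n ω)).re) P := I3.re.const_mul 2
    refine ⟨by simp only [e]; exact I12.add I3', ?_⟩
    simp only [e]
    rw [integral_add I12 I3', integral_add I1 I2, integral_const_mul,
      h.integral_mul_indep g1 m1, h.integral_mul_indep g2 m2]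
    have hre : ∫ ω, (((starRingEnd ℂ) (C (Z n ω)) * p (Z n ω)) * ((starRingEnd ℂ) (D ω) * Y n ω)).re ∂P =
        ((∫ z, (starRingEnd ℂ) (C z) * p z ∂ν) * ∫ ω, (starRingEnd ℂ) (D ω) * Y n ω ∂P).re := by
      rw [← h.integral_mul_indep g3 m3]
      exact integral_re I3
    rw [hre]
    have icp : Integrable p ν := by
      refine ((integrable_const (1 : ℝ)).add (hp n).int).mono' hpm.aestronglyMeasurable (ae_of_all _ fun z => ?_)
      simp only [Pi.add_apply]
      nlinarith [sq_nonneg (‖p z‖ - 1)]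
    have ic1 : Integrable (fun z => (starRingEnd ℂ) (C z - 1) * p z) ν := by
      refine (ic.sub icp).congr (ae_of_all _ fun z => ?_)
      simp [sub_mul]
    -- Writing `C = 1 + (C - 1)`, the first part sees only the small mean of `p`, and the second is
    -- a product of two fluctuations of order `√k`. Both are of order `k`, so no factor `√k`
    -- survives in the cross term. The weights `ε / κ` and `κ / ε` balance Young's inequality.
    have bP : ‖∫ z, (starRingEnd ℂ) (C z) * p z ∂ν‖ ≤ k * (ε * (1 + κ)) := by
      have e1 : ∫ z, (starRingEnd ℂ) (C z) * p z ∂ν = ∫ z, p z ∂ν + ∫ z, (starRingEnd ℂ) (C z - 1) * p z ∂ν := by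
        rw [← integral_add icp ic1]
        congr 1; ext z; simp; ring
      rw [e1]
      refine (norm_add_le _ _).trans ?_
      have b2 : ‖∫ z, (starRingEnd ℂ) (C z - 1) * p z ∂ν‖ ≤ k * (ε * κ) := by
        refine (norm_integral_le_integral_norm _).trans ?_
        have hpt : ∀ z, ‖(starRingEnd ℂ) (C z - 1) * p z‖ ≤
            (ε / (2 * κ)) * ‖C z - 1‖ ^ 2 + (κ / (2 * ε)) * ‖p z‖ ^ 2 := by
          intro z
          rw [norm_mul, RCLike.norm_conj]
          have : (ε / (2 * κ)) * ‖C z - 1‖ ^ 2 + (κ / (2 * ε)) * ‖p z‖ ^ 2 - ‖C z - 1‖ * ‖p z‖ =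
            (ε * ‖C z - 1‖ - κ * ‖p z‖) ^ 2 / (2 * κ * ε) := by field_simp; ring
          have : 0 ≤ (ε * ‖C z - 1‖ - κ * ‖p z‖) ^ 2 / (2 * κ * ε) := by positivity
          linarith
        have J1 := (hC1 n).int.const_mul (ε / (2 * κ))
        have J2 := (hp n).int.const_mul (κ / (2 * ε))
        refine (integral_mono ic1.norm (J1.add J2) hpt).trans ?_
        simp only [Pi.add_apply]
        rw [integral_add J1 J2, integral_const_mul, integral_const_mul]
        have k1 := mul_le_mul_of_nonneg_left (hC1 n).sq (by positivity : 0 ≤ ε / (2 * κ))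
        have k2 := mul_le_mul_of_nonneg_left (hp n).sq (by positivity : 0 ≤ κ / (2 * ε))
        have k3 : ε / (2 * κ) * (k * κ ^ 2) + κ / (2 * ε) * (k * ε ^ 2) = k * (ε * κ) := by field_simp; ring
        linarith
      have b1 := (hp n).mean
      nlinarith
    set A := Real.exp (2 * (k * n)) * (2 * (k * n)) * (ε ^ 2 * ((1 + κ) ^ 2 + 1)) * y with hA
    have hA0 : 0 ≤ A := by positivity
    have hq0 : 0 < q := by linarith
    have bY : 2 * ((ε * (1 + κ)) * ‖∫ ω, (starRingEnd ℂ) (D ω) * Y n ω ∂P‖) ≤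
        A * q ^ n + (ε * (1 + κ)) ^ 2 * (y * q ^ n) := by
      have hpt : ∀ ω, (2 * (ε * (1 + κ))) * ‖(starRingEnd ℂ) (D ω) * Y n ω‖ ≤
          ‖D ω‖ ^ 2 + (ε * (1 + κ)) ^ 2 * ‖Y n ω‖ ^ 2 := by
        intro ω
        rw [norm_mul, RCLike.norm_conj]
        nlinarith [sq_nonneg (‖D ω‖ - (ε * (1 + κ)) * ‖Y n ω‖)]
      have J2 := hY.1.const_mul ((ε * (1 + κ)) ^ 2)
      have t := integral_mono (iy.norm.const_mul (2 * (ε * (1 + κ)))) (ih.1.add J2) hpt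
      simp only [Pi.add_apply] at t
      rw [integral_const_mul, integral_add ih.1 J2, integral_const_mul] at t
      have t2 := norm_integral_le_integral_norm (μ := P) (fun ω => (starRingEnd ℂ) (D ω) * Y n ω)
      have t3 := mul_le_mul_of_nonneg_left t2 (by positivity : 0 ≤ 2 * (ε * (1 + κ)))
      have t4 := mul_le_mul_of_nonneg_left hY.2 (sq_nonneg (ε * (1 + κ)))
      linarith [ih.2]
    have bcross : 2 * ((∫ z, (starRingEnd ℂ) (C z) * p z ∂ν) * ∫ ω, (starRingEnd ℂ) (D ω) * Y n ω ∂P).re ≤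
        k * (A * q ^ n + (ε * (1 + κ)) ^ 2 * (y * q ^ n)) := by
      have t1 := Complex.re_le_norm ((∫ z, (starRingEnd ℂ) (C z) * p z ∂ν) *
        ∫ ω, (starRingEnd ℂ) (D ω) * Y n ω ∂P)
      rw [norm_mul] at t1
      have t2 := mul_le_mul_of_nonneg_right bP (norm_nonneg (∫ ω, (starRingEnd ℂ) (D ω) * Y n ω ∂P))
      have t3 := mul_le_mul_of_nonneg_left bY hk
      linarith
    have c1 : (∫ z, ‖C z‖ ^ 2 ∂ν) * ∫ ω, ‖D ω‖ ^ 2 ∂P ≤ q * (A * q ^ n) :=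
      mul_le_mul (hCq n) ih.2 (integral_nonneg fun _ => by positivity) hq0.le
    have c2 : (∫ z, ‖p z‖ ^ 2 ∂ν) * ∫ ω, ‖Y n ω‖ ^ 2 ∂P ≤ (k * ε ^ 2) * (y * q ^ n) :=
      mul_le_mul (hp n).sq hY.2 (integral_nonneg fun _ => by positivity) (by positivity)
    set B := ε ^ 2 * ((1 + κ) ^ 2 + 1) with hB
    have hB0 : 0 ≤ B := by positivity
    have hqn : 0 < q ^ n := by positivity
    have s1 : q * (A * q ^ n) + (k * ε ^ 2) * (y * q ^ n) + k * (A * q ^ n + (ε * (1 + κ)) ^ 2 * (y * q ^ n)) ≤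
        ((1 + 2 * k) * A + 2 * k * B * y) * q ^ (n + 1) := by
      -- The assumption `1 ≤ 2 * q` pays for raising the power of `q`, so the geometric decay is not
      -- lost in the induction.
      have u1 : k * (A * q ^ n) ≤ 2 * k * A * q ^ (n + 1) := by
        have : 0 ≤ k * (A * q ^ n) := by positivity
        rw [pow_succ]; nlinarith
      have u2 : k * (B * y * q ^ n) ≤ 2 * k * B * y * q ^ (n + 1) := by
        have : 0 ≤ k * (B * y * q ^ n) := by positivity
        rw [pow_succ]; nlinarith
      have u3 : q * (A * q ^ n) + (k * ε ^ 2) * (y * q ^ n) + k * (A * q ^ n + (ε * (1 + κ)) ^ 2 * (y * q ^ n)) =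
        A * q ^ (n + 1) + k * (A * q ^ n) + k * (B * y * q ^ n) := by rw [hB]; ring
      rw [u3]; nlinarith
    -- The growth closes by `1 + 2 * k ≤ exp (2 * k)`, and the new forcing term supplies the
    -- increment of the linear factor `2 * (k * n)`.
    have s2 : (1 + 2 * k) * A + 2 * k * B * y ≤
        Real.exp (2 * (k * ((n + 1 : ℕ) : ℝ))) * (2 * (k * ((n + 1 : ℕ) : ℝ))) * B * y := by
      have hE : Real.exp (2 * (k * ((n + 1 : ℕ) : ℝ))) = Real.exp (2 * k) * Real.exp (2 * (k * n)) := by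
        rw [← Real.exp_add]; congr 1; push_cast; ring
      have e1 : 1 + 2 * k ≤ Real.exp (2 * k) := by linarith [Real.add_one_le_exp (2 * k)]
      have e2 : 1 ≤ Real.exp (2 * k) * Real.exp (2 * (k * n)) := by
        have := Real.one_le_exp (by positivity : 0 ≤ 2 * (k * (n : ℝ)))
        nlinarith
      have v1 := mul_le_mul_of_nonneg_right e1 hA0
      have v2 := mul_le_mul_of_nonneg_right e2 (by positivity : 0 ≤ 2 * k * B * y)
      rw [hE]
      have : Real.exp (2 * k) * Real.exp (2 * (k * n)) * (2 * (k * ((n + 1 : ℕ) : ℝ))) * B * y =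
        Real.exp (2 * k) * A + Real.exp (2 * k) * Real.exp (2 * (k * n)) * (2 * k * B * y) := by
        rw [hA]; push_cast; ring
      rw [this]; linarith
    calc _ ≤ q * (A * q ^ n) + (k * ε ^ 2) * (y * q ^ n) + k * (A * q ^ n + (ε * (1 + κ)) ^ 2 * (y * q ^ n)) := by
          linarith
      _ ≤ _ := s1
      _ ≤ _ := mul_le_mul_of_nonneg_right s2 (by positivity)

end Gronwall

section Identities

variable {Ω : Type*} {Z : ℕ → Ω → ℝ × ℝ}

/-- Discrete variation of constants: the difference of two products solves the recursion of the
first, forced by the one-step difference acting on the second. -/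
lemma stepProd_sub (C D : ℝ × ℝ → ℂ) (n : ℕ) (ω : Ω) :
    stepProd C Z n ω - stepProd D Z n ω = duhamel C (fun z => C z - D z) (stepProd D Z) Z n ω := by
  induction n with
  | zero => simp [stepProd, duhamel]
  | succ n ih => simp only [stepProd, duhamel, ← ih]; ring

/-- A discrete Leibniz rule for a second difference. With `C`, `D` the scheme and the equation, and
primes a change of symbol, the three forcings are a time defect acting on a space error, a space
difference acting on a time error, and a mixed one-step difference; each contains both small
parameters. -/
lemma stepProd_second_diff (C D C' D' : ℝ × ℝ → ℂ) (n : ℕ) (ω : Ω) :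
    (stepProd C Z n ω - stepProd D Z n ω) - (stepProd C' Z n ω - stepProd D' Z n ω) =
      duhamel C (fun z => C z - D z) (fun n ω => stepProd D Z n ω - stepProd D' Z n ω) Z n ω +
      duhamel C (fun z => C z - C' z) (fun n ω => stepProd C' Z n ω - stepProd D' Z n ω) Z n ω +
      duhamel C (fun z => (C z - D z) - (C' z - D' z)) (stepProd D' Z) Z n ω := by
  induction n with
  | zero => simp [stepProd, duhamel]
  | succ n ih =>
    simp only [stepProd, duhamel]
    linear_combination C (Z n ω) * ih

end Identities

/-! ### Time, space and mixed errors at one low frequency -/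

/-- The amplification constant of the discrete Gronwall estimate up to time `T`. -/
def growth (T κ : ℝ) : ℝ := Real.exp (2 * T) * (2 * T) * ((1 + κ) ^ 2 + 1)

lemma growth_nonneg {T : ℝ} (hT : 0 ≤ T) (κ : ℝ) : 0 ≤ growth T κ := by
  unfold growth; positivity

section Frequency

variable {Ω : Type*} [mΩ : MeasurableSpace Ω] {P : Measure Ω}
  {Z : ℕ → Ω → ℝ × ℝ} {M : Coeffs} {k L e q T lam : ℝ} {N : ℕ} {p p' : Sym}

/-- The scale condition gives `k * L ^ 2 ≤ 1 / 16`, which puts low frequencies in the regime of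
exponential decay. -/
lemma excess_le_one (hk : 0 ≤ k) (hL : 1 ≤ L) (hl : scale M k L ≤ 1 / 4) (hb : p.Bounded L) :
    excess k p ≤ 1 := by
  have h2 := (scale_bounds_diam (M := M) hk hL).2.1
  have h0 := scale_nonneg M k L
  have h3 : k * L ^ 2 ≤ 1 / 16 := by nlinarith
  have hx : k * p.σ ≤ 1 / 16 := (mul_le_mul_of_nonneg_left hb.σ hk).trans h3
  have hy : k * p.τ ≤ 1 / 16 := (mul_le_mul_of_nonneg_left hb.τ hk).trans h3
  have hx0 : 0 ≤ k * p.σ := mul_nonneg hk ((sq_nonneg _).trans hb.s_sq)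
  have hy0 : 0 ≤ k * p.τ := mul_nonneg hk ((sq_nonneg _).trans hb.t_sq)
  unfold excess
  nlinarith

/-- The data of a frequency pair in the low-frequency regime. -/
structure LowPair (M : Coeffs) (lam k L e q : ℝ) (p p' : Sym) : Prop where
  valid : M.Valid
  stable : StableRate lam M.ρx M.ρy M.ρ
  hk : 0 ≤ k
  hL : 1 ≤ L
  small : scale M k L ≤ 1 / 4
  he : 0 < e
  b : p.Bounded L
  b' : p'.Bounded L
  near : p.Near p' e
  hq : 1 ≤ 2 * q
  decay : Real.exp (-((1 - lam) / 2 * (k * (p.σ + p.τ)))) ≤ q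
  decay' : Real.exp (-((1 - lam) / 2 * (k * (p'.σ + p'.τ)))) ≤ q

namespace LowPair

variable (h : LowPair M lam k L e q p p')

include h

lemma symm : LowPair M lam k L e q p' p where
  valid := h.valid
  stable := h.stable
  hk := h.hk
  hL := h.hL
  small := h.small
  he := h.he
  b := h.b'
  b' := h.b
  near := ⟨by rw [abs_sub_comm]; exact h.near.s, by rw [abs_sub_comm]; exact h.near.t,
    by rw [abs_sub_comm]; exact h.near.σ, by rw [abs_sub_comm]; exact h.near.τ⟩
  hq := h.hq
  decay := h.decay'
  decay' := h.decay

lemma q_nonneg : 0 ≤ q := by linarith [h.hq]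

lemma ratF_sq_le {ν : Measure (ℝ × ℝ)} (hν : CorrGauss M.ρ ν) : ∫ z, ‖ratF M k p z‖ ^ 2 ∂ν ≤ q :=
  (integral_norm_ratF_sq_le_exp h.valid hν h.stable h.hk h.b.s_sq h.b.t_sq
    (excess_le_one h.hk h.hL h.small h.b)).trans h.decay

lemma expF_sq_le {ν : Measure (ℝ × ℝ)} (hν : CorrGauss M.ρ ν) :
    Integrable (fun z => ‖expF M k p z‖ ^ 2) ν ∧ ∫ z, ‖expF M k p z‖ ^ 2 ∂ν ≤ q := by
  have := hν.prob
  have hle : ∀ z, ‖expF M k p z‖ ^ 2 ≤ q := fun z =>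
    (norm_expF_sq_le h.stable h.hk h.b.s_sq h.b.t_sq z).trans h.decay
  have hi : Integrable (fun z => ‖expF M k p z‖ ^ 2) ν := by
    simp only [norm_expF_sq]; exact integrable_const _
  refine ⟨hi, (integral_mono hi (integrable_const q) hle).trans ?_⟩
  simp

lemma ratF_sub_one {ν : Measure (ℝ × ℝ)} (hν : CorrGauss M.ρ ν) :
    StepSize ν k (stepConst * rate M L) fun z => ratF M k p z - 1 := by
  have := (nearPair_zero h.valid h.hk h.hL h.b).ratF_sub h.valid hν h.hk h.hL (by linarith [h.small])
  simpa only [ratF_zero, mul_one] using this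

lemma expF_sub_one {ν : Measure (ℝ × ℝ)} (hν : CorrGauss M.ρ ν) :
    StepSize ν k (stepConst * rate M L) fun z => expF M k p z - 1 := by
  have := (nearPair_zero h.valid h.hk h.hL h.b).expF_sub h.valid hν h.hk h.hL (by linarith [h.small])
  simpa only [expF_zero, mul_one] using this

lemma defect {ν : Measure (ℝ × ℝ)} (hν : CorrGauss M.ρ ν) :
    StepSize ν k (stepConst * (k * rate M L ^ 2)) fun z => ratF M k p z - expF M k p z := by
  have := (nearPair_zero h.valid h.hk h.hL h.b).defect_sub h.valid hν h.hk h.hL (by linarith [h.small])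
  simpa only [expF_zero, ratF_zero, mul_one, sub_self, sub_zero] using this

lemma nearPair : NearPair M k L e p p' :=
  nearPair_of_near h.valid h.hk h.hL h.b h.b' h.near h.he

lemma const_pos : 0 < stepConst * rate M L := by
  have := one_le_rate M h.hL
  have := le_stepConst
  positivity

variable [IsProbabilityMeasure P] (hZ : GaussSteps P M.ρ Z)
include hZ

lemma sqLe_ratF (n : ℕ) : SqLe P (stepProd (ratF M k p) Z n) (q ^ n) :=
  hZ.sqLe_stepProd (by fun_prop) h.q_nonneg (fun n => integrable_norm_ratF_sq (hZ.law n) _ _)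
    (fun n => h.ratF_sq_le (hZ.law n)) n

lemma sqLe_expF (n : ℕ) : SqLe P (stepProd (expF M k p) Z n) (q ^ n) :=
  hZ.sqLe_stepProd (by fun_prop) h.q_nonneg (fun n => (h.expF_sq_le (hZ.law n)).1)
    (fun n => (h.expF_sq_le (hZ.law n)).2) n

lemma sqLe_duhamel_ratF {f : ℝ × ℝ → ℂ} {Y : ℕ → Ω → ℂ} {ε y : ℝ} (hT : k * N ≤ T) (hε : 0 < ε)
    (hf : ∀ n, StepSize (P.map (Z n)) k ε f) (hYm : ∀ n, Measurable[past Z n] (Y n))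
    (hY : ∀ n < N, SqLe P (Y n) (y * q ^ n)) (hy : 0 ≤ y) (n : ℕ) (hn : n ≤ N) :
    SqLe P (duhamel (ratF M k p) f Y Z n)
      (growth T (stepConst * rate M L) * ε ^ 2 * y * q ^ n) := by
  have hk := h.hk
  have hq := h.q_nonneg
  have := hZ.sqLe_duhamel h.hk h.hq h.const_pos hε (fun n => integrable_norm_ratF_sq (hZ.law n) k p)
    (fun n => h.ratF_sq_le (hZ.law n)) (by fun_prop) (fun n => h.ratF_sub_one (hZ.law n)) hf hYm hY hy n hn
  refine this.mono ?_
  have hkn : k * n ≤ T := le_trans (mul_le_mul_of_nonneg_left (by exact_mod_cast hn) h.hk) hT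
  unfold growth
  calc _ ≤ Real.exp (2 * T) * (2 * T) * (ε ^ 2 * ((1 + stepConst * rate M L) ^ 2 + 1)) * y * q ^ n := by
        gcongr
    _ = _ := by ring

lemma sqLe_duhamel_expF {f : ℝ × ℝ → ℂ} {Y : ℕ → Ω → ℂ} {ε y : ℝ} (hT : k * N ≤ T) (hε : 0 < ε)
    (hf : ∀ n, StepSize (P.map (Z n)) k ε f) (hYm : ∀ n, Measurable[past Z n] (Y n))
    (hY : ∀ n < N, SqLe P (Y n) (y * q ^ n)) (hy : 0 ≤ y) (n : ℕ) (hn : n ≤ N) :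
    SqLe P (duhamel (expF M k p) f Y Z n)
      (growth T (stepConst * rate M L) * ε ^ 2 * y * q ^ n) := by
  have hk := h.hk
  have hq := h.q_nonneg
  have := hZ.sqLe_duhamel h.hk h.hq h.const_pos hε (fun n => (h.expF_sq_le (hZ.law n)).1)
    (fun n => (h.expF_sq_le (hZ.law n)).2) (by fun_prop) (fun n => h.expF_sub_one (hZ.law n)) hf hYm hY hy n hn
  refine this.mono ?_
  have hkn : k * n ≤ T := le_trans (mul_le_mul_of_nonneg_left (by exact_mod_cast hn) h.hk) hT
  unfold growth
  calc _ ≤ Real.exp (2 * T) * (2 * T) * (ε ^ 2 * ((1 + stepConst * rate M L) ^ 2 + 1)) * y * q ^ n := by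
        gcongr
    _ = _ := by ring

/-- The time discretisation error is of first order in `k`. -/
lemma sqLe_time_error (hk : 0 < k) (hT : k * N ≤ T) (n : ℕ) (hn : n ≤ N) :
    SqLe P (fun ω => stepProd (ratF M k p) Z n ω - stepProd (expF M k p) Z n ω)
      (growth T (stepConst * rate M L) * (stepConst * (k * rate M L ^ 2)) ^ 2 * q ^ n) := by
  have hR := one_le_rate M h.hL
  have hs := le_stepConst
  have := h.sqLe_duhamel_ratF hZ hT (ε := stepConst * (k * rate M L ^ 2)) (y := 1) (by positivity)
    (fun n => h.defect (hZ.law n)) (fun n => measurable_past_stepProd (measurable_expF M k p) n)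
    (fun n _ => by simpa using h.sqLe_expF hZ n) zero_le_one n hn
  simpa only [stepProd_sub, mul_one] using this

/-- The effect of replacing the symbol in the exact evolution. -/
lemma sqLe_space_error (hT : k * N ≤ T) (n : ℕ) (hn : n ≤ N) :
    SqLe P (fun ω => stepProd (expF M k p) Z n ω - stepProd (expF M k p') Z n ω)
      (growth T (stepConst * rate M L) * (stepConst * rate M L * e) ^ 2 * q ^ n) := by
  have := h.sqLe_duhamel_expF hZ hT (ε := stepConst * rate M L * e) (y := 1) (mul_pos h.const_pos h.he)
    (fun n => h.nearPair.expF_sub h.valid (hZ.law n) h.hk h.hL (by linarith [h.small]))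
    (fun n => measurable_past_stepProd (measurable_expF M k p') n)
    (fun n _ => by simpa using h.symm.sqLe_expF hZ n) zero_le_one n hn
  simpa only [stepProd_sub, mul_one] using this

/-- The interaction of the time and space discretisation errors. -/
lemma sqLe_mixed_error (hk : 0 < k) (hT0 : 0 ≤ T) (hT : k * N ≤ T) :
    SqLe P (fun ω => (stepProd (ratF M k p) Z N ω - stepProd (expF M k p) Z N ω) -
      (stepProd (ratF M k p') Z N ω - stepProd (expF M k p') Z N ω))
      (10 * ((1 + growth T (stepConst * rate M L)) * (stepConst ^ 2 * rate M L ^ 3) * (k * e)) ^ 2 * q ^ N) := by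
  have hR := one_le_rate M h.hL
  have hs := le_stepConst
  have hG := growth_nonneg hT0 (stepConst * rate M L)
  have he := h.he
  have hq := h.q_nonneg
  set G := growth T (stepConst * rate M L) with hGd
  have mC : Measurable (ratF M k p) := by fun_prop
  have mS : ∀ {C : ℝ × ℝ → ℂ}, Measurable C → ∀ n, Measurable[past Z n] (stepProd C Z n) :=
    fun hC n => measurable_past_stepProd hC n
  have m1 : ∀ n, Measurable[past Z n] fun ω => stepProd (expF M k p) Z n ω - stepProd (expF M k p') Z n ω :=
    fun n => (mS (by fun_prop) n).sub (mS (by fun_prop) n)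
  have m2 : ∀ n, Measurable[past Z n] fun ω => stepProd (ratF M k p') Z n ω - stepProd (expF M k p') Z n ω :=
    fun n => (mS (by fun_prop) n).sub (mS (by fun_prop) n)
  -- The three forcings of `stepProd_second_diff`. In the first two the input `Y` is itself an error
  -- already estimated, and the product of its size with `ε` is of order `k * e`; in the third the
  -- one-step difference alone has that order.
  have a1 := h.sqLe_duhamel_ratF hZ hT (ε := stepConst * (k * rate M L ^ 2))
    (Y := fun n ω => stepProd (expF M k p) Z n ω - stepProd (expF M k p') Z n ω)
    (by positivity) (fun n => h.defect (hZ.law n)) m1 (fun n hn => h.sqLe_space_error hZ hT n hn.le)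
    (by positivity) N le_rfl
  have a2 := h.sqLe_duhamel_ratF hZ hT (ε := stepConst * rate M L * e)
    (Y := fun n ω => stepProd (ratF M k p') Z n ω - stepProd (expF M k p') Z n ω)
    (mul_pos h.const_pos h.he)
    (fun n => h.nearPair.ratF_sub h.valid (hZ.law n) h.hk h.hL (by linarith [h.small])) m2
    (fun n hn => h.symm.sqLe_time_error hZ hk hT n hn.le) (by positivity) N le_rfl
  have a3 := h.sqLe_duhamel_ratF hZ hT (ε := stepConst * (k * rate M L ^ 2) * e) (y := 1)
    (by positivity) (fun n => h.nearPair.defect_sub h.valid (hZ.law n) h.hk h.hL (by linarith [h.small]))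
    (fun n => mS (measurable_expF M k p') n) (fun n _ => by simpa using h.symm.sqLe_expF hZ n) zero_le_one N le_rfl
  have le := past_le hZ.meas N
  have n1 := ((measurable_past_duhamel mC (by fun_prop : Measurable fun z => ratF M k p z - expF M k p z)
    m1 N).mono le le_rfl).aestronglyMeasurable (μ := P)
  have n2 := ((measurable_past_duhamel mC (by fun_prop : Measurable fun z => ratF M k p z - ratF M k p' z)
    m2 N).mono le le_rfl).aestronglyMeasurable (μ := P)
  have n3 := ((measurable_past_duhamel mC (by fun_prop : Measurable fun z =>
    (ratF M k p z - expF M k p z) - (ratF M k p' z - expF M k p' z))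
    (fun n => mS (by fun_prop : Measurable (expF M k p')) n) N).mono le le_rfl).aestronglyMeasurable (μ := P)
  have := (a1.add a2 n1 n2).add a3 (n1.add n2) n3
  simp only [stepProd_second_diff]
  refine this.mono ?_
  rw [← hGd]
  set R := rate M L
  set s := stepConst
  have e1 : 2 * (2 * (G * (s * (k * R ^ 2)) ^ 2 * (G * (s * R * e) ^ 2) * q ^ N +
      G * (s * R * e) ^ 2 * (G * (s * (k * R ^ 2)) ^ 2) * q ^ N) + G * (s * (k * R ^ 2) * e) ^ 2 * 1 * q ^ N) =
      (8 * G ^ 2 * (s ^ 4 * R ^ 6) + 2 * G * (s ^ 2 * R ^ 4)) * ((k * e) ^ 2 * q ^ N) := by ring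
  rw [e1]
  have e2 : s ^ 2 * R ^ 4 ≤ s ^ 4 * R ^ 6 := by
    gcongr
    · linarith
    · norm_num
    · norm_num
  calc _ ≤ (10 * (1 + G) ^ 2 * (s ^ 4 * R ^ 6)) * ((k * e) ^ 2 * q ^ N) := by
        refine mul_le_mul_of_nonneg_right ?_ (by positivity)
        have p0 : 0 ≤ s ^ 4 * R ^ 6 := by positivity
        have := mul_le_mul_of_nonneg_left e2 (by positivity : 0 ≤ 2 * G)
        nlinarith [mul_nonneg hG p0, mul_nonneg (mul_nonneg hG hG) p0]
    _ = _ := by ring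

end LowPair

end Frequency

/-! ### Uniqueness of square-summable solutions of the implicit equations -/

section Uniqueness

lemma summable_mul_shift {w : ℤ → ℝ} (hw : Summable fun i => w i ^ 2) : Summable fun i => w i * w (i + 1) := by
  have h1 : Summable fun i => w (i + 1) ^ 2 := by
    have := (Equiv.addRight (1 : ℤ)).summable_iff.2 hw
    simpa [Function.comp_def] using this
  have hs : Summable fun i => w i ^ 2 + w (i + 1) ^ 2 := hw.add h1
  refine Summable.of_norm_bounded hs fun i => ?_
  rw [Real.norm_eq_abs, abs_mul]
  nlinarith [sq_nonneg (|w i| - |w (i + 1)|), sq_abs (w i), sq_abs (w (i + 1))]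

/-- Square-summable sequences in the kernel of a one-dimensional implicit factor vanish. -/
lemma eq_zero_of_implicit {w : ℤ → ℝ} (hw : Summable fun i => w i ^ 2) (c : ℝ) {d : ℝ} (hd : 0 ≤ d)
    (h : ∀ i, w i + c * (w (i + 1) - w (i - 1)) - d * (w (i + 1) - 2 * w i + w (i - 1)) = 0) (i : ℤ) :
    w i = 0 := by
  have s0 := summable_mul_shift hw
  have h1 : Summable fun i => w (i + 1) ^ 2 := by
    have := (Equiv.addRight (1 : ℤ)).summable_iff.2 hw
    simpa [Function.comp_def] using this
  have s1 : Summable fun i => w (i - 1) * w i := by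
    have := (Equiv.subRight (1 : ℤ)).summable_iff.2 s0
    simpa [Function.comp_def] using this
  have t1 : ∑' i, w (i - 1) * w i = ∑' i, w i * w (i + 1) := by
    rw [← (Equiv.subRight (1 : ℤ)).tsum_eq (fun i => w i * w (i + 1))]
    simp
  have t2 : ∑' i, w (i + 1) ^ 2 = ∑' i, w i ^ 2 := (Equiv.addRight (1 : ℤ)).tsum_eq (fun i => w i ^ 2)
  set Q := ∑' i, w i ^ 2 with hQ
  set R := ∑' i, w i * w (i + 1) with hR
  -- Energy method: multiply the equation by `w i` and sum. The drift terms cancel by translation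
  -- invariance, and the diffusion contributes `d` times the nonnegative sum of squared differences,
  -- so the sum of the squares of `w` must vanish.
  have e : ∑' i, ((1 + 2 * d) * w i ^ 2 + (c - d) * (w i * w (i + 1)) + (-c - d) * (w (i - 1) * w i)) = 0 := by
    rw [← tsum_zero (α := ℝ) (β := ℤ)]
    congr 1; ext i
    linear_combination w i * h i
  rw [Summable.tsum_add ((hw.mul_left _).add (s0.mul_left _)) (s1.mul_left _),
    Summable.tsum_add (hw.mul_left _) (s0.mul_left _), tsum_mul_left, tsum_mul_left, tsum_mul_left, t1] at e
  have hP : 0 ≤ ∑' i, (w i - w (i + 1)) ^ 2 := tsum_nonneg fun i => sq_nonneg _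
  have e2 : ∑' i, (w i - w (i + 1)) ^ 2 = 2 * Q - 2 * R := by
    have : ∀ i, (w i - w (i + 1)) ^ 2 = w i ^ 2 + w (i + 1) ^ 2 + (-2) * (w i * w (i + 1)) := fun i => by ring
    simp only [this]
    rw [Summable.tsum_add (hw.add h1) (s0.mul_left _), Summable.tsum_add hw h1, tsum_mul_left, t2]
    ring
  have hQ0 : 0 ≤ Q := tsum_nonneg fun i => sq_nonneg _
  have hQ1 : Q = 0 := by
    rw [e2] at hP
    have := mul_nonneg hd hP
    nlinarith
  have hs : HasSum (fun i => w i ^ 2) 0 := by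
    rw [← hQ1]; exact hw.hasSum
  have := (hasSum_zero_iff_of_nonneg (fun i => sq_nonneg (w i))).1 hs
  have := congrFun this i
  simpa using this

lemma summable_lin_comb {a b c : ℤ → ℝ} (ha : Summable fun i => a i ^ 2) (hb : Summable fun i => b i ^ 2)
    (hc : Summable fun i => c i ^ 2) (x y z : ℝ) : Summable fun i => (x * a i + y * b i + z * c i) ^ 2 := by
  have := (((ha.mul_left (x ^ 2)).add (hb.mul_left (y ^ 2))).add (hc.mul_left (z ^ 2))).mul_left 3
  refine Summable.of_nonneg_of_le (fun i => sq_nonneg _) (fun i => ?_) this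
  nlinarith [sq_nonneg (x * a i - y * b i), sq_nonneg (x * a i - z * c i), sq_nonneg (y * b i - z * c i)]

/-- Grid functions with square-summable rows and columns in the kernel of the implicit operator vanish. -/
lemma eq_zero_of_implicitXY {μx μy k hx hy : ℝ} (hk : 0 ≤ k) {W : Grid}
    (hr : ∀ j, Summable fun i => W i j ^ 2) (hc : ∀ i, Summable fun j => W i j ^ 2)
    (h : ∀ i j, implicitX μx k hx (implicitY μy k hy W) i j = 0) (i j : ℤ) : W i j = 0 := by
  have h1 : ∀ i j, implicitY μy k hy W i j = 0 := by
    intro i j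
    refine eq_zero_of_implicit (w := fun i => implicitY μy k hy W i j) ?_ (μx * k / (2 * hx))
      (d := k / (2 * hx ^ 2)) (by positivity) (fun i => h i j) i
    refine (summable_lin_comb (hr j) (hr (j + 1)) (hr (j - 1)) (1 + 2 * (k / (2 * hy ^ 2)))
      (μy * k / (2 * hy) - k / (2 * hy ^ 2)) (-(μy * k / (2 * hy)) - k / (2 * hy ^ 2))).congr fun i => ?_
    simp only [implicitY, Dy, Dyy]
    ring
  exact eq_zero_of_implicit (hc i) (μy * k / (2 * hy)) (d := k / (2 * hy ^ 2)) (by positivity) (h1 i) j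

end Uniqueness

/-! ### Fourier calculus for the difference operators -/

/-- The symbol of the difference operators at a frequency. -/
def symH (hx hy : ℝ) (p : ℝ × ℝ) : Sym :=
  ⟨Real.sin (hx * p.1) / hx, Real.sin (hy * p.2) / hy, (2 - 2 * Real.cos (hx * p.1)) / hx ^ 2,
    (2 - 2 * Real.cos (hy * p.2)) / hy ^ 2⟩

/-- The symbol of the differential operators at a frequency. -/
def symZ (p : ℝ × ℝ) : Sym := ⟨p.1, p.2, p.1 ^ 2, p.2 ^ 2⟩

/-- The frequency box of a grid. -/
def box (hx hy : ℝ) : Set (ℝ × ℝ) :=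
  Set.Icc (-(Real.pi / hx)) (Real.pi / hx) ×ˢ Set.Icc (-(Real.pi / hy)) (Real.pi / hy)

/-- The Fourier phase. -/
def phase (x y : ℝ) (p : ℝ × ℝ) : ℂ := Complex.exp (Complex.I * ((p.1 * x + p.2 * y : ℝ) : ℂ))

lemma isCompact_box (hx hy : ℝ) : IsCompact (box hx hy) := isCompact_Icc.prod isCompact_Icc

lemma measurableSet_box (hx hy : ℝ) : MeasurableSet (box hx hy) := (isCompact_box hx hy).measurableSet

@[fun_prop]
lemma continuous_phase (x y : ℝ) : Continuous (phase x y) := by unfold phase; fun_prop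

lemma norm_phase (x y : ℝ) (p : ℝ × ℝ) : ‖phase x y p‖ = 1 := by
  unfold phase
  rw [mul_comm]; exact Complex.norm_exp_ofReal_mul_I _

section GridFourier

variable {hx hy x₀ y₀ : ℝ}

/-- The grid function with a given frequency density. -/
def gridFT (hx hy x₀ y₀ : ℝ) (G : ℝ × ℝ → ℂ) : Grid := fun i j =>
  (∫ p in box hx hy, phase (i * hx - x₀) (j * hy - y₀) p * G p).re

lemma integrableOn_box {G : ℝ × ℝ → ℂ} (hG : Continuous G) (x y : ℝ) :
    IntegrableOn (fun p => phase x y p * G p) (box hx hy) :=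
  ((continuous_phase x y).mul hG).continuousOn.integrableOn_compact (isCompact_box hx hy)

lemma gridFT_add {G G' : ℝ × ℝ → ℂ} (hG : Continuous G) (hG' : Continuous G') (i j : ℤ) :
    gridFT hx hy x₀ y₀ (fun p => G p + G' p) i j = gridFT hx hy x₀ y₀ G i j + gridFT hx hy x₀ y₀ G' i j := by
  unfold gridFT
  rw [← Complex.add_re, ← integral_add (integrableOn_box hG _ _) (integrableOn_box hG' _ _)]
  simp only [mul_add]

lemma gridFT_const_mul (c : ℝ) (G : ℝ × ℝ → ℂ) (i j : ℤ) :
    gridFT hx hy x₀ y₀ (fun p => c * G p) i j = c * gridFT hx hy x₀ y₀ G i j := by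
  unfold gridFT
  rw [← Complex.re_ofReal_mul, ← integral_const_mul]
  congr 2; ext p; ring

lemma gridFT_shift_x (G : ℝ × ℝ → ℂ) (i j d : ℤ) :
    gridFT hx hy x₀ y₀ G (i + d) j =
      gridFT hx hy x₀ y₀ (fun p => Complex.exp (Complex.I * ((d * (hx * p.1) : ℝ) : ℂ)) * G p) i j := by
  unfold gridFT phase
  congr 2; ext p
  rw [← mul_assoc, ← Complex.exp_add]
  congr 2; push_cast; ring

lemma gridFT_shift_y (G : ℝ × ℝ → ℂ) (i j d : ℤ) :
    gridFT hx hy x₀ y₀ G i (j + d) =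
      gridFT hx hy x₀ y₀ (fun p => Complex.exp (Complex.I * ((d * (hy * p.2) : ℝ) : ℂ)) * G p) i j := by
  unfold gridFT phase
  congr 2; ext p
  rw [← mul_assoc, ← Complex.exp_add]
  congr 2; push_cast; ring

lemma exp_sub_exp (a : ℝ) : Complex.exp (Complex.I * (((1 : ℤ) * a : ℝ) : ℂ)) -
    Complex.exp (Complex.I * (((-1 : ℤ) * a : ℝ) : ℂ)) = 2 * Complex.I * (Real.sin a : ℂ) := by
  push_cast
  rw [Complex.sin]
  have := Complex.I_sq
  rw [show Complex.I * (1 * (a : ℂ)) = a * Complex.I by ring, show Complex.I * (-1 * (a : ℂ)) = -a * Complex.I by ring]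
  linear_combination (Complex.exp (a * Complex.I) - Complex.exp (-a * Complex.I)) * this

lemma exp_add_exp (a : ℝ) : Complex.exp (Complex.I * (((1 : ℤ) * a : ℝ) : ℂ)) +
    Complex.exp (Complex.I * (((-1 : ℤ) * a : ℝ) : ℂ)) = 2 * (Real.cos a : ℂ) := by
  push_cast
  rw [Complex.cos]
  rw [show Complex.I * (1 * (a : ℂ)) = a * Complex.I by ring, show Complex.I * (-1 * (a : ℂ)) = -a * Complex.I by ring]
  ring

lemma gridFT_sub {G G' : ℝ × ℝ → ℂ} (hG : Continuous G) (hG' : Continuous G') (i j : ℤ) :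
    gridFT hx hy x₀ y₀ (fun p => G p - G' p) i j = gridFT hx hy x₀ y₀ G i j - gridFT hx hy x₀ y₀ G' i j := by
  unfold gridFT
  rw [← Complex.sub_re, ← integral_sub (integrableOn_box hG _ _) (integrableOn_box hG' _ _)]
  simp only [mul_sub]

lemma Dx_gridFT {G : ℝ × ℝ → ℂ} (hG : Continuous G) : Dx (gridFT hx hy x₀ y₀ G) =
    gridFT hx hy x₀ y₀ fun p => 2 * Complex.I * (Real.sin (hx * p.1) : ℂ) * G p := by
  ext i j
  have h1 := gridFT_shift_x (hx := hx) (hy := hy) (x₀ := x₀) (y₀ := y₀) G i j 1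
  have h2 := gridFT_shift_x (hx := hx) (hy := hy) (x₀ := x₀) (y₀ := y₀) G i j (-1)
  unfold Dx
  rw [sub_eq_add_neg i 1, h1, h2, ← gridFT_sub (by fun_prop) (by fun_prop)]
  congr 1; ext p
  rw [← sub_mul, exp_sub_exp]

lemma Dy_gridFT {G : ℝ × ℝ → ℂ} (hG : Continuous G) : Dy (gridFT hx hy x₀ y₀ G) =
    gridFT hx hy x₀ y₀ fun p => 2 * Complex.I * (Real.sin (hy * p.2) : ℂ) * G p := by
  ext i j
  have h1 := gridFT_shift_y (hx := hx) (hy := hy) (x₀ := x₀) (y₀ := y₀) G i j 1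
  have h2 := gridFT_shift_y (hx := hx) (hy := hy) (x₀ := x₀) (y₀ := y₀) G i j (-1)
  unfold Dy
  rw [sub_eq_add_neg j 1, h1, h2, ← gridFT_sub (by fun_prop) (by fun_prop)]
  congr 1; ext p
  rw [← sub_mul, exp_sub_exp]

lemma Dxx_gridFT {G : ℝ × ℝ → ℂ} (hG : Continuous G) : Dxx (gridFT hx hy x₀ y₀ G) =
    gridFT hx hy x₀ y₀ fun p => (2 * (Real.cos (hx * p.1) : ℂ) - (2 : ℝ)) * G p := by
  ext i j
  have h1 := gridFT_shift_x (hx := hx) (hy := hy) (x₀ := x₀) (y₀ := y₀) G i j 1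
  have h2 := gridFT_shift_x (hx := hx) (hy := hy) (x₀ := x₀) (y₀ := y₀) G i j (-1)
  unfold Dxx
  rw [sub_eq_add_neg i 1, h1, h2, ← gridFT_const_mul, ← gridFT_sub (by fun_prop) (by fun_prop),
    ← gridFT_add (by fun_prop) (by fun_prop)]
  congr 1; ext p
  rw [← exp_add_exp]; ring

lemma Dyy_gridFT {G : ℝ × ℝ → ℂ} (hG : Continuous G) : Dyy (gridFT hx hy x₀ y₀ G) =
    gridFT hx hy x₀ y₀ fun p => (2 * (Real.cos (hy * p.2) : ℂ) - (2 : ℝ)) * G p := by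
  ext i j
  have h1 := gridFT_shift_y (hx := hx) (hy := hy) (x₀ := x₀) (y₀ := y₀) G i j 1
  have h2 := gridFT_shift_y (hx := hx) (hy := hy) (x₀ := x₀) (y₀ := y₀) G i j (-1)
  unfold Dyy
  rw [sub_eq_add_neg j 1, h1, h2, ← gridFT_const_mul, ← gridFT_sub (by fun_prop) (by fun_prop),
    ← gridFT_add (by fun_prop) (by fun_prop)]
  congr 1; ext p
  rw [← exp_add_exp]; ring

lemma Dxy_eq (V : Grid) : Dxy V = Dx (Dy V) := by
  ext i j; simp only [Dxy, Dx, Dy]; ring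

lemma implicitX_gridFT {μ k : ℝ} (hhx : hx ≠ 0) {G : ℝ × ℝ → ℂ} (hG : Continuous G) :
    implicitX μ k hx (gridFT hx hy x₀ y₀ G) =
      gridFT hx hy x₀ y₀ fun p => (1 + impl μ k (symH hx hy p).s (symH hx hy p).σ) * G p := by
  ext i j
  unfold implicitX
  rw [Dx_gridFT hG, Dxx_gridFT hG, ← gridFT_const_mul, ← gridFT_const_mul, ← gridFT_add hG (by fun_prop),
    ← gridFT_sub (by fun_prop) (by fun_prop)]
  congr 1; ext p
  have : (hx : ℂ) ≠ 0 := by exact_mod_cast hhx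
  simp only [impl, symH]
  push_cast
  field_simp
  ring

lemma implicitY_gridFT {μ k : ℝ} (hhy : hy ≠ 0) {G : ℝ × ℝ → ℂ} (hG : Continuous G) :
    implicitY μ k hy (gridFT hx hy x₀ y₀ G) =
      gridFT hx hy x₀ y₀ fun p => (1 + impl μ k (symH hx hy p).t (symH hx hy p).τ) * G p := by
  ext i j
  unfold implicitY
  rw [Dy_gridFT hG, Dyy_gridFT hG, ← gridFT_const_mul, ← gridFT_const_mul, ← gridFT_add hG (by fun_prop),
    ← gridFT_sub (by fun_prop) (by fun_prop)]
  congr 1; ext p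
  have : (hy : ℂ) ≠ 0 := by exact_mod_cast hhy
  simp only [impl, symH]
  push_cast
  field_simp
  ring

/-- The symbol of the explicit operator. -/
def explSym (M : Coeffs) (k : ℝ) (p : Sym) (z : ℝ × ℝ) : ℂ :=
  1 + -Complex.I * noise M k p z + (-Complex.I * noise M k p z) ^ 2 / 2 + itoCorr M k p

/-- The two pure second-order noise terms and the mixed one complete half the square of the
first-order noise symbol; the `-1` in `z ^ 2 - 1` leaves the Itô correction. -/
lemma milsteinRhs_gridFT {M : Coeffs} (hM : M.Valid) {k : ℝ} (hk : 0 ≤ k) (hhx : hx ≠ 0) (hhy : hy ≠ 0)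
    {G : ℝ × ℝ → ℂ} (hG : Continuous G) (z : ℝ × ℝ) :
    milsteinRhs M.ρx M.ρy k hx hy z.1 z.2 (gridFT hx hy x₀ y₀ G) =
      gridFT hx hy x₀ y₀ fun p => explSym M k (symH hx hy p) z * G p := by
  ext i j
  unfold milsteinRhs
  rw [Dxy_eq, Dx_gridFT hG, Dy_gridFT hG, Dx_gridFT (by fun_prop), Dy_gridFT (by fun_prop), Dx_gridFT (by fun_prop)]
  rw [← gridFT_const_mul, ← gridFT_const_mul, ← gridFT_const_mul, ← gridFT_const_mul, ← gridFT_const_mul,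
    ← gridFT_sub hG (by fun_prop), ← gridFT_sub (by fun_prop) (by fun_prop),
    ← gridFT_add (by fun_prop) (by fun_prop), ← gridFT_add (by fun_prop) (by fun_prop),
    ← gridFT_add (by fun_prop) (by fun_prop)]
  congr 1; ext p
  have hx' : (hx : ℂ) ≠ 0 := by exact_mod_cast hhx
  have hy' : (hy : ℂ) ≠ 0 := by exact_mod_cast hhy
  have s1 : (√k : ℂ) ^ 2 = k := by rw [← Complex.ofReal_pow, Real.sq_sqrt hk]
  have s2 : (√M.ρx : ℂ) ^ 2 = M.ρx := by rw [← Complex.ofReal_pow, Real.sq_sqrt hM.x0]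
  have s3 : (√M.ρy : ℂ) ^ 2 = M.ρy := by rw [← Complex.ofReal_pow, Real.sq_sqrt hM.y0]
  have hI := Complex.I_sq
  rw [Real.sqrt_mul hM.x0, Real.sqrt_mul hM.y0, Real.sqrt_mul hM.x0]
  simp only [explSym, noise, itoCorr, symH]
  push_cast
  rw [← s1, ← s2, ← s3]
  field_simp
  ring_nf
  simp only [hI]
  ring

end GridFourier

/-! ### The scheme as an inverse Fourier transform over the box -/

section GridSolution

variable {hx hy x₀ y₀ : ℝ}

/-- Parseval: as the starting point is a grid point, the integral is `2 * π / h` times the Fourier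
coefficient of `f` of index `i₀ - i`. -/
lemma summable_sq_fourier_integral {h x₀ : ℝ} (hh : 0 < h) {f : ℝ → ℂ} (hf : Continuous f) (i₀ : ℤ)
    (hx₀ : x₀ = i₀ * h) :
    Summable fun i : ℤ => ‖∫ ξ in Set.Icc (-(Real.pi / h)) (Real.pi / h),
      Complex.exp (Complex.I * ((ξ * (i * h - x₀) : ℝ) : ℂ)) * f ξ‖ ^ 2 := by
  have hpi := Real.pi_pos
  have hab : -(Real.pi / h) < Real.pi / h := by
    have : 0 < Real.pi / h := by positivity
    linarith
  have hm : MemLp f 2 (volume.restrict (Set.Ioc (-(Real.pi / h)) (Real.pi / h))) := by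
    have : IsFiniteMeasure (volume.restrict (Set.Ioc (-(Real.pi / h)) (Real.pi / h))) := by
      refine ⟨by simp⟩
    obtain ⟨C, hC⟩ := (isCompact_Icc (a := -(Real.pi / h)) (b := Real.pi / h)).exists_bound_of_continuousOn
      hf.continuousOn
    refine MemLp.of_bound hf.aestronglyMeasurable C ?_
    filter_upwards [ae_restrict_mem measurableSet_Ioc] with x hx
    exact hC x ⟨hx.1.le, hx.2⟩
  have hs := (hasSum_sq_fourierCoeffOn hab hm).summable
  have hs2 := ((Equiv.subLeft i₀).summable_iff (f := fun i => ‖fourierCoeffOn hab f i‖ ^ 2)).2 hs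
  refine (hs2.mul_left ((2 * (Real.pi / h)) ^ 2)).congr fun i => ?_
  simp only [Function.comp, Equiv.subLeft_apply]
  rw [fourierCoeffOn_eq_integral, intervalIntegral.integral_of_le hab.le, ← integral_Icc_eq_integral_Ioc,
    norm_smul, ← mul_pow, ← mul_assoc]
  have e1 : 2 * (Real.pi / h) * ‖1 / (Real.pi / h - -(Real.pi / h))‖ = 1 := by
    rw [Real.norm_of_nonneg (by rw [one_div]; positivity)]
    field_simp; ring
  rw [e1, one_mul]
  congr 2
  refine setIntegral_congr_fun measurableSet_Icc fun ξ _ => ?_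
  simp only [smul_eq_mul]
  rw [fourier_coe_apply]
  congr 2
  have h1 : (h : ℂ) ≠ 0 := by exact_mod_cast hh.ne'
  have h2 : (Real.pi : ℂ) ≠ 0 := by exact_mod_cast hpi.ne'
  rw [hx₀]
  push_cast
  field_simp
  ring

/-- For a fixed row, integrating out the second frequency by Fubini leaves a one-dimensional Fourier
integral of a continuous density. -/
lemma summable_row_gridFT (hhx : 0 < hx) {G : ℝ × ℝ → ℂ} (hG : Continuous G) {i₀ : ℤ}
    (hx₀ : x₀ = i₀ * hx) (j : ℤ) : Summable fun i => gridFT hx hy x₀ y₀ G i j ^ 2 := by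
  let f : ℝ → ℂ := fun ξ => ∫ η in Set.Icc (-(Real.pi / hy)) (Real.pi / hy),
    Complex.exp (Complex.I * ((η * (j * hy - y₀) : ℝ) : ℂ)) * G (ξ, η)
  have hf : Continuous f := continuous_parametric_integral_of_continuous (by fun_prop) isCompact_Icc
  refine Summable.of_nonneg_of_le (fun i => sq_nonneg _) (fun i => ?_)
    (summable_sq_fourier_integral hhx hf i₀ hx₀)
  have e : ∫ p in box hx hy, phase (i * hx - x₀) (j * hy - y₀) p * G p =
      ∫ ξ in Set.Icc (-(Real.pi / hx)) (Real.pi / hx), Complex.exp (Complex.I * ((ξ * (i * hx - x₀) : ℝ) : ℂ)) * f ξ := by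
    have := setIntegral_prod (μ := volume) (ν := volume) (fun p => phase (i * hx - x₀) (j * hy - y₀) p * G p)
      (s := Set.Icc (-(Real.pi / hx)) (Real.pi / hx)) (t := Set.Icc (-(Real.pi / hy)) (Real.pi / hy))
      (integrableOn_box hG _ _)
    unfold box
    rw [Measure.volume_eq_prod, this]
    refine setIntegral_congr_fun measurableSet_Icc fun ξ _ => ?_
    simp only [f]
    rw [← integral_const_mul]
    congr 1; ext η
    unfold phase
    rw [← mul_assoc, ← Complex.exp_add]
    congr 2; push_cast; ring
  unfold gridFT
  rw [e, ← sq_abs]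
  exact pow_le_pow_left₀ (abs_nonneg _) (Complex.abs_re_le_norm _) 2

lemma summable_col_gridFT (hhy : 0 < hy) {G : ℝ × ℝ → ℂ} (hG : Continuous G) {j₀ : ℤ}
    (hy₀ : y₀ = j₀ * hy) (i : ℤ) : Summable fun j => gridFT hx hy x₀ y₀ G i j ^ 2 := by
  let G' : ℝ × ℝ → ℂ := fun p => G p.swap
  have hG' : Continuous G' := hG.comp continuous_swap
  have := summable_row_gridFT (hx := hy) (hy := hx) (x₀ := y₀) (y₀ := x₀) hhy hG' hy₀ i
  refine this.congr fun j => ?_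
  congr 1
  unfold gridFT
  congr 1
  have hmp : MeasurePreserving (Prod.swap : ℝ × ℝ → ℝ × ℝ) volume volume := by
    rw [Measure.volume_eq_prod]; exact Measure.measurePreserving_swap
  have hpre : Prod.swap ⁻¹' (box hx hy) = box hy hx := by
    ext p; simp [box, and_comm]
  rw [← hmp.setIntegral_preimage_emb MeasurableEquiv.prodComm.measurableEmbedding _ (box hx hy), hpre]
  congr 1; ext p
  simp only [G', phase, Prod.fst_swap, Prod.snd_swap]
  congr 3; push_cast; ring

lemma integral_exp_box {h : ℝ} (hh : 0 < h) (m : ℤ) :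
    ∫ ξ in Set.Icc (-(Real.pi / h)) (Real.pi / h), Complex.exp (Complex.I * ((ξ * (m * h) : ℝ) : ℂ)) =
      if m = 0 then ((2 * Real.pi / h : ℝ) : ℂ) else 0 := by
  have hpi := Real.pi_pos
  have hab : -(Real.pi / h) ≤ Real.pi / h := by
    have : 0 < Real.pi / h := by positivity
    linarith
  rw [integral_Icc_eq_integral_Ioc, ← intervalIntegral.integral_of_le hab]
  split_ifs with hm
  · subst hm
    simp
    ring
  · have hc : (Complex.I * (m * h : ℝ) : ℂ) ≠ 0 := by
      refine mul_ne_zero Complex.I_ne_zero ?_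
      exact_mod_cast mul_ne_zero (by exact_mod_cast hm) hh.ne'
    have e : ∀ ξ : ℝ, Complex.exp (Complex.I * ((ξ * (m * h) : ℝ) : ℂ)) =
        Complex.exp ((Complex.I * (m * h : ℝ) : ℂ) * ξ) := by
      intro ξ; congr 1; push_cast; ring
    simp only [e]
    rw [integral_exp_mul_complex hc]
    have h1 : (Complex.I * (m * h : ℝ) : ℂ) * ((Real.pi / h : ℝ) : ℂ) =
        (Complex.I * (m * h : ℝ) : ℂ) * ((-(Real.pi / h) : ℝ) : ℂ) + m * (2 * Real.pi * Complex.I) := by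
      have : (h : ℂ) ≠ 0 := by exact_mod_cast hh.ne'
      push_cast; field_simp; ring
    rw [h1, Complex.exp_periodic.int_mul m]
    simp

/-- Orthogonality of characters over the box: a discrete Dirac mass has constant density. This fixes
the normalisation `(4 * π ^ 2)⁻¹` used throughout. -/
lemma gridFT_one (hhx : 0 < hx) (hhy : 0 < hy) {i₀ j₀ : ℤ} (hx₀ : x₀ = i₀ * hx) (hy₀ : y₀ = j₀ * hy) (i j : ℤ) :
    gridFT hx hy x₀ y₀ (fun _ => 1) i j =
      4 * Real.pi ^ 2 * (if i = i₀ ∧ j = j₀ then hx⁻¹ * hy⁻¹ else 0) := by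
  have e : ∀ p : ℝ × ℝ, phase (i * hx - x₀) (j * hy - y₀) p * 1 =
      Complex.exp (Complex.I * ((p.1 * (((i - i₀ : ℤ) : ℝ) * hx) : ℝ) : ℂ)) *
      Complex.exp (Complex.I * ((p.2 * (((j - j₀ : ℤ) : ℝ) * hy) : ℝ) : ℂ)) := by
    intro p
    unfold phase
    rw [mul_one, ← Complex.exp_add, hx₀, hy₀]
    congr 1; push_cast; ring
  unfold gridFT box
  simp only [e]
  rw [Measure.volume_eq_prod, setIntegral_prod_mul (fun ξ : ℝ =>
    Complex.exp (Complex.I * ((ξ * (((i - i₀ : ℤ) : ℝ) * hx) : ℝ) : ℂ))) (fun η : ℝ =>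
    Complex.exp (Complex.I * ((η * (((j - j₀ : ℤ) : ℝ) * hy) : ℝ) : ℂ))), integral_exp_box hhx,
    integral_exp_box hhy]
  simp only [sub_eq_zero]
  by_cases h1 : i = i₀ <;> by_cases h2 : j = j₀ <;> simp [h1, h2, -Complex.ofReal_div, -Complex.ofReal_mul, ← Complex.ofReal_mul]
  field_simp
  ring

variable {Ω : Type*} {Z : ℕ → Ω → ℝ × ℝ}

lemma one_add_impl_ne_zero {μ k s σ : ℝ} (hk : 0 ≤ k) (hσ : 0 ≤ σ) : 1 + impl μ k s σ ≠ 0 := by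
  intro h
  have := congrArg Complex.re h
  simp [impl] at this
  nlinarith [mul_nonneg hk hσ]

/-- The difference of the numerators is `(1 - cos a) ^ 2`. The bound means that central first
differences are dominated by the discrete diffusion, which is all that stability uses. -/
lemma symH_sq_le {h : ℝ} (a : ℝ) : (Real.sin a / h) ^ 2 ≤ (2 - 2 * Real.cos a) / h ^ 2 := by
  rw [div_pow]
  refine div_le_div_of_nonneg_right ?_ (sq_nonneg h)
  nlinarith [Real.sin_sq_add_cos_sq a, sq_nonneg (1 - Real.cos a)]

lemma symH_s_sq (hx hy : ℝ) (p : ℝ × ℝ) : (symH hx hy p).s ^ 2 ≤ (symH hx hy p).σ := symH_sq_le _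

lemma symH_t_sq (hx hy : ℝ) (p : ℝ × ℝ) : (symH hx hy p).t ^ 2 ≤ (symH hx hy p).τ := symH_sq_le _

lemma continuous_explSym (M : Coeffs) (k : ℝ) (z : ℝ × ℝ) :
    Continuous fun p => explSym M k (symH hx hy p) z := by
  unfold explSym noise itoCorr symH; fun_prop

lemma continuous_implX (M : Coeffs) (k : ℝ) :
    Continuous fun p => 1 + impl M.μx k (symH hx hy p).s (symH hx hy p).σ := by
  unfold impl symH; fun_prop

lemma continuous_implY (M : Coeffs) (k : ℝ) :
    Continuous fun p => 1 + impl M.μy k (symH hx hy p).t (symH hx hy p).τ := by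
  unfold impl symH; fun_prop

lemma continuous_ratF_symH (M : Coeffs) {k : ℝ} (hk : 0 ≤ k) (z : ℝ × ℝ) :
    Continuous fun p => ratF M k (symH hx hy p) z := by
  unfold ratF ratStep
  refine (continuous_explSym M k z).mul (((continuous_implX M k).mul (continuous_implY M k)).inv₀ fun p => ?_)
  exact mul_ne_zero (one_add_impl_ne_zero hk ((sq_nonneg _).trans (symH_s_sq hx hy p)))
    (one_add_impl_ne_zero hk ((sq_nonneg _).trans (symH_t_sq hx hy p)))

lemma continuous_stepProd_symH (M : Coeffs) {k : ℝ} (hk : 0 ≤ k) (n : ℕ) (ω : Ω) :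
    Continuous fun p => stepProd (ratF M k (symH hx hy p)) Z n ω := by
  induction n with
  | zero => exact continuous_const
  | succ n ih => exact (continuous_ratF_symH M hk _).mul ih

lemma round_grid {h x : ℝ} (hh : 0 < h) {i : ℤ} (hx : x = i * h) : round (x / h) = i := by
  rw [hx, mul_div_cancel_right₀ _ hh.ne', round_intCast]

/-- The scheme is the inverse Fourier transform of the product of amplification factors. -/
lemma IsADIPath.eq_gridFT {M : Coeffs} (hM : M.Valid) {k : ℝ} (hk : 0 ≤ k) (hhx : 0 < hx) (hhy : 0 < hy)
    {i₀ j₀ : ℤ} (hx₀ : x₀ = i₀ * hx) (hy₀ : y₀ = j₀ * hy) {V : ℕ → Grid} {zx zy : ℕ → ℝ}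
    (hV : IsADIPath M.μx M.μy M.ρx M.ρy x₀ y₀ k hx hy zx zy V) {ω : Ω} (hZ : ∀ n, Z n ω = (zx n, zy n))
    (n : ℕ) (i j : ℤ) :
    V n i j = (4 * Real.pi ^ 2)⁻¹ *
      gridFT hx hy x₀ y₀ (fun p => stepProd (ratF M k (symH hx hy p)) Z n ω) i j := by
  have hpi := Real.pi_pos
  have hcont := fun n => continuous_stepProd_symH (hx := hx) (hy := hy) (Z := Z) M hk n ω
  rw [← gridFT_const_mul]
  induction n generalizing i j with
  | zero =>
    rw [hV.init, round_grid hhx hx₀, round_grid hhy hy₀]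
    simp only [stepProd]
    rw [gridFT_const_mul, gridFT_one hhx hhy hx₀ hy₀]
    field_simp
  | succ n ih =>
    set U : Grid := gridFT hx hy x₀ y₀ fun p => (((4 * Real.pi ^ 2)⁻¹ : ℝ) : ℂ) *
      stepProd (ratF M k (symH hx hy p)) Z (n + 1) ω with hU
    have hVn : V n = gridFT hx hy x₀ y₀ fun p => (((4 * Real.pi ^ 2)⁻¹ : ℝ) : ℂ) *
      stepProd (ratF M k (symH hx hy p)) Z n ω := by
      ext i j; exact ih i j
    have c1 : Continuous fun p => (((4 * Real.pi ^ 2)⁻¹ : ℝ) : ℂ) *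
      stepProd (ratF M k (symH hx hy p)) Z (n + 1) ω := continuous_const.mul (hcont (n + 1))
    have c0 : Continuous fun p => (((4 * Real.pi ^ 2)⁻¹ : ℝ) : ℂ) *
      stepProd (ratF M k (symH hx hy p)) Z n ω := continuous_const.mul (hcont n)
    have c2 : Continuous fun p => (1 + impl M.μy k (symH hx hy p).t (symH hx hy p).τ) *
      ((((4 * Real.pi ^ 2)⁻¹ : ℝ) : ℂ) * stepProd (ratF M k (symH hx hy p)) Z (n + 1) ω) :=
      (continuous_implY M k).mul c1
    have hUstep : implicitX M.μx k hx (implicitY M.μy k hy U) =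
        milsteinRhs M.ρx M.ρy k hx hy (zx n) (zy n) (V n) := by
      have hm := milsteinRhs_gridFT (x₀ := x₀) (y₀ := y₀) hM hk hhx.ne' hhy.ne'
        c0 (Z n ω)
      rw [hZ n] at hm
      rw [hVn, hm, hU, implicitY_gridFT hhy.ne' c1, implicitX_gridFT hhx.ne' c2]
      congr 1; ext p
      simp only [stepProd, ratF, ratStep, explSym, hZ n]
      have n1 := one_add_impl_ne_zero (μ := M.μx) (s := (symH hx hy p).s) hk
        ((sq_nonneg _).trans (symH_s_sq hx hy p))
      have n2 := one_add_impl_ne_zero (μ := M.μy) (s := (symH hx hy p).t) hk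
        ((sq_nonneg _).trans (symH_t_sq hx hy p))
      field_simp
    -- The Fourier candidate solves the same implicit equation as `V (n + 1)`. The difference has
    -- square-summable rows and columns, so it vanishes.
    have hzero := eq_zero_of_implicitXY (μx := M.μx) (μy := M.μy) (hx := hx) (hy := hy) hk
      (W := fun i j => V (n + 1) i j - U i j) ?_ ?_ ?_ i j
    · linarith
    · intro j
      have s1 : Summable fun i => V (n + 1) i j ^ 2 :=
        (hV.summable (n + 1)).comp_injective (i := fun i : ℤ => (i, j)) fun a b h => (Prod.mk.inj h).1
      have s2 := summable_row_gridFT (hy := hy) (y₀ := y₀) hhx c1 hx₀ j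
      refine (summable_lin_comb s1 s2 s2 1 (-1) 0).congr fun i => ?_
      ring
    · intro i
      have s1 : Summable fun j => V (n + 1) i j ^ 2 :=
        (hV.summable (n + 1)).comp_injective (i := fun j : ℤ => (i, j)) fun a b h => (Prod.mk.inj h).2
      have s2 := summable_col_gridFT (hx := hx) (x₀ := x₀) hhy c1 hy₀ i
      refine (summable_lin_comb s1 s2 s2 1 (-1) 0).congr fun j => ?_
      ring
    · intro i j
      have e1 := hV.step n i j
      have e2 := congrFun (congrFun hUstep i) j
      rw [← e2] at e1
      simp only [implicitX, implicitY, Dx, Dxx, Dy, Dyy] at e1 ⊢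
      linear_combination e1

end GridSolution

/-! ### Taylor bounds for sine and cosine -/

section Trigonometric

lemma nonneg_of_deriv_nonneg {f f' : ℝ → ℝ} (hf : ∀ x, HasDerivAt f (f' x) x) (h0 : f 0 = 0)
    (hf' : ∀ x, 0 ≤ x → 0 ≤ f' x) (x : ℝ) (hx : 0 ≤ x) : 0 ≤ f x := by
  have hm : MonotoneOn f (Set.Ici 0) := by
    refine monotoneOn_of_deriv_nonneg (convex_Ici 0) (fun y _ => (hf y).continuousAt.continuousWithinAt)
      (fun y _ => (hf y).differentiableAt.differentiableWithinAt) fun y hy => ?_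
    rw [(hf y).deriv]
    rw [interior_Ici] at hy
    exact hf' y (le_of_lt hy)
  have := hm (Set.mem_Ici.2 le_rfl) (Set.mem_Ici.2 hx) hx
  rwa [h0] at this

/-- Alternating bounds, each obtained by integrating the previous one, starting from `1 - x ^ 2 / 2
≤ cos x`. -/
lemma taylor_sin_cos {x : ℝ} (hx : 0 ≤ x) :
    x - x ^ 3 / 6 ≤ Real.sin x ∧ Real.sin x ≤ x - x ^ 3 / 6 + x ^ 5 / 120 ∧
    1 - x ^ 2 / 2 ≤ Real.cos x ∧ Real.cos x ≤ 1 - x ^ 2 / 2 + x ^ 4 / 24 ∧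
    1 - x ^ 2 / 2 + x ^ 4 / 24 - x ^ 6 / 720 ≤ Real.cos x := by
  have hp : ∀ (n : ℕ) (x : ℝ), HasDerivAt (fun x : ℝ => x ^ n) (n * x ^ (n - 1)) x := fun n x =>
    hasDerivAt_pow n x
  have c2 : ∀ x : ℝ, 0 ≤ x → 0 ≤ Real.cos x - (1 - x ^ 2 / 2) := fun x _ => by
    linarith [Real.one_sub_sq_div_two_le_cos (x := x)]
  have s3 : ∀ x : ℝ, 0 ≤ x → 0 ≤ Real.sin x - (x - x ^ 3 / 6) :=
    nonneg_of_deriv_nonneg (fun x => by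
      refine ((Real.hasDerivAt_sin x).sub ((hasDerivAt_id x).sub ((hp 3 x).div_const 6))).congr_deriv
        (g' := Real.cos x - (1 - x ^ 2 / 2)) ?_
      norm_num; ring) (by simp) c2
  have c4 : ∀ x : ℝ, 0 ≤ x → 0 ≤ (1 - x ^ 2 / 2 + x ^ 4 / 24) - Real.cos x :=
    nonneg_of_deriv_nonneg (fun x => by
      refine ((((hasDerivAt_const x (1 : ℝ)).sub ((hp 2 x).div_const 2)).add ((hp 4 x).div_const 24)).sub
        (Real.hasDerivAt_cos x)).congr_deriv (g' := Real.sin x - (x - x ^ 3 / 6)) ?_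
      norm_num; ring) (by simp) s3
  have s5 : ∀ x : ℝ, 0 ≤ x → 0 ≤ (x - x ^ 3 / 6 + x ^ 5 / 120) - Real.sin x :=
    nonneg_of_deriv_nonneg (fun x => by
      refine ((((hasDerivAt_id x).sub ((hp 3 x).div_const 6)).add ((hp 5 x).div_const 120)).sub
        (Real.hasDerivAt_sin x)).congr_deriv (g' := (1 - x ^ 2 / 2 + x ^ 4 / 24) - Real.cos x) ?_
      norm_num; ring) (by simp) c4
  have c6 : ∀ x : ℝ, 0 ≤ x → 0 ≤ Real.cos x - (1 - x ^ 2 / 2 + x ^ 4 / 24 - x ^ 6 / 720) :=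
    nonneg_of_deriv_nonneg (fun x => by
      refine ((Real.hasDerivAt_cos x).sub ((((hasDerivAt_const x (1 : ℝ)).sub ((hp 2 x).div_const 2)).add
        ((hp 4 x).div_const 24)).sub ((hp 6 x).div_const 720))).congr_deriv
        (g' := (x - x ^ 3 / 6 + x ^ 5 / 120) - Real.sin x) ?_
      norm_num; ring) (by simp) s5
  exact ⟨by linarith [s3 x hx], by linarith [s5 x hx], by linarith [c2 x hx], by linarith [c4 x hx],
    by linarith [c6 x hx]⟩

lemma abs_sin_sub_le (x : ℝ) : |Real.sin x - x| ≤ |x| ^ 3 ∧ |Real.sin x - x + x ^ 3 / 6| ≤ |x| ^ 5 := by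
  wlog hx : 0 ≤ x generalizing x
  · have := this (-x) (by linarith)
    rw [Real.sin_neg, abs_neg] at this
    refine ⟨le_trans (le_of_eq ?_) this.1, le_trans (le_of_eq ?_) this.2⟩
    · rw [← abs_neg]; congr 1; ring
    · rw [← abs_neg]; congr 1; ring
  obtain ⟨h1, h2, -, -, -⟩ := taylor_sin_cos hx
  have h3 := Real.sin_le hx
  rw [abs_of_nonneg hx]
  have p3 : 0 ≤ x ^ 3 := by positivity
  have p5 : 0 ≤ x ^ 5 := by positivity
  exact ⟨abs_le.2 ⟨by linarith, by linarith⟩, abs_le.2 ⟨by linarith, by linarith⟩⟩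

lemma abs_two_sub_two_cos_sub_le (x : ℝ) :
    |2 - 2 * Real.cos x - x ^ 2| ≤ x ^ 4 ∧ |2 - 2 * Real.cos x - x ^ 2 + x ^ 4 / 12| ≤ x ^ 6 := by
  wlog hx : 0 ≤ x generalizing x
  · have := this (-x) (by linarith)
    rwa [Real.cos_neg, Even.neg_pow (by decide), Even.neg_pow (by decide), Even.neg_pow (by decide)] at this
  obtain ⟨-, -, h3, h4, h5⟩ := taylor_sin_cos hx
  have p4 : 0 ≤ x ^ 4 := by positivity
  have p6 : 0 ≤ x ^ 6 := by positivity
  exact ⟨abs_le.2 ⟨by linarith, by linarith⟩, abs_le.2 ⟨by linarith, by linarith⟩⟩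

end Trigonometric

/-! ### Discrete against continuous symbols -/

section Symbol

variable {h L : ℝ}

lemma diffSymbol_bounds (hh : 0 < h) (ξ : ℝ) :
    |Real.sin (h * ξ) / h| ≤ |ξ| ∧ (2 - 2 * Real.cos (h * ξ)) / h ^ 2 ≤ ξ ^ 2 := by
  constructor
  · rw [abs_div, abs_of_pos hh, div_le_iff₀ hh]
    refine Real.abs_sin_le_abs.trans (le_of_eq ?_)
    rw [abs_mul, abs_of_pos hh, mul_comm]
  · rw [div_le_iff₀ (by positivity)]
    have := Real.one_sub_sq_div_two_le_cos (x := h * ξ)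
    nlinarith

lemma diffSymbol_first (hh : 0 < h) (ξ : ℝ) :
    |Real.sin (h * ξ) / h - ξ| ≤ h ^ 2 * |ξ| ^ 3 ∧
    |(2 - 2 * Real.cos (h * ξ)) / h ^ 2 - ξ ^ 2| ≤ h ^ 2 * ξ ^ 4 := by
  constructor
  · have e : Real.sin (h * ξ) / h - ξ = (Real.sin (h * ξ) - h * ξ) / h := by field_simp
    rw [e, abs_div, abs_of_pos hh, div_le_iff₀ hh]
    refine (abs_sin_sub_le _).1.trans (le_of_eq ?_)
    rw [abs_mul, abs_of_pos hh]; ring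
  · have e : (2 - 2 * Real.cos (h * ξ)) / h ^ 2 - ξ ^ 2 =
        (2 - 2 * Real.cos (h * ξ) - (h * ξ) ^ 2) / h ^ 2 := by field_simp
    rw [e, abs_div, abs_of_pos (by positivity : 0 < h ^ 2), div_le_iff₀ (by positivity)]
    refine (abs_two_sub_two_cos_sub_le _).1.trans (le_of_eq ?_)
    ring

lemma diffSymbol_second (hh : 0 < h) (ξ : ℝ) :
    |Real.sin (h * ξ) / h - ξ + h ^ 2 * ξ ^ 3 / 6| ≤ h ^ 4 * |ξ| ^ 5 ∧
    |(2 - 2 * Real.cos (h * ξ)) / h ^ 2 - ξ ^ 2 + h ^ 2 * ξ ^ 4 / 12| ≤ h ^ 4 * ξ ^ 6 := by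
  constructor
  · have e : Real.sin (h * ξ) / h - ξ + h ^ 2 * ξ ^ 3 / 6 =
        (Real.sin (h * ξ) - h * ξ + (h * ξ) ^ 3 / 6) / h := by field_simp
    rw [e, abs_div, abs_of_pos hh, div_le_iff₀ hh]
    refine (abs_sin_sub_le _).2.trans (le_of_eq ?_)
    rw [abs_mul, abs_of_pos hh]; ring
  · have e : (2 - 2 * Real.cos (h * ξ)) / h ^ 2 - ξ ^ 2 + h ^ 2 * ξ ^ 4 / 12 =
        (2 - 2 * Real.cos (h * ξ) - (h * ξ) ^ 2 + (h * ξ) ^ 4 / 12) / h ^ 2 := by field_simp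
    rw [e, abs_div, abs_of_pos (by positivity : 0 < h ^ 2), div_le_iff₀ (by positivity)]
    refine (abs_two_sub_two_cos_sub_le _).2.trans (le_of_eq ?_)
    ring

/-- The concave bound `cos x ≤ 1 - 2 / π ^ 2 * x ^ 2` holds for `|x| ≤ π`, which is exactly the
frequency box. There the discrete diffusion controls the continuous one, so decay in `σ + τ` becomes
Gaussian decay in the frequency. -/
lemma le_diffSymbol_of_mem (hh : 0 < h) {ξ : ℝ} (hξ : ξ ∈ Set.Icc (-(Real.pi / h)) (Real.pi / h)) :
    4 / Real.pi ^ 2 * ξ ^ 2 ≤ (2 - 2 * Real.cos (h * ξ)) / h ^ 2 := by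
  rw [le_div_iff₀ (by positivity)]
  have h1 : |h * ξ| ≤ Real.pi := by
    rw [abs_mul, abs_of_pos hh, mul_comm, ← le_div_iff₀ hh]
    exact abs_le.2 hξ
  have := Real.cos_le_one_sub_mul_cos_sq h1
  calc _ = 2 * (2 / Real.pi ^ 2 * (h * ξ) ^ 2) := by ring
    _ ≤ _ := by linarith

/-- The size of a frequency. -/
def freq (p : ℝ × ℝ) : ℝ := 1 + |p.1| + |p.2|

lemma one_le_freq (p : ℝ × ℝ) : 1 ≤ freq p := by
  unfold freq; linarith [abs_nonneg p.1, abs_nonneg p.2]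

lemma abs_fst_le_freq (p : ℝ × ℝ) : |p.1| ≤ freq p := by unfold freq; linarith [abs_nonneg p.2]

lemma abs_snd_le_freq (p : ℝ × ℝ) : |p.2| ≤ freq p := by unfold freq; linarith [abs_nonneg p.1]

lemma abs_pow_le_pow {x : ℝ} (hL : 1 ≤ L) (hx : |x| ≤ L) {m n : ℕ} (hmn : m ≤ n) : |x| ^ m ≤ L ^ n :=
  (pow_le_pow_left₀ (abs_nonneg _) hx m).trans (pow_le_pow_right₀ hL hmn)

lemma symZ_bounded (p : ℝ × ℝ) : (symZ p).Bounded (freq p) where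
  s := abs_fst_le_freq p
  t := abs_snd_le_freq p
  s_sq := le_rfl
  t_sq := le_rfl
  σ := by
    have := abs_pow_le_pow (one_le_freq p) (abs_fst_le_freq p) (le_refl 2)
    rwa [sq_abs] at this
  τ := by
    have := abs_pow_le_pow (one_le_freq p) (abs_snd_le_freq p) (le_refl 2)
    rwa [sq_abs] at this

variable {hx hy : ℝ}

lemma symH_bounded (hhx : 0 < hx) (hhy : 0 < hy) (p : ℝ × ℝ) : (symH hx hy p).Bounded (freq p) where
  s := (diffSymbol_bounds hhx p.1).1.trans (symZ_bounded p).s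
  t := (diffSymbol_bounds hhy p.2).1.trans (symZ_bounded p).t
  s_sq := symH_s_sq hx hy p
  t_sq := symH_t_sq hx hy p
  σ := (diffSymbol_bounds hhx p.1).2.trans (symZ_bounded p).σ
  τ := (diffSymbol_bounds hhy p.2).2.trans (symZ_bounded p).τ

lemma even_pow_le {x : ℝ} (hL : 1 ≤ L) (hx : |x| ≤ L) {m n : ℕ} (hm : Even m) (hmn : m ≤ n) : x ^ m ≤ L ^ n := by
  rw [← hm.pow_abs]; exact abs_pow_le_pow hL hx hmn

lemma symH_near (hhx : 0 < hx) (hhy : 0 < hy) (p : ℝ × ℝ) :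
    (symH hx hy p).Near (symZ p) ((hx ^ 2 + hy ^ 2) * freq p ^ 4) := by
  have hL := one_le_freq p
  have b1 := abs_fst_le_freq p
  have b2 := abs_snd_le_freq p
  have l1 : hx ^ 2 ≤ hx ^ 2 + hy ^ 2 := by linarith [sq_nonneg hy]
  have l2 : hy ^ 2 ≤ hx ^ 2 + hy ^ 2 := by linarith [sq_nonneg hx]
  refine ⟨(diffSymbol_first hhx p.1).1.trans ?_, (diffSymbol_first hhy p.2).1.trans ?_,
    (diffSymbol_first hhx p.1).2.trans ?_, (diffSymbol_first hhy p.2).2.trans ?_⟩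
  · exact mul_le_mul l1 (abs_pow_le_pow hL b1 (by norm_num)) (by positivity) (by positivity)
  · exact mul_le_mul l2 (abs_pow_le_pow hL b2 (by norm_num)) (by positivity) (by positivity)
  · exact mul_le_mul l1 (even_pow_le hL b1 (by decide) (by norm_num)) (by positivity) (by positivity)
  · exact mul_le_mul l2 (even_pow_le hL b2 (by decide) (by norm_num)) (by positivity) (by positivity)

/-- The Gaussian decay rate of the mean-square amplification. -/
def decayRate (lam : ℝ) : ℝ := (1 - lam) / 2 * (4 / Real.pi ^ 2)

lemma four_div_pi_sq_le : 4 / Real.pi ^ 2 ≤ 1 := by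
  rw [div_le_one (by positivity)]
  nlinarith [Real.pi_gt_three]

lemma decayRate_pos {lam : ℝ} (h : lam < 1) : 0 < decayRate lam := by
  have := sub_pos.2 h
  unfold decayRate
  positivity

lemma exp_symH_le {lam k : ℝ} (hl : lam < 1) (hk : 0 ≤ k) (hhx : 0 < hx) (hhy : 0 < hy) {p : ℝ × ℝ} (hp : p ∈ box hx hy) :
    Real.exp (-((1 - lam) / 2 * (k * ((symH hx hy p).σ + (symH hx hy p).τ)))) ≤
      Real.exp (-(decayRate lam * (k * (p.1 ^ 2 + p.2 ^ 2)))) := by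
  apply Real.exp_le_exp.2
  have h1 := le_diffSymbol_of_mem hhx hp.1
  have h2 := le_diffSymbol_of_mem hhy hp.2
  have h3 : 0 ≤ (1 - lam) / 2 * k := mul_nonneg (by linarith) hk
  have := mul_le_mul_of_nonneg_left (add_le_add h1 h2) h3
  unfold decayRate symH
  simp only
  linarith

lemma exp_symZ_le {lam k : ℝ} (hl : lam < 1) (hk : 0 ≤ k) (p : ℝ × ℝ) :
    Real.exp (-((1 - lam) / 2 * (k * ((symZ p).σ + (symZ p).τ)))) ≤
      Real.exp (-(decayRate lam * (k * (p.1 ^ 2 + p.2 ^ 2)))) := by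
  apply Real.exp_le_exp.2
  have h3 : 0 ≤ (1 - lam) / 2 * (k * (p.1 ^ 2 + p.2 ^ 2)) :=
    mul_nonneg (by linarith) (mul_nonneg hk (by positivity))
  have := mul_le_mul_of_nonneg_left four_div_pi_sq_le h3
  unfold decayRate symZ
  simp only
  linarith

/-- At low frequency `k * (p.1 ^ 2 + p.2 ^ 2) ≤ 1 / 8`, so the decay over one step stays above one
half. This is the hypothesis `1 ≤ 2 * q` of the Gronwall estimate. -/
lemma one_le_two_mul_exp {M : Coeffs} {lam k : ℝ} (h0 : 0 < lam) (hk : 0 ≤ k) {p : ℝ × ℝ}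
    (hs : scale M k (freq p) ≤ 1 / 4) : 1 ≤ 2 * Real.exp (-(decayRate lam * (k * (p.1 ^ 2 + p.2 ^ 2)))) := by
  have h2 := (scale_bounds_diam (M := M) hk (one_le_freq p)).2.1
  have hs0 := scale_nonneg M k (freq p)
  have h3 : k * freq p ^ 2 ≤ 1 / 16 := by nlinarith
  have hp : p.1 ^ 2 + p.2 ^ 2 ≤ freq p ^ 2 + freq p ^ 2 := add_le_add (symZ_bounded p).σ (symZ_bounded p).τ
  have h4 : k * (p.1 ^ 2 + p.2 ^ 2) ≤ 1 / 8 := by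
    have := mul_le_mul_of_nonneg_left hp hk
    linarith
  have h5 : decayRate lam ≤ 1 := by
    unfold decayRate
    have := four_div_pi_sq_le
    have h6 : 0 ≤ 4 / Real.pi ^ 2 := by positivity
    nlinarith
  have h7 : 0 ≤ k * (p.1 ^ 2 + p.2 ^ 2) := mul_nonneg hk (by positivity)
  have := Real.add_one_le_exp (-(decayRate lam * (k * (p.1 ^ 2 + p.2 ^ 2))))
  nlinarith

lemma lowPair {M : Coeffs} {lam k : ℝ} (hM : M.Valid) (hl : StableRate lam M.ρx M.ρy M.ρ) (hk : 0 ≤ k)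
    (hhx : 0 < hx) (hhy : 0 < hy) {p : ℝ × ℝ} (hs : scale M k (freq p) ≤ 1 / 4) (hp : p ∈ box hx hy) :
    LowPair M lam k (freq p) ((hx ^ 2 + hy ^ 2) * freq p ^ 4)
      (Real.exp (-(decayRate lam * (k * (p.1 ^ 2 + p.2 ^ 2))))) (symH hx hy p) (symZ p) where
  valid := hM
  stable := hl
  hk := hk
  hL := one_le_freq p
  small := hs
  he := by have := one_le_freq p; positivity
  b := symH_bounded hhx hhy p
  b' := symZ_bounded p
  near := symH_near hhx hhy p
  hq := one_le_two_mul_exp hl.pos hk hs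
  decay := exp_symH_le hl.lt hk hhx hhy hp
  decay' := exp_symZ_le hl.lt hk p

lemma lowPair_self {M : Coeffs} {lam k : ℝ} (hM : M.Valid) (hl : StableRate lam M.ρx M.ρy M.ρ) (hk : 0 ≤ k)
    {p : ℝ × ℝ} (hs : scale M k (freq p) ≤ 1 / 4) :
    LowPair M lam k (freq p) 1
      (Real.exp (-(decayRate lam * (k * (p.1 ^ 2 + p.2 ^ 2))))) (symZ p) (symZ p) where
  valid := hM
  stable := hl
  hk := hk
  hL := one_le_freq p
  small := hs
  he := one_pos
  b := symZ_bounded p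
  b' := symZ_bounded p
  near := by constructor <;> simp
  hq := one_le_two_mul_exp hl.pos hk hs
  decay := exp_symZ_le hl.lt hk p
  decay' := exp_symZ_le hl.lt hk p

end Symbol

/-! ### Expansion of the exact evolution in the mesh sizes -/

section Taylor

/-- Along the segment from `0` to `g` the modulus of the exponential stays below the larger of its
end values. The bound avoids `exp ‖g‖`, which would not be usable since `g` is unbounded in the
noise and in the frequency. -/
lemma norm_exp_tail_le {g : ℂ} {B : ℝ} (hB : 1 ≤ B) (hg : ‖Complex.exp g‖ ≤ B) :
    ‖Complex.exp g - 1 - g‖ ≤ ‖g‖ ^ 2 * B := by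
  have hexp : ∀ t ∈ Set.Icc (0 : ℝ) 1, ‖Complex.exp (t * g)‖ ≤ B := by
    intro t ht
    rw [Complex.norm_exp] at hg ⊢
    rw [Complex.re_ofReal_mul]
    rcases le_total 0 g.re with h | h
    · refine le_trans (Real.exp_le_exp.2 ?_) hg
      nlinarith [ht.2]
    · refine le_trans (Real.exp_le_one_iff.2 ?_) hB
      nlinarith [ht.1]
  have hd : ∀ t : ℝ, HasDerivAt (fun t : ℝ => Complex.exp (t * g)) (Complex.exp (t * g) * g) t := by
    intro t
    have h1 : HasDerivAt (fun t : ℝ => (t : ℂ) * g) g t := by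
      simpa using (Complex.ofRealCLM.hasDerivAt (x := t)).mul_const g
    exact h1.cexp
  have h1 : ∀ s ∈ Set.Icc (0 : ℝ) 1, ‖Complex.exp (s * g) - 1‖ ≤ B * ‖g‖ := by
    intro s hs
    have := norm_image_sub_le_of_norm_deriv_le_segment' (a := 0) (b := 1) (C := B * ‖g‖)
      (fun t _ => (hd t).hasDerivWithinAt) (fun t ht => by
        rw [norm_mul]
        exact mul_le_mul_of_nonneg_right (hexp t ⟨ht.1, ht.2.le⟩) (norm_nonneg _)) s hs
    have h0 : 0 ≤ B * ‖g‖ := by positivity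
    simp only [Complex.ofReal_zero, zero_mul, Complex.exp_zero, sub_zero] at this
    nlinarith [hs.2]
  have hd2 : ∀ t : ℝ, HasDerivAt (fun t : ℝ => Complex.exp (t * g) - t * g) (Complex.exp (t * g) * g - g) t := by
    intro t
    have h1 : HasDerivAt (fun t : ℝ => (t : ℂ) * g) g t := by
      simpa using (Complex.ofRealCLM.hasDerivAt (x := t)).mul_const g
    exact (hd t).sub h1
  have := norm_image_sub_le_of_norm_deriv_le_segment_01' (C := ‖g‖ ^ 2 * B)
    (fun t _ => (hd2 t).hasDerivWithinAt) (fun t ht => by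
      have := h1 t ⟨ht.1, ht.2.le⟩
      calc ‖Complex.exp (t * g) * g - g‖ = ‖Complex.exp (t * g) - 1‖ * ‖g‖ := by
            rw [← norm_mul]; congr 1; ring
        _ ≤ B * ‖g‖ * ‖g‖ := by gcongr
        _ = _ := by ring)
  simp only [Complex.ofReal_one, one_mul, Complex.ofReal_zero, zero_mul, Complex.exp_zero, sub_zero] at this
  rwa [sub_right_comm] at this

/-- The exponent of the exact evolution in one coordinate. -/
def expArg (r μ T z s σ : ℝ) : ℂ :=
  ((T / 2 * (r * s ^ 2) - T / 2 * σ : ℝ) : ℂ) - Complex.I * (((√T * √r * z + T * μ) * s : ℝ) : ℂ)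

/-- The coefficient of `h ^ 2` in the exponent of the semidiscrete evolution. -/
def expArgCoeff (r μ T z ξ : ℝ) : ℂ :=
  ((T / 24 * ξ ^ 4 - T * r / 6 * ξ ^ 4 : ℝ) : ℂ) + Complex.I * (((√T * √r * z + T * μ) * (ξ ^ 3 / 6) : ℝ) : ℂ)

lemma expF_eq_exp_expArg (M : Coeffs) (T : ℝ) (p : Sym) (z : ℝ × ℝ) :
    expF M T p z = Complex.exp (expArg M.ρx M.μx T z.1 p.s p.σ + expArg M.ρy M.μy T z.2 p.t p.τ) := by
  unfold expF expStep noise itoCorr impl expArg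
  congr 1
  push_cast
  ring

section Coordinate

variable {r μ T z h L : ℝ}

lemma norm_real_add_I_mul_le (a b : ℝ) : ‖(a : ℂ) + Complex.I * (b : ℂ)‖ ≤ |a| + |b| := by
  refine (norm_add_le _ _).trans ?_
  simp

lemma abs_drift_le (hT : 0 ≤ T) (hr1 : r ≤ 1) :
    T + |√T * √r * z + T * μ| ≤ (1 + T) * (1 + |μ|) * (1 + |z|) := by
  have h1 : √T ≤ 1 + T := by
    nlinarith [Real.sq_sqrt hT, sq_nonneg (√T - 1), Real.sqrt_nonneg T]
  have h2 : √r ≤ 1 := Real.sqrt_le_one.2 hr1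
  have h3 : |√T * √r * z + T * μ| ≤ (1 + T) * |z| + T * |μ| := by
    refine (abs_add_le _ _).trans ?_
    rw [abs_mul, abs_mul, abs_mul, abs_of_nonneg hT, abs_of_nonneg (Real.sqrt_nonneg T),
      abs_of_nonneg (Real.sqrt_nonneg r)]
    have : √T * √r ≤ (1 + T) * 1 := mul_le_mul h1 h2 (Real.sqrt_nonneg _) (by linarith)
    have := mul_le_mul_of_nonneg_right this (abs_nonneg z)
    linarith
  have := mul_nonneg (mul_nonneg (by linarith : 0 ≤ 1 + T) (abs_nonneg μ)) (abs_nonneg z)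
  nlinarith [abs_nonneg μ, abs_nonneg z]

lemma norm_expArg_sub_le (hT : 0 ≤ T) (hr : 0 ≤ r) (hr1 : r ≤ 1) (hh : 0 < h) (hL : 1 ≤ L) {ξ : ℝ} (hξ : |ξ| ≤ L) :
    ‖expArg r μ T z (Real.sin (h * ξ) / h) ((2 - 2 * Real.cos (h * ξ)) / h ^ 2) - expArg r μ T z ξ (ξ ^ 2)‖ ≤
      2 * h ^ 2 * L ^ 4 * ((1 + T) * (1 + |μ|) * (1 + |z|)) := by
  obtain ⟨b1, -⟩ := diffSymbol_bounds hh ξ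
  obtain ⟨f1, f2⟩ := diffSymbol_first hh ξ
  set s := Real.sin (h * ξ) / h
  set σ := (2 - 2 * Real.cos (h * ξ)) / h ^ 2
  have e : expArg r μ T z s σ - expArg r μ T z ξ (ξ ^ 2) =
      ((T / 2 * (r * ((s - ξ) * (s + ξ))) - T / 2 * (σ - ξ ^ 2) : ℝ) : ℂ) +
        Complex.I * (((√T * √r * z + T * μ) * -(s - ξ) : ℝ) : ℂ) := by
    unfold expArg; push_cast; ring
  rw [e]
  refine (norm_real_add_I_mul_le _ _).trans ?_
  have hd := abs_drift_le (μ := μ) (z := z) hT hr1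
  set c := √T * √r * z + T * μ
  have g1 : |s - ξ| ≤ h ^ 2 * L ^ 3 := f1.trans (by gcongr)
  have g1' : |s - ξ| ≤ h ^ 2 * L ^ 4 := g1.trans (by gcongr; norm_num)
  have g2 : |σ - ξ ^ 2| ≤ h ^ 2 * L ^ 4 :=
    f2.trans (mul_le_mul_of_nonneg_left (even_pow_le hL hξ (by decide) le_rfl) (by positivity))
  have g3 : |s + ξ| ≤ 2 * L := (abs_add_le _ _).trans (by linarith)
  have a1 : |(s - ξ) * (s + ξ)| ≤ 2 * (h ^ 2 * L ^ 4) := by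
    rw [abs_mul]
    calc _ ≤ (h ^ 2 * L ^ 3) * (2 * L) := mul_le_mul g1 g3 (abs_nonneg _) (by positivity)
      _ = _ := by ring
  have a2 : |r * ((s - ξ) * (s + ξ))| ≤ 2 * (h ^ 2 * L ^ 4) := by
    rw [abs_mul, abs_of_nonneg hr]
    exact (mul_le_of_le_one_left (abs_nonneg _) hr1).trans a1
  have a3 : |T / 2 * (r * ((s - ξ) * (s + ξ))) - T / 2 * (σ - ξ ^ 2)| ≤ 2 * T * (h ^ 2 * L ^ 4) := by
    rw [← mul_sub, abs_mul, abs_of_nonneg (by positivity)]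
    have := (abs_sub _ _).trans (add_le_add a2 g2)
    have := mul_le_mul_of_nonneg_left this (by positivity : 0 ≤ T / 2)
    have : 0 ≤ T * (h ^ 2 * L ^ 4) := by positivity
    linarith
  have a4 : |c * -(s - ξ)| ≤ |c| * (h ^ 2 * L ^ 4) := by
    rw [abs_mul, abs_neg]; gcongr
  have h0 : 0 ≤ h ^ 2 * L ^ 4 := by positivity
  nlinarith [mul_le_mul_of_nonneg_right hd h0, mul_nonneg (abs_nonneg c) h0]

/-- `expArgCoeff` collects the effect of the corrections `-h ^ 2 * ξ ^ 3 / 6` and `-h ^ 2 * ξ ^ 4 /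
12` of the two symbols. What is left are their next-order errors and the square of the first-order
error of the sine symbol. -/
lemma norm_expArg_second_le (hT : 0 ≤ T) (hr : 0 ≤ r) (hr1 : r ≤ 1) (hh : 0 < h) (hL : 1 ≤ L) {ξ : ℝ} (hξ : |ξ| ≤ L) :
    ‖expArg r μ T z (Real.sin (h * ξ) / h) ((2 - 2 * Real.cos (h * ξ)) / h ^ 2) - expArg r μ T z ξ (ξ ^ 2) -
      (h ^ 2 : ℝ) * expArgCoeff r μ T z ξ‖ ≤
      2 * h ^ 4 * L ^ 6 * ((1 + T) * (1 + |μ|) * (1 + |z|)) := by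
  obtain ⟨f1, -⟩ := diffSymbol_first hh ξ
  obtain ⟨f3, f4⟩ := diffSymbol_second hh ξ
  set s := Real.sin (h * ξ) / h
  set σ := (2 - 2 * Real.cos (h * ξ)) / h ^ 2
  have e : expArg r μ T z s σ - expArg r μ T z ξ (ξ ^ 2) - (h ^ 2 : ℝ) * expArgCoeff r μ T z ξ =
      ((T / 2 * (r * (2 * ξ * (s - ξ + h ^ 2 * ξ ^ 3 / 6) + (s - ξ) ^ 2)) -
        T / 2 * (σ - ξ ^ 2 + h ^ 2 * ξ ^ 4 / 12) : ℝ) : ℂ) +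
        Complex.I * (((√T * √r * z + T * μ) * -(s - ξ + h ^ 2 * ξ ^ 3 / 6) : ℝ) : ℂ) := by
    unfold expArg expArgCoeff; push_cast; ring
  rw [e]
  refine (norm_real_add_I_mul_le _ _).trans ?_
  have hd := abs_drift_le (μ := μ) (z := z) hT hr1
  set c := √T * √r * z + T * μ
  set a := s - ξ + h ^ 2 * ξ ^ 3 / 6
  set b := σ - ξ ^ 2 + h ^ 2 * ξ ^ 4 / 12
  have g1 : |s - ξ| ≤ h ^ 2 * L ^ 3 := f1.trans (by gcongr)
  have g2 : |a| ≤ h ^ 4 * L ^ 5 := f3.trans (by gcongr)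
  have g2' : |a| ≤ h ^ 4 * L ^ 6 := g2.trans (by gcongr; norm_num)
  have g3 : |b| ≤ h ^ 4 * L ^ 6 :=
    f4.trans (mul_le_mul_of_nonneg_left (even_pow_le hL hξ (by decide) le_rfl) (by positivity))
  have a1 : |2 * ξ * a + (s - ξ) ^ 2| ≤ 3 * (h ^ 4 * L ^ 6) := by
    have e1 : |2 * ξ * a| ≤ 2 * (h ^ 4 * L ^ 6) := by
      rw [abs_mul, abs_mul, abs_two]
      calc _ ≤ 2 * L * (h ^ 4 * L ^ 5) := by gcongr
        _ = _ := by ring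
    have e2 : |(s - ξ) ^ 2| ≤ h ^ 4 * L ^ 6 := by
      rw [abs_pow]
      calc _ ≤ (h ^ 2 * L ^ 3) ^ 2 := pow_le_pow_left₀ (abs_nonneg _) g1 2
        _ = _ := by ring
    exact (abs_add_le _ _).trans (by linarith)
  have a2 : |r * (2 * ξ * a + (s - ξ) ^ 2)| ≤ 3 * (h ^ 4 * L ^ 6) := by
    rw [abs_mul, abs_of_nonneg hr]
    exact (mul_le_of_le_one_left (abs_nonneg _) hr1).trans a1
  have a3 : |T / 2 * (r * (2 * ξ * a + (s - ξ) ^ 2)) - T / 2 * b| ≤ 2 * T * (h ^ 4 * L ^ 6) := by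
    rw [← mul_sub, abs_mul, abs_of_nonneg (by positivity)]
    have := (abs_sub _ _).trans (add_le_add a2 g3)
    have := mul_le_mul_of_nonneg_left this (by positivity : 0 ≤ T / 2)
    linarith
  have a4 : |c * -a| ≤ |c| * (h ^ 4 * L ^ 6) := by
    rw [abs_mul, abs_neg]; gcongr
  have h0 : 0 ≤ h ^ 4 * L ^ 6 := by positivity
  nlinarith [mul_le_mul_of_nonneg_right hd h0, mul_nonneg (abs_nonneg c) h0]

lemma norm_expArgCoeff_le (hT : 0 ≤ T) (hr : 0 ≤ r) (hr1 : r ≤ 1) (hL : 1 ≤ L) {ξ : ℝ} (hξ : |ξ| ≤ L) :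
    ‖expArgCoeff r μ T z ξ‖ ≤ L ^ 4 * ((1 + T) * (1 + |μ|) * (1 + |z|)) := by
  refine (norm_real_add_I_mul_le _ _).trans ?_
  have hd := abs_drift_le (μ := μ) (z := z) hT hr1
  set c := √T * √r * z + T * μ
  have g3 : |ξ| ^ 3 ≤ L ^ 4 := abs_pow_le_pow hL hξ (by norm_num)
  have g4 : ξ ^ 4 ≤ L ^ 4 := even_pow_le hL hξ (by decide) le_rfl
  have a3 : |T / 24 * ξ ^ 4 - T * r / 6 * ξ ^ 4| ≤ T * L ^ 4 := by
    have e1 : T / 24 * ξ ^ 4 - T * r / 6 * ξ ^ 4 = T * (1 / 24 - r / 6) * ξ ^ 4 := by ring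
    rw [e1, abs_mul, abs_mul, abs_of_nonneg hT, abs_of_nonneg (by positivity : 0 ≤ ξ ^ 4)]
    have : |1 / 24 - r / 6| ≤ 1 := abs_le.2 ⟨by linarith, by linarith⟩
    calc T * |1 / 24 - r / 6| * ξ ^ 4 ≤ T * 1 * L ^ 4 := by gcongr
      _ = _ := by ring
  have a4 : |c * (ξ ^ 3 / 6)| ≤ |c| * L ^ 4 := by
    rw [abs_mul, abs_div, abs_pow]
    gcongr
    have : (0:ℝ) ≤ |ξ| ^ 3 := by positivity
    rw [abs_of_pos (by norm_num : (0:ℝ) < 6)]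
    linarith
  have h0 : 0 ≤ L ^ 4 := by positivity
  nlinarith [mul_le_mul_of_nonneg_right hd h0]

end Coordinate

variable {M : Coeffs} {T hx hy lam : ℝ}

/-- The spectral density of the leading spatial error in the first coordinate. -/
def spaceCoeffX (M : Coeffs) (T : ℝ) (p z : ℝ × ℝ) : ℂ :=
  expF M T (symZ p) z * expArgCoeff M.ρx M.μx T z.1 p.1

/-- The spectral density of the leading spatial error in the second coordinate. -/
def spaceCoeffY (M : Coeffs) (T : ℝ) (p z : ℝ × ℝ) : ℂ :=
  expF M T (symZ p) z * expArgCoeff M.ρy M.μy T z.2 p.2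

lemma norm_expF_le {E : ℝ} (hl : StableRate lam M.ρx M.ρy M.ρ) (hT : 0 ≤ T) {p : Sym} (hs : p.s ^ 2 ≤ p.σ)
    (ht : p.t ^ 2 ≤ p.τ) (hE : Real.exp (-((1 - lam) / 2 * (T * (p.σ + p.τ)))) ≤ E ^ 2) (hE0 : 0 ≤ E) (z : ℝ × ℝ) :
    ‖expF M T p z‖ ≤ E :=
  abs_le_of_sq_le_sq' ((norm_expF_sq_le hl hT hs ht z).trans hE) hE0 |>.2

lemma size_bounds (M : Coeffs) (hT : 0 ≤ T) (z : ℝ × ℝ) :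
    (1 + T) * (1 + |M.μx|) * (1 + |z.1|) ≤ (1 + T) * M.size * (1 + (|z.1| + |z.2|)) ∧
    (1 + T) * (1 + |M.μy|) * (1 + |z.2|) ≤ (1 + T) * M.size * (1 + (|z.1| + |z.2|)) ∧
    1 ≤ (1 + T) * M.size * (1 + (|z.1| + |z.2|)) := by
  have a := abs_nonneg z.1
  have b := abs_nonneg z.2
  have c := abs_nonneg M.μx
  have d := abs_nonneg M.μy
  have e1 : 1 + |M.μx| ≤ M.size := by unfold Coeffs.size; linarith
  have e2 : 1 + |M.μy| ≤ M.size := by unfold Coeffs.size; linarith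
  have e3 : 1 ≤ M.size := by linarith
  have e4 : 1 + |z.1| ≤ 1 + (|z.1| + |z.2|) := by linarith
  have e5 : 1 + |z.2| ≤ 1 + (|z.1| + |z.2|) := by linarith
  have h1 : 1 ≤ (1 + T) * M.size := by nlinarith
  exact ⟨by gcongr, by gcongr, by nlinarith⟩

lemma norm_spaceCoeff_le {E : ℝ} (hM : M.Valid) (hT : 0 ≤ T) {p z : ℝ × ℝ} (hE : ‖expF M T (symZ p) z‖ ≤ E) :
    ‖spaceCoeffX M T p z‖ ≤ E * freq p ^ 4 * ((1 + T) * M.size * (1 + (|z.1| + |z.2|))) ∧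
    ‖spaceCoeffY M T p z‖ ≤ E * freq p ^ 4 * ((1 + T) * M.size * (1 + (|z.1| + |z.2|))) := by
  obtain ⟨s1, s2, -⟩ := size_bounds M hT z
  have hE0 := (norm_nonneg _).trans hE
  have hL := one_le_freq p
  have c1 := (norm_expArgCoeff_le (μ := M.μx) (z := z.1) hT hM.x0 hM.x1.le hL (abs_fst_le_freq p)).trans
    (mul_le_mul_of_nonneg_left s1 (by positivity))
  have c2 := (norm_expArgCoeff_le (μ := M.μy) (z := z.2) hT hM.y0 hM.y1.le hL (abs_snd_le_freq p)).trans
    (mul_le_mul_of_nonneg_left s2 (by positivity))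
  unfold spaceCoeffX spaceCoeffY
  rw [norm_mul, norm_mul, mul_assoc E]
  exact ⟨mul_le_mul hE c1 (norm_nonneg _) hE0, mul_le_mul hE c2 (norm_nonneg _) hE0⟩

set_option maxHeartbeats 800000 in
/-- The spatial error of the exact evolution beyond leading order. -/
lemma norm_expF_symH_taylor_le {E : ℝ} (hM : M.Valid) (hT : 0 ≤ T) (hhx : 0 < hx) (hhy : 0 < hy) {p z : ℝ × ℝ}
    (hE0 : ‖expF M T (symZ p) z‖ ≤ E) (hE1 : ‖expF M T (symH hx hy p) z‖ ≤ E) :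
    ‖expF M T (symH hx hy p) z - expF M T (symZ p) z - (hx ^ 2 : ℝ) * spaceCoeffX M T p z -
      (hy ^ 2 : ℝ) * spaceCoeffY M T p z‖ ≤
      6 * E * (hx ^ 2 + hy ^ 2) ^ 2 * freq p ^ 8 * ((1 + T) * M.size * (1 + (|z.1| + |z.2|))) ^ 2 := by
  obtain ⟨s1, s2, s3⟩ := size_bounds M hT z
  have hL := one_le_freq p
  have hEn := (norm_nonneg _).trans hE0
  set J := (1 + T) * M.size * (1 + (|z.1| + |z.2|))
  set L := freq p
  have a1 := (norm_expArg_sub_le (μ := M.μx) (z := z.1) hT hM.x0 hM.x1.le hhx hL (abs_fst_le_freq p)).trans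
    (mul_le_mul_of_nonneg_left s1 (by positivity))
  have a2 := (norm_expArg_sub_le (μ := M.μy) (z := z.2) hT hM.y0 hM.y1.le hhy hL (abs_snd_le_freq p)).trans
    (mul_le_mul_of_nonneg_left s2 (by positivity))
  have b1 := (norm_expArg_second_le (μ := M.μx) (z := z.1) hT hM.x0 hM.x1.le hhx hL (abs_fst_le_freq p)).trans
    (mul_le_mul_of_nonneg_left s1 (by positivity))
  have b2 := (norm_expArg_second_le (μ := M.μy) (z := z.2) hT hM.y0 hM.y1.le hhy hL (abs_snd_le_freq p)).trans
    (mul_le_mul_of_nonneg_left s2 (by positivity))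
  set AX := expArg M.ρx M.μx T z.1 (Real.sin (hx * p.1) / hx) ((2 - 2 * Real.cos (hx * p.1)) / hx ^ 2)
  set AY := expArg M.ρy M.μy T z.2 (Real.sin (hy * p.2) / hy) ((2 - 2 * Real.cos (hy * p.2)) / hy ^ 2)
  set BX := expArg M.ρx M.μx T z.1 p.1 (p.1 ^ 2)
  set BY := expArg M.ρy M.μy T z.2 p.2 (p.2 ^ 2)
  have eH : expF M T (symH hx hy p) z = Complex.exp (AX + AY) := expF_eq_exp_expArg _ _ _ _
  have eZ : expF M T (symZ p) z = Complex.exp (BX + BY) := expF_eq_exp_expArg _ _ _ _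
  unfold spaceCoeffX spaceCoeffY
  set CX := expArgCoeff M.ρx M.μx T z.1 p.1
  set CY := expArgCoeff M.ρy M.μy T z.2 p.2
  set X0 := expF M T (symZ p) z
  set g := (AX - BX) + (AY - BY) with hg
  have eHg : expF M T (symH hx hy p) z = X0 * Complex.exp g := by
    rw [eH, eZ, ← Complex.exp_add]; congr 1; rw [hg]; ring
  have eXZ := eZ
  clear_value J L AX AY BX BY CX CY X0 g
  have hX0 : 0 < ‖X0‖ := by rw [eXZ, Complex.norm_exp]; positivity
  -- The ratio `E / ‖X0‖` bounds both `1` and the exponential of `g`, since both evolutions are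
  -- bounded by `E`. Multiplying back by `X0` then leaves the decaying factor `E` with only a
  -- polynomial in the noise.
  have hB : ‖Complex.exp g - 1 - g‖ ≤ ‖g‖ ^ 2 * (E / ‖X0‖) := by
    refine norm_exp_tail_le ((one_le_div hX0).2 hE0) ?_
    rw [le_div_iff₀ hX0, mul_comm, ← norm_mul, ← eHg]
    exact hE1
  have hδ : 0 ≤ hx ^ 2 + hy ^ 2 := by positivity
  set δ := hx ^ 2 + hy ^ 2 with hδd
  have hgn : ‖g‖ ≤ 2 * δ * L ^ 4 * J := by
    rw [hg]
    refine (norm_add_le _ _).trans ((add_le_add a1 a2).trans (le_of_eq ?_))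
    rw [hδd]; ring
  have t1 : ‖X0 * (Complex.exp g - 1 - g)‖ ≤ E * (2 * δ * L ^ 4 * J) ^ 2 := by
    rw [norm_mul]
    calc ‖X0‖ * ‖Complex.exp g - 1 - g‖ ≤ ‖X0‖ * (‖g‖ ^ 2 * (E / ‖X0‖)) := by gcongr
      _ = E * ‖g‖ ^ 2 := by field_simp
      _ ≤ _ := by gcongr
  have t2 : ‖X0 * (g - (hx ^ 2 : ℝ) * CX - (hy ^ 2 : ℝ) * CY)‖ ≤ E * (2 * δ ^ 2 * L ^ 6 * J) := by
    rw [norm_mul]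
    refine mul_le_mul hE0 ?_ (norm_nonneg _) hEn
    have e : g - (hx ^ 2 : ℝ) * CX - (hy ^ 2 : ℝ) * CY = (AX - BX - (hx ^ 2 : ℝ) * CX) + (AY - BY - (hy ^ 2 : ℝ) * CY) := by
      rw [hg]; ring
    rw [e]
    refine (norm_add_le _ _).trans ((add_le_add b1 b2).trans ?_)
    have h4 : hx ^ 4 + hy ^ 4 ≤ δ ^ 2 := by
      have e : δ ^ 2 = hx ^ 4 + hy ^ 4 + 2 * (hx ^ 2 * hy ^ 2) := by rw [hδd]; ring
      rw [e]
      exact le_add_of_nonneg_right (by positivity)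
    calc _ = 2 * (hx ^ 4 + hy ^ 4) * L ^ 6 * J := by ring
      _ ≤ _ := by gcongr
  have e : expF M T (symH hx hy p) z - X0 - (hx ^ 2 : ℝ) * (X0 * CX) - (hy ^ 2 : ℝ) * (X0 * CY) =
      X0 * (Complex.exp g - 1 - g) + X0 * (g - (hx ^ 2 : ℝ) * CX - (hy ^ 2 : ℝ) * CY) := by
    rw [eHg]; ring
  rw [e]
  refine (norm_add_le _ _).trans ((add_le_add t1 t2).trans ?_)
  have l1 : L ^ 6 * J ≤ L ^ 8 * J ^ 2 := by
    have : L ^ 6 ≤ L ^ 8 := pow_le_pow_right₀ hL (by norm_num)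
    have : J ≤ J ^ 2 := by nlinarith
    gcongr
  have := mul_le_mul_of_nonneg_left l1 (by positivity : 0 ≤ 2 * E * δ ^ 2)
  linarith

end Taylor

/-! ### From frequency densities to random fields -/

section Field

variable {Ω : Type*} [MeasurableSpace Ω] {P : Measure Ω} {α : Type*} [MeasurableSpace α] {μ : Measure α}

open scoped ENNReal in
/-- Minkowski's integral inequality for the second moment. -/
lemma lintegral_sq_lintegral_le [SFinite P] [SFinite μ] {f : α → Ω → ℝ≥0∞} (hf : Measurable (Function.uncurry f))
    {w : α → ℝ≥0∞} (hw : Measurable w) (h : ∀ p, ∫⁻ ω, f p ω ^ 2 ∂P ≤ w p ^ 2) :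
    ∫⁻ ω, (∫⁻ p, f p ω ∂μ) ^ 2 ∂P ≤ (∫⁻ p, w p ∂μ) ^ 2 := by
  have m1 : ∀ p, Measurable (f p) := fun p => hf.comp (by fun_prop : Measurable fun ω => (p, ω))
  have m2 : ∀ ω, Measurable fun p => f p ω := fun ω => hf.comp (by fun_prop : Measurable fun p => (p, ω))
  -- The square is written as a double integral over frequencies; after Tonelli, the Cauchy–Schwarz
  -- inequality in the probability space bounds the integrand by `w p * w p'`.
  have e : ∀ ω, (∫⁻ p, f p ω ∂μ) ^ 2 = ∫⁻ p, ∫⁻ p', f p ω * f p' ω ∂μ ∂μ := by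
    intro ω
    rw [sq, ← lintegral_mul_const _ (m2 ω)]
    refine lintegral_congr fun p => ?_
    rw [lintegral_const_mul _ (m2 ω)]
  have hr : ∀ a : ℝ≥0∞, (a ^ 2) ^ (1 / 2 : ℝ) = a := fun a => by
    rw [← ENNReal.rpow_natCast, ← ENNReal.rpow_mul]; norm_num
  have hH : ∀ p p', ∫⁻ ω, f p ω * f p' ω ∂P ≤ w p * w p' := by
    intro p p'
    have := ENNReal.lintegral_mul_le_Lp_mul_Lq P Real.HolderConjugate.two_two (m1 p).aemeasurable (m1 p').aemeasurable
    refine this.trans (mul_le_mul' ?_ ?_)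
    · have := ENNReal.rpow_le_rpow (h p) (by norm_num : (0 : ℝ) ≤ 1 / 2)
      rw [hr] at this
      simpa only [ENNReal.rpow_two] using this
    · have := ENNReal.rpow_le_rpow (h p') (by norm_num : (0 : ℝ) ≤ 1 / 2)
      rw [hr] at this
      simpa only [ENNReal.rpow_two] using this
  have m3 : Measurable fun q : Ω × α × α => f q.2.1 q.1 * f q.2.2 q.1 :=
    (hf.comp (by fun_prop : Measurable fun q : Ω × α × α => (q.2.1, q.1))).mul
      (hf.comp (by fun_prop : Measurable fun q : Ω × α × α => (q.2.2, q.1)))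
  calc ∫⁻ ω, (∫⁻ p, f p ω ∂μ) ^ 2 ∂P = ∫⁻ ω, ∫⁻ p, ∫⁻ p', f p ω * f p' ω ∂μ ∂μ ∂P := lintegral_congr e
    _ = ∫⁻ p, ∫⁻ ω, ∫⁻ p', f p ω * f p' ω ∂μ ∂P ∂μ := by
        refine lintegral_lintegral_swap (Measurable.aemeasurable ?_)
        exact Measurable.lintegral_prod_right' (f := fun q : (Ω × α) × α => f q.1.2 q.1.1 * f q.2 q.1.1)
          (m3.comp (by fun_prop : Measurable fun q : (Ω × α) × α => (q.1.1, q.1.2, q.2)))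
    _ = ∫⁻ p, ∫⁻ p', ∫⁻ ω, f p ω * f p' ω ∂P ∂μ ∂μ := by
        refine lintegral_congr fun p => lintegral_lintegral_swap (Measurable.aemeasurable ?_)
        exact m3.comp (by fun_prop : Measurable fun q : Ω × α => (q.1, p, q.2))
    _ ≤ ∫⁻ p, ∫⁻ p', w p * w p' ∂μ ∂μ := lintegral_mono fun p => lintegral_mono fun p' => hH p p'
    _ = (∫⁻ p, w p ∂μ) ^ 2 := by
        rw [sq, ← lintegral_mul_const _ hw]
        refine lintegral_congr fun p => ?_
        rw [lintegral_const_mul _ hw]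

/-- A random frequency density whose root mean square is at most `w`. -/
structure DensityBound (P : Measure Ω) (Ξ : ℝ × ℝ → Ω → ℂ) (w : ℝ × ℝ → ℝ) : Prop where
  meas : Measurable (Function.uncurry Ξ)
  wmeas : Measurable w
  nonneg : ∀ p, 0 ≤ w p
  int : Integrable w
  sq : ∀ p, SqLe P (Ξ p) (w p ^ 2)

/-- The random field with a given frequency density. -/
def field (Ξ : ℝ × ℝ → Ω → ℂ) (x y : ℝ) (ω : Ω) : ℝ :=
  (4 * Real.pi ^ 2)⁻¹ * (∫ p, phase x y p * Ξ p ω).re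

/-- The bound does not involve `x` and `y`; this is where uniformity in the space variables comes
from. -/
lemma enorm_field_le {Ω : Type*} (Ξ : ℝ × ℝ → Ω → ℂ) (x y : ℝ) (ω : Ω) : ‖field Ξ x y ω‖ₑ ≤ ∫⁻ p, ‖Ξ p ω‖ₑ := by
  have h1 : ‖field Ξ x y ω‖ ≤ ‖∫ p, phase x y p * Ξ p ω‖ := by
    unfold field
    rw [norm_mul]
    have : ‖(4 * Real.pi ^ 2)⁻¹‖ ≤ 1 := by
      rw [Real.norm_of_nonneg (by positivity)]
      exact inv_le_one_of_one_le₀ (by nlinarith [Real.pi_gt_three])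
    exact (mul_le_of_le_one_left (norm_nonneg _) this).trans (Complex.abs_re_le_norm _)
  calc ‖field Ξ x y ω‖ₑ ≤ ‖∫ p, phase x y p * Ξ p ω‖ₑ := by
        rw [← ofReal_norm, ← ofReal_norm]; exact ENNReal.ofReal_le_ofReal h1
    _ ≤ ∫⁻ p, ‖phase x y p * Ξ p ω‖ₑ := enorm_integral_le_lintegral_enorm _
    _ = ∫⁻ p, ‖Ξ p ω‖ₑ := by
        refine lintegral_congr fun p => ?_
        rw [← ofReal_norm, norm_mul, norm_phase, one_mul, ofReal_norm]

namespace DensityBound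

variable {Ξ : ℝ × ℝ → Ω → ℂ} {w : ℝ × ℝ → ℝ} (h : DensityBound P Ξ w)

include h

lemma lintegral_sq_le [IsProbabilityMeasure P] :
    ∫⁻ ω, (∫⁻ p, ‖Ξ p ω‖ₑ) ^ 2 ∂P ≤ ENNReal.ofReal (∫ p, w p) ^ 2 := by
  rw [ofReal_integral_eq_lintegral_ofReal h.int (ae_of_all _ h.nonneg)]
  refine lintegral_sq_lintegral_le (f := fun p ω => ‖Ξ p ω‖ₑ) h.meas.enorm (h.wmeas.ennreal_ofReal) fun p => ?_
  have e : ∀ ω, ‖Ξ p ω‖ₑ ^ 2 = ENNReal.ofReal (‖Ξ p ω‖ ^ 2) := fun ω => by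
    rw [ENNReal.ofReal_pow (norm_nonneg _), ofReal_norm]
  simp only [e]
  rw [← ofReal_integral_eq_lintegral_ofReal (h.sq p).1 (ae_of_all _ fun ω => by positivity),
    ← ENNReal.ofReal_pow (h.nonneg p)]
  exact ENNReal.ofReal_le_ofReal (h.sq p).2

lemma measurable_section (ω : Ω) : Measurable fun p => Ξ p ω :=
  h.meas.comp (by fun_prop : Measurable fun p => (p, ω))

/-- The total mass of the density over frequencies has a finite second moment, hence is almost
surely finite. This permits splitting the Fourier integrals path by path. -/
lemma ae_integrable [IsProbabilityMeasure P] : ∀ᵐ ω ∂P, Integrable fun p => Ξ p ω := by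
  have m : Measurable fun ω => (∫⁻ p, ‖Ξ p ω‖ₑ) ^ 2 :=
    (Measurable.lintegral_prod_right' (f := fun q : Ω × (ℝ × ℝ) => ‖Ξ q.2 q.1‖ₑ)
      (h.meas.comp measurable_swap).enorm).pow_const 2
  have hfin := ae_lt_top m (ne_top_of_le_ne_top (by finiteness) h.lintegral_sq_le)
  filter_upwards [hfin] with ω hω
  refine ⟨(h.measurable_section ω).aestronglyMeasurable, ?_⟩
  by_contra hc
  simp only [HasFiniteIntegral, not_lt, top_le_iff] at hc
  simp [hc] at hω

lemma integrable_phase_mul {ω : Ω} (hω : Integrable fun p => Ξ p ω) (x y : ℝ) :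
    Integrable fun p => phase x y p * Ξ p ω := by
  refine hω.mono (((continuous_phase x y).measurable.mul (h.measurable_section ω)).aestronglyMeasurable)
    (ae_of_all _ fun p => ?_)
  rw [norm_mul, norm_phase, one_mul]

lemma measurable_field (x y : ℝ) : AEStronglyMeasurable (field Ξ x y) P := by
  have m : StronglyMeasurable fun ω => ∫ p, phase x y p * Ξ p ω :=
    StronglyMeasurable.integral_prod_right' (f := fun q : Ω × (ℝ × ℝ) => phase x y q.2 * Ξ q.2 q.1)
      ((((continuous_phase x y).measurable.comp measurable_snd).mul
        (h.meas.comp measurable_swap)).stronglyMeasurable)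
  exact ((Complex.continuous_re.comp_stronglyMeasurable m).const_mul _).aestronglyMeasurable

lemma lintegral_field_sq_le [IsProbabilityMeasure P] (x y : ℝ) : ∫⁻ ω, ‖field Ξ x y ω‖ₑ ^ 2 ∂P ≤ ENNReal.ofReal ((∫ p, w p) ^ 2) := by
  rw [ENNReal.ofReal_pow (integral_nonneg h.nonneg)]
  refine (lintegral_mono fun ω => ?_).trans h.lintegral_sq_le
  gcongr
  exact enorm_field_le Ξ x y ω

lemma memLp_field [IsProbabilityMeasure P] (x y : ℝ) : MemLp (field Ξ x y) 2 P := by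
  refine ⟨h.measurable_field x y, ?_⟩
  rw [eLpNorm_lt_top_iff_lintegral_rpow_enorm_lt_top (by norm_num) (by norm_num)]
  have := h.lintegral_field_sq_le x y
  simp only [ENNReal.toReal_ofNat, ENNReal.rpow_ofNat]
  exact this.trans_lt ENNReal.ofReal_lt_top

lemma integral_field_sq_le [IsProbabilityMeasure P] (x y : ℝ) : ∫ ω, field Ξ x y ω ^ 2 ∂P ≤ (∫ p, w p) ^ 2 := by
  rw [integral_eq_lintegral_of_nonneg_ae (ae_of_all _ fun ω => sq_nonneg _) ((h.measurable_field x y).pow 2)]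
  refine ENNReal.toReal_le_of_le_ofReal (sq_nonneg _) (le_trans (le_of_eq ?_) (h.lintegral_field_sq_le x y))
  refine lintegral_congr fun ω => ?_
  rw [← ofReal_norm, ← ENNReal.ofReal_pow (norm_nonneg _), Real.norm_eq_abs, sq_abs]

end DensityBound

lemma integral_abs_le_of_sq_le [IsProbabilityMeasure P] {X : Ω → ℝ} (hX : MemLp X 2 P) {c : ℝ} (hc : 0 ≤ c)
    (h : ∫ ω, X ω ^ 2 ∂P ≤ c ^ 2) : ∫ ω, |X ω| ∂P ≤ c := by
  have h1 : MemLp (fun ω => |X ω|) 2 P := hX.abs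
  have hv := variance_nonneg (fun ω => |X ω|) P
  rw [variance_eq_sub h1] at hv
  have e : ∫ ω, ((fun ω => |X ω|) ^ 2) ω ∂P = ∫ ω, X ω ^ 2 ∂P := by
    simp only [Pi.pow_apply, sq_abs]
  rw [e] at hv
  exact abs_le_of_sq_le_sq' (by linarith) hc |>.2

end Field

/-! ### Gaussian weights with polynomial factors -/

section GaussianWeight

/-- A Gaussian weight in frequency. -/
def gaussWeight (b : ℝ) (p : ℝ × ℝ) : ℝ := Real.exp (-(b * (p.1 ^ 2 + p.2 ^ 2)))

lemma gaussWeight_pos (b : ℝ) (p : ℝ × ℝ) : 0 < gaussWeight b p := Real.exp_pos _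

lemma gaussWeight_sq (b : ℝ) (p : ℝ × ℝ) : gaussWeight b p ^ 2 = gaussWeight (2 * b) p := by
  unfold gaussWeight
  rw [← Real.exp_nat_mul]; congr 1; push_cast; ring

@[fun_prop]
lemma measurable_freq : Measurable freq := by unfold freq; fun_prop

@[fun_prop]
lemma measurable_gaussWeight (b : ℝ) : Measurable (gaussWeight b) := by unfold gaussWeight; fun_prop

lemma integrable_gaussWeight {b : ℝ} (hb : 0 < b) : Integrable (gaussWeight b) := by
  have h := integrable_exp_neg_mul_sq hb
  refine (h.mul_prod h).congr (ae_of_all _ fun p => ?_)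
  simp only [gaussWeight]
  rw [← Real.exp_add]; congr 1; ring

/-- A power is bounded by a factorial times an exponential, whose exponent is linear in the
frequency; completing the square absorbs it into half of the Gaussian. -/
lemma freq_pow_mul_gaussWeight_le {b : ℝ} (hb : 0 < b) (n : ℕ) (p : ℝ × ℝ) :
    freq p ^ n * gaussWeight b p ≤ n.factorial * Real.exp (1 + 1 / b) * gaussWeight (b / 2) p := by
  have hL := one_le_freq p
  have h1 : freq p ^ n ≤ n.factorial * Real.exp (freq p) := by
    have := Real.pow_div_factorial_le_exp (freq p) (by linarith) n
    rwa [div_le_iff₀ (by positivity), mul_comm] at this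
  have h2 : ∀ x : ℝ, |x| ≤ 1 / (2 * b) + b / 2 * x ^ 2 := by
    intro x
    have : 0 ≤ (1 - b * |x|) ^ 2 / (2 * b) := by positivity
    have e : (1 - b * |x|) ^ 2 / (2 * b) = 1 / (2 * b) + b / 2 * |x| ^ 2 - |x| := by field_simp; ring
    rw [e, sq_abs] at this
    linarith
  have h3 : freq p ≤ 1 + 1 / b + b / 2 * (p.1 ^ 2 + p.2 ^ 2) := by
    have := h2 p.1
    have := h2 p.2
    have e : 1 / b = 1 / (2 * b) + 1 / (2 * b) := by field_simp; norm_num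
    unfold freq
    rw [e]; linarith
  calc freq p ^ n * gaussWeight b p
      ≤ (n.factorial * Real.exp (1 + 1 / b + b / 2 * (p.1 ^ 2 + p.2 ^ 2))) * gaussWeight b p := by
        refine mul_le_mul_of_nonneg_right (h1.trans ?_) (gaussWeight_pos _ _).le
        gcongr
    _ = _ := by
        unfold gaussWeight
        rw [mul_assoc, ← Real.exp_add, mul_assoc, ← Real.exp_add]
        congr 2; ring

lemma integrable_freq_pow_mul_gaussWeight {b : ℝ} (hb : 0 < b) (n : ℕ) :
    Integrable fun p => freq p ^ n * gaussWeight b p := by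
  refine ((integrable_gaussWeight (half_pos hb)).const_mul (n.factorial * Real.exp (1 + 1 / b))).mono'
    (by fun_prop) (ae_of_all _ fun p => ?_)
  have := one_le_freq p
  have := gaussWeight_pos b p
  rw [Real.norm_of_nonneg (by positivity)]
  exact freq_pow_mul_gaussWeight_le hb n p

end GaussianWeight

/-! ### The exact solution as a Fourier integral -/

section ExactSolution

/-- A one-dimensional complex Gaussian integral. The Itô term lowers the diffusion from `T` to `(1 -
r) * T`, and drift and noise only translate. -/
lemma integral_exp_expArg {r T : ℝ} (hr : r < 1) (hT : 0 < T) (μ z a : ℝ) :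
    ∫ ξ : ℝ, Complex.exp (Complex.I * ((ξ * a : ℝ) : ℂ)) * Complex.exp (expArg r μ T z ξ (ξ ^ 2)) =
      ((√(2 * Real.pi / ((1 - r) * T)) *
        Real.exp (-(a - T * μ - √T * √r * z) ^ 2 / (2 * (1 - r) * T)) : ℝ) : ℂ) := by
  have hr' : 0 < 1 - r := by linarith
  have hb : ((-(T * (1 - r) / 2) : ℝ) : ℂ).re < 0 := by
    rw [Complex.ofReal_re]
    have : 0 < T * (1 - r) / 2 := by positivity
    linarith
  have h := integral_cexp_quadratic hb (Complex.I * ((a - T * μ - √T * √r * z : ℝ) : ℂ)) 0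
  have e : ∀ ξ : ℝ, Complex.exp (Complex.I * ((ξ * a : ℝ) : ℂ)) * Complex.exp (expArg r μ T z ξ (ξ ^ 2)) =
      Complex.exp (((-(T * (1 - r) / 2) : ℝ) : ℂ) * ξ ^ 2 +
        Complex.I * ((a - T * μ - √T * √r * z : ℝ) : ℂ) * ξ + 0) := by
    intro ξ
    rw [← Complex.exp_add]
    unfold expArg
    congr 1
    push_cast
    ring
  simp only [e]
  rw [h, Complex.ofReal_mul, Complex.ofReal_exp]
  congr 1
  · rw [Real.sqrt_eq_rpow, Complex.ofReal_cpow (by positivity)]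
    congr 1
    · push_cast
      have h1 : (T : ℂ) ≠ 0 := by exact_mod_cast hT.ne'
      have h2 : (1 - r : ℂ) ≠ 0 := by exact_mod_cast hr'.ne'
      field_simp
    · norm_num
  · congr 1
    rw [mul_pow, Complex.I_sq]
    push_cast
    have h1 : (T : ℂ) ≠ 0 := by exact_mod_cast hT.ne'
    have h2 : (1 - r : ℂ) ≠ 0 := by exact_mod_cast hr'.ne'
    field_simp
    ring

/-- The exact solution as a Fourier integral. -/
lemma exactSolution_eq_integral {M : Coeffs} (hM : M.Valid) {T : ℝ} (hT : 0 < T) (x₀ y₀ x y : ℝ) (z : ℝ × ℝ) :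
    exactSolution M.μx M.μy M.ρx M.ρy x₀ y₀ T (√T * z.1) (√T * z.2) x y =
      (4 * Real.pi ^ 2)⁻¹ * (∫ p, phase (x - x₀) (y - y₀) p * expF M T (symZ p) z).re := by
  have hx : 0 < 1 - M.ρx := by linarith [hM.x1]
  have hy : 0 < 1 - M.ρy := by linarith [hM.y1]
  have e : ∀ p : ℝ × ℝ, phase (x - x₀) (y - y₀) p * expF M T (symZ p) z =
      (Complex.exp (Complex.I * ((p.1 * (x - x₀) : ℝ) : ℂ)) * Complex.exp (expArg M.ρx M.μx T z.1 p.1 (p.1 ^ 2))) *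
      (Complex.exp (Complex.I * ((p.2 * (y - y₀) : ℝ) : ℂ)) * Complex.exp (expArg M.ρy M.μy T z.2 p.2 (p.2 ^ 2))) := by
    intro p
    rw [expF_eq_exp_expArg]
    unfold phase symZ
    simp only [← Complex.exp_add]
    congr 1
    push_cast
    ring
  simp only [e]
  rw [Measure.volume_eq_prod, integral_prod_mul (μ := volume) (ν := volume)
    (fun ξ : ℝ => Complex.exp (Complex.I * ((ξ * (x - x₀) : ℝ) : ℂ)) * Complex.exp (expArg M.ρx M.μx T z.1 ξ (ξ ^ 2)))
    (fun ξ : ℝ => Complex.exp (Complex.I * ((ξ * (y - y₀) : ℝ) : ℂ)) * Complex.exp (expArg M.ρy M.μy T z.2 ξ (ξ ^ 2))),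
    integral_exp_expArg hM.x1 hT, integral_exp_expArg hM.y1 hT, ← Complex.ofReal_mul, Complex.ofReal_re]
  unfold exactSolution
  have e1 : √(2 * Real.pi / ((1 - M.ρx) * T)) * √(2 * Real.pi / ((1 - M.ρy) * T)) =
      2 * Real.pi / (√((1 - M.ρx) * (1 - M.ρy)) * T) := by
    rw [← Real.sqrt_mul (by positivity)]
    have : 2 * Real.pi / ((1 - M.ρx) * T) * (2 * Real.pi / ((1 - M.ρy) * T)) =
        (2 * Real.pi / T) ^ 2 / ((1 - M.ρx) * (1 - M.ρy)) := by field_simp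
    rw [this, Real.sqrt_div (by positivity), Real.sqrt_sq (by positivity), div_div, mul_comm T]
  have e2 : ∀ A B : ℝ, √(2 * Real.pi / ((1 - M.ρx) * T)) * A * (√(2 * Real.pi / ((1 - M.ρy) * T)) * B) =
      2 * Real.pi / (√((1 - M.ρx) * (1 - M.ρy)) * T) * (A * B) := fun A B => by rw [← e1]; ring
  rw [e2, ← Real.exp_add]
  have hs : 0 < √((1 - M.ρx) * (1 - M.ρy)) := Real.sqrt_pos.2 (by positivity)
  have e3 : -(x - x₀ - M.μx * T - √M.ρx * (√T * z.1)) ^ 2 / (2 * (1 - M.ρx) * T) -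
      (y - y₀ - M.μy * T - √M.ρy * (√T * z.2)) ^ 2 / (2 * (1 - M.ρy) * T) =
      -(x - x₀ - T * M.μx - √T * √M.ρx * z.1) ^ 2 / (2 * (1 - M.ρx) * T) +
      -(y - y₀ - T * M.μy - √T * √M.ρy * z.2) ^ 2 / (2 * (1 - M.ρy) * T) := by ring
  rw [e3]
  have := Real.pi_pos
  field_simp
  norm_num

end ExactSolution

/-! ### Accumulated exact steps -/

section Accumulated

variable {Ω : Type*} {Z : ℕ → Ω → ℝ × ℝ}

/-- The exact evolution over many steps depends on the noise through its sum only. -/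
lemma stepProd_expF_eq (M : Coeffs) {k T : ℝ} {N : ℕ} {ω : Ω} {ζ : ℝ × ℝ} (hN : N * k = T)
    (h1 : √k * ∑ n ∈ Finset.range N, (Z n ω).1 = √T * ζ.1)
    (h2 : √k * ∑ n ∈ Finset.range N, (Z n ω).2 = √T * ζ.2) (p : Sym) :
    stepProd (expF M k p) Z N ω = expF M T p ζ := by
  -- Exponents add and are affine in the noise, so after `n` steps only the partial sums remain.
  have key : ∀ n : ℕ, stepProd (expF M k p) Z n ω = Complex.exp (
      (((n * k) / 2 * (M.ρx * p.s ^ 2 + M.ρy * p.t ^ 2) - (n * k) / 2 * (p.σ + p.τ) : ℝ) : ℂ) -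
      Complex.I * (((√M.ρx * (√k * ∑ i ∈ Finset.range n, (Z i ω).1) + n * k * M.μx) * p.s +
        (√M.ρy * (√k * ∑ i ∈ Finset.range n, (Z i ω).2) + n * k * M.μy) * p.t : ℝ) : ℂ)) := by
    intro n
    induction n with
    | zero => simp [stepProd]
    | succ n ih =>
      simp only [stepProd]
      rw [ih, expF_eq_exp_expArg, ← Complex.exp_add, Finset.sum_range_succ, Finset.sum_range_succ]
      unfold expArg
      congr 1
      push_cast
      ring
  rw [key, h1, h2, hN, expF_eq_exp_expArg]
  unfold expArg
  congr 1
  push_cast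
  ring

end Accumulated

section Measurability

variable {Ω : Type*} [MeasurableSpace Ω] {Z : ℕ → Ω → ℝ × ℝ} (M : Coeffs) (k hx hy : ℝ)

lemma measurable_stepProd_family {C : ℝ × ℝ → ℝ × ℝ → ℂ} (hC : Measurable (Function.uncurry C))
    (hZ : ∀ n, Measurable (Z n)) (n : ℕ) :
    Measurable (Function.uncurry fun (p : ℝ × ℝ) (ω : Ω) => stepProd (C p) Z n ω) := by
  induction n with
  | zero => simp only [stepProd]; exact measurable_const
  | succ n ih =>
    have h1 : Measurable fun q : (ℝ × ℝ) × Ω => C q.1 (Z n q.2) :=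
      hC.comp (measurable_fst.prodMk ((hZ n).comp measurable_snd))
    exact h1.mul ih

lemma measurable_ratF_symH : Measurable (Function.uncurry fun p z => ratF M k (symH hx hy p) z) := by
  unfold Function.uncurry ratF ratStep noise itoCorr impl symH
  fun_prop

lemma measurable_ratF_symZ : Measurable (Function.uncurry fun p z => ratF M k (symZ p) z) := by
  unfold Function.uncurry ratF ratStep noise itoCorr impl symZ
  fun_prop

lemma measurable_expF_symZ : Measurable (Function.uncurry fun p z => expF M k (symZ p) z) := by
  unfold Function.uncurry expF expStep noise itoCorr impl symZ
  fun_prop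

lemma measurable_spaceCoeffX : Measurable (Function.uncurry (spaceCoeffX M k)) := by
  have h : Measurable fun q : (ℝ × ℝ) × ℝ × ℝ => expArgCoeff M.ρx M.μx k q.2.1 q.1.1 := by
    unfold expArgCoeff; fun_prop
  exact (measurable_expF_symZ M k).mul h

lemma measurable_spaceCoeffY : Measurable (Function.uncurry (spaceCoeffY M k)) := by
  have h : Measurable fun q : (ℝ × ℝ) × ℝ × ℝ => expArgCoeff M.ρy M.μy k q.2.2 q.1.2 := by
    unfold expArgCoeff; fun_prop
  exact (measurable_expF_symZ M k).mul h

end Measurability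

/-! ### Frequency densities of the leading error terms -/

section Density

variable {Ω : Type*} [mΩ : MeasurableSpace Ω] {P : Measure Ω} {Z : ℕ → Ω → ℝ × ℝ} {ζ : Ω → ℝ × ℝ}
  {M : Coeffs} {lam k hx hy T : ℝ} {N : ℕ}

/-- The Gaussian decay of frequency densities at time `T`. -/
def decay (lam T : ℝ) (p : ℝ × ℝ) : ℝ := gaussWeight (decayRate lam * T / 2) p

lemma decay_nonneg (lam T : ℝ) (p : ℝ × ℝ) : 0 ≤ decay lam T p := (gaussWeight_pos _ _).le

@[fun_prop]
lemma measurable_decay (lam T : ℝ) : Measurable (decay lam T) := measurable_gaussWeight _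

lemma integrable_freq_pow_mul_decay (hl : lam < 1) (hT : 0 < T) (n : ℕ) :
    Integrable fun p => freq p ^ n * decay lam T p :=
  integrable_freq_pow_mul_gaussWeight (half_pos (mul_pos (decayRate_pos hl) hT)) n

lemma decay_sq (lam T : ℝ) (p : ℝ × ℝ) : decay lam T p ^ 2 = Real.exp (-(decayRate lam * (T * (p.1 ^ 2 + p.2 ^ 2)))) := by
  unfold decay
  rw [gaussWeight_sq]
  unfold gaussWeight
  congr 1; ring

lemma exp_pow_eq_decay_sq (hN : N * k = T) (p : ℝ × ℝ) :
    Real.exp (-(decayRate lam * (k * (p.1 ^ 2 + p.2 ^ 2)))) ^ N = decay lam T p ^ 2 := by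
  rw [decay_sq, ← Real.exp_nat_mul, ← hN]
  congr 1; ring

lemma norm_expF_symZ_le (hl : StableRate lam M.ρx M.ρy M.ρ) (hT : 0 ≤ T) (p z : ℝ × ℝ) :
    ‖expF M T (symZ p) z‖ ≤ decay lam T p :=
  norm_expF_le hl hT (symZ_bounded p).s_sq (symZ_bounded p).t_sq
    ((exp_symZ_le hl.lt hT p).trans (decay_sq lam T p).ge) (decay_nonneg _ _ _) z

lemma norm_expF_symH_le (hl : StableRate lam M.ρx M.ρy M.ρ) (hT : 0 ≤ T) (hhx : 0 < hx) (hhy : 0 < hy)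
    {p : ℝ × ℝ} (hp : p ∈ box hx hy) (z : ℝ × ℝ) : ‖expF M T (symH hx hy p) z‖ ≤ decay lam T p :=
  norm_expF_le hl hT (symH_s_sq hx hy p) (symH_t_sq hx hy p)
    ((exp_symH_le hl.lt hT hhx hhy hp).trans (decay_sq lam T p).ge) (decay_nonneg _ _ _) z

lemma sqLe_comp_of_cubic_bound {ρ : ℝ} (hζ : Measurable ζ) (hν : CorrGauss ρ (P.map ζ)) {f : ℝ × ℝ → ℂ}
    (hf : Measurable f) {b : ℝ} (hb : ∀ z, ‖f z‖ ≤ b * (1 + (|z.1| + |z.2|)) ^ 3) :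
    SqLe P (fun ω => f (ζ ω)) ((b * CorrGauss.momentConst) ^ 2) := by
  obtain ⟨h1, h2⟩ := secondMoment_of_cubic_bound hν hf hb
  have h3 : Integrable (fun ω => ‖f (ζ ω)‖ ^ 2) P := (integrable_map_measure (by fun_prop) (by fun_prop)).1 h1
  refine ⟨h3, ?_⟩
  rw [integral_map (by fun_prop) (by fun_prop)] at h2
  refine h2.trans ?_
  rw [mul_pow]
  have := CorrGauss.one_le_momentConst
  exact mul_le_mul_of_nonneg_left (by nlinarith) (sq_nonneg _)

lemma SqLe.congr {f g : Ω → ℂ} {A : ℝ} (h : SqLe P f A) (hfg : f =ᵐ[P] g) : SqLe P g A := by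
  have e : (fun ω => ‖f ω‖ ^ 2) =ᵐ[P] fun ω => ‖g ω‖ ^ 2 := by
    filter_upwards [hfg] with ω hω
    rw [hω]
  exact ⟨h.1.congr e, (integral_congr_ae e).symm.le.trans h.2⟩

lemma SqLe.add_sq {f g : Ω → ℂ} {a b : ℝ} (hf : SqLe P f (a ^ 2)) (hg : SqLe P g (b ^ 2)) (ha : 0 ≤ a) (hb : 0 ≤ b)
    (mf : AEStronglyMeasurable f P) (mg : AEStronglyMeasurable g P) :
    SqLe P (fun ω => f ω + g ω) ((2 * (a + b)) ^ 2) :=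
  (hf.add hg mf mg).mono (by nlinarith [mul_nonneg ha hb])

lemma SqLe.sub_sq {f g : Ω → ℂ} {a b : ℝ} (hf : SqLe P f (a ^ 2)) (hg : SqLe P g (b ^ 2)) (ha : 0 ≤ a) (hb : 0 ≤ b)
    (mf : AEStronglyMeasurable f P) (mg : AEStronglyMeasurable g P) :
    SqLe P (fun ω => f ω - g ω) ((2 * (a + b)) ^ 2) := by
  have hn : SqLe P (fun ω => -g ω) (b ^ 2) := by simpa only [SqLe, norm_neg] using hg
  simpa only [sub_eq_add_neg] using hf.add_sq hn ha hb mf mg.neg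

/-- A bound for the coefficients of the exponents up to time `T`. -/
def driftConst (M : Coeffs) (T : ℝ) : ℝ := (1 + T) * M.size

lemma one_le_driftConst (M : Coeffs) (hT : 0 ≤ T) : 1 ≤ driftConst M T := by
  have := M.two_le_size
  unfold driftConst; nlinarith

lemma self_le_cube {a : ℝ} (ha : 0 ≤ a) : 1 + a ≤ (1 + a) ^ 3 := le_self_pow₀ (by linarith) (by norm_num)

lemma norm_spaceCoeff_le_cube (hM : M.Valid) (hl : StableRate lam M.ρx M.ρy M.ρ) (hT : 0 ≤ T) (p z : ℝ × ℝ) :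
    ‖spaceCoeffX M T p z‖ ≤ driftConst M T * (freq p ^ 4 * decay lam T p) * (1 + (|z.1| + |z.2|)) ^ 3 ∧
    ‖spaceCoeffY M T p z‖ ≤ driftConst M T * (freq p ^ 4 * decay lam T p) * (1 + (|z.1| + |z.2|)) ^ 3 := by
  have h := norm_spaceCoeff_le hM hT (norm_expF_symZ_le hl hT p z)
  have hd := decay_nonneg lam T p
  have hc := one_le_driftConst M hT
  have hL := one_le_freq p
  have ha : 0 ≤ |z.1| + |z.2| := by positivity
  have e : decay lam T p * freq p ^ 4 * ((1 + T) * M.size * (1 + (|z.1| + |z.2|))) ≤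
      driftConst M T * (freq p ^ 4 * decay lam T p) * (1 + (|z.1| + |z.2|)) ^ 3 := by
    calc _ = driftConst M T * (freq p ^ 4 * decay lam T p) * (1 + (|z.1| + |z.2|)) := by unfold driftConst; ring
      _ ≤ _ := mul_le_mul_of_nonneg_left (self_le_cube ha) (by positivity)
  exact ⟨h.1.trans e, h.2.trans e⟩

/-- Densities evaluated at the endpoint of the driving motion grow at most polynomially in it, so a
pathwise cubic bound and Gaussian decay in frequency give an integrable root mean square. -/
lemma densityBound_of_cubic_bound {G : ℝ × ℝ → ℝ × ℝ → ℂ} (hG : Measurable (Function.uncurry G))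
    (hl : lam < 1) (hT : 0 < T) (hζ : Measurable ζ) {ρ : ℝ} (hν : CorrGauss ρ (P.map ζ)) {c : ℝ} (hc : 0 ≤ c) (n : ℕ)
    (hb : ∀ p z, ‖G p z‖ ≤ c * (freq p ^ n * decay lam T p) * (1 + (|z.1| + |z.2|)) ^ 3) :
    DensityBound P (fun p ω => G p (ζ ω))
      fun p => c * CorrGauss.momentConst * (freq p ^ n * decay lam T p) where
  meas := hG.comp (measurable_fst.prodMk (hζ.comp measurable_snd))
  wmeas := by fun_prop
  nonneg p := by
    have := CorrGauss.one_le_momentConst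
    have := decay_nonneg lam T p
    have := one_le_freq p
    positivity
  int := (integrable_freq_pow_mul_decay hl hT n).const_mul _
  sq p := by
    have := sqLe_comp_of_cubic_bound hζ hν (hG.comp (by fun_prop : Measurable fun z : ℝ × ℝ => (p, z)))
      (b := c * (freq p ^ n * decay lam T p)) (hb p)
    refine this.mono (le_of_eq ?_)
    ring

lemma densityBound_expF (hl : StableRate lam M.ρx M.ρy M.ρ) (hT : 0 < T) (hζ : Measurable ζ) {ρ : ℝ}
    (hν : CorrGauss ρ (P.map ζ)) :
    DensityBound P (fun p ω => expF M T (symZ p) (ζ ω))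
      fun p => 1 * CorrGauss.momentConst * (freq p ^ 0 * decay lam T p) := by
  refine densityBound_of_cubic_bound (measurable_expF_symZ M T) hl.lt hT hζ hν zero_le_one 0 fun p z => ?_
  rw [pow_zero, one_mul, one_mul]
  refine (norm_expF_symZ_le hl hT.le p z).trans (le_mul_of_one_le_right (decay_nonneg _ _ _) ?_)
  exact one_le_pow₀ (by linarith [abs_nonneg z.1, abs_nonneg z.2])

lemma densityBound_spaceCoeffX (hM : M.Valid) (hl : StableRate lam M.ρx M.ρy M.ρ) (hT : 0 < T) (hζ : Measurable ζ)
    {ρ : ℝ} (hν : CorrGauss ρ (P.map ζ)) : DensityBound P (fun p ω => spaceCoeffX M T p (ζ ω))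
      fun p => driftConst M T * CorrGauss.momentConst * (freq p ^ 4 * decay lam T p) :=
  densityBound_of_cubic_bound (measurable_spaceCoeffX M T) hl.lt hT hζ hν
    (zero_le_one.trans (one_le_driftConst M hT.le)) 4 fun p z => (norm_spaceCoeff_le_cube hM hl hT.le p z).1

lemma densityBound_spaceCoeffY (hM : M.Valid) (hl : StableRate lam M.ρx M.ρy M.ρ) (hT : 0 < T) (hζ : Measurable ζ)
    {ρ : ℝ} (hν : CorrGauss ρ (P.map ζ)) : DensityBound P (fun p ω => spaceCoeffY M T p (ζ ω))
      fun p => driftConst M T * CorrGauss.momentConst * (freq p ^ 4 * decay lam T p) :=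
  densityBound_of_cubic_bound (measurable_spaceCoeffY M T) hl.lt hT hζ hν
    (zero_le_one.trans (one_le_driftConst M hT.le)) 4 fun p z => (norm_spaceCoeff_le_cube hM hl hT.le p z).2

/-- The frequency density of the leading error in time. -/
def timeCoeff (M : Coeffs) (k : ℝ) (N : ℕ) (Z : ℕ → Ω → ℝ × ℝ) (p : ℝ × ℝ) (ω : Ω) : ℂ :=
  {p | scale M k (freq p) ≤ 1 / 4}.indicator (fun p => ((k⁻¹ : ℝ) : ℂ) *
    (stepProd (ratF M k (symZ p)) Z N ω - stepProd (expF M k (symZ p)) Z N ω)) p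

/-- The constant in the polynomial bound of the discrete Gronwall factor. -/
def growthConst (M : Coeffs) (T : ℝ) : ℝ := 1 + Real.exp (2 * T) * (2 * T) * (5 * (stepConst * M.size ^ 2) ^ 2)

lemma one_le_growthConst (M : Coeffs) (hT : 0 ≤ T) : 1 ≤ growthConst M T := by
  unfold growthConst
  have : 0 ≤ Real.exp (2 * T) * (2 * T) * (5 * (stepConst * M.size ^ 2) ^ 2) := by positivity
  linarith

/-- The Gronwall constant grows only polynomially in the frequency, so the Gaussian decay absorbs
it. -/
lemma one_add_growth_le (hT : 0 ≤ T) {L : ℝ} (hL : 1 ≤ L) :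
    1 + growth T (stepConst * rate M L) ≤ growthConst M T * L ^ 8 := by
  have h1 : 1 ≤ stepConst * rate M L := by
    have := one_le_rate M hL
    have := le_stepConst
    nlinarith
  have h2 : (1 + stepConst * rate M L) ^ 2 + 1 ≤ 5 * (stepConst * rate M L) ^ 2 := by nlinarith
  have h3 : growth T (stepConst * rate M L) ≤ Real.exp (2 * T) * (2 * T) * (5 * (stepConst * rate M L) ^ 2) :=
    mul_le_mul_of_nonneg_left h2 (by positivity)
  have h4 : (stepConst * rate M L) ^ 2 = (stepConst * M.size ^ 2) ^ 2 * L ^ 8 := by unfold rate; ring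
  have h5 : (1 : ℝ) ≤ L ^ 8 := one_le_pow₀ hL
  rw [h4] at h3
  unfold growthConst
  linarith

lemma measurableSet_low : MeasurableSet {p : ℝ × ℝ | scale M k (freq p) ≤ 1 / 4} := by
  refine measurableSet_le ?_ measurable_const
  unfold scale; fun_prop

lemma measurable_timeCoeff (hZ : ∀ n, Measurable (Z n)) : Measurable (Function.uncurry (timeCoeff M k N Z)) := by
  have h := ((measurable_stepProd_family (measurable_ratF_symZ M k) hZ N).sub
    (measurable_stepProd_family (measurable_expF_symZ M k) hZ N)).const_mul ((k⁻¹ : ℝ) : ℂ)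
  have := h.indicator ((measurableSet_low (M := M) (k := k)).preimage (measurable_fst (β := Ω)))
  exact this

variable [IsProbabilityMeasure P]

/-- On low frequencies this is `sqLe_time_error` divided by `k ^ 2`; the power `16` combines `8`
from the Gronwall constant and `8` from `rate ^ 2`. The cutoff is needed because the scheme at the
continuous symbols has Gaussian decay only there. The weight does not involve `k` or `N`, which
gives moments uniform in the timestep. -/
lemma densityBound_timeCoeff (hM : M.Valid) (hl : StableRate lam M.ρx M.ρy M.ρ) (hZ : GaussSteps P M.ρ Z)
    (hk : 0 < k) (hT : 0 < T) (hN : N * k = T) :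
    DensityBound P (timeCoeff M k N Z)
      fun p => growthConst M T * stepConst * M.size ^ 4 * (freq p ^ 16 * decay lam T p) where
  meas := measurable_timeCoeff hZ.meas
  wmeas := by fun_prop
  nonneg p := by
    have := one_le_growthConst M hT.le
    have := le_stepConst
    have := decay_nonneg lam T p
    have := one_le_freq p
    positivity
  int := (integrable_freq_pow_mul_decay hl.lt hT 16).const_mul _
  sq p := by
    by_cases hp : scale M k (freq p) ≤ 1 / 4
    · have h := ((lowPair_self hM hl hk.le hp).sqLe_time_error hZ hk (T := T) (N := N)
        (by rw [mul_comm]; exact hN.le) N le_rfl).const_mul ((k⁻¹ : ℝ) : ℂ)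
      have e : (timeCoeff M k N Z p) = fun ω => ((k⁻¹ : ℝ) : ℂ) *
          (stepProd (ratF M k (symZ p)) Z N ω - stepProd (expF M k (symZ p)) Z N ω) := by
        ext ω; exact Set.indicator_of_mem (s := {p | scale M k (freq p) ≤ 1 / 4}) hp _
      rw [e]
      refine h.mono ?_
      rw [exp_pow_eq_decay_sq hN, Complex.norm_real, Real.norm_eq_abs, sq_abs]
      have hL := one_le_freq p
      have g1 := one_add_growth_le (M := M) hT.le hL
      have g0 := growth_nonneg hT.le (stepConst * rate M (freq p))
      have g2 : growth T (stepConst * rate M (freq p)) ≤ (growthConst M T * freq p ^ 8) ^ 2 := by nlinarith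
      calc _ = growth T (stepConst * rate M (freq p)) * (stepConst * rate M (freq p) ^ 2 * decay lam T p) ^ 2 := by
            field_simp
        _ ≤ (growthConst M T * freq p ^ 8) ^ 2 * (stepConst * rate M (freq p) ^ 2 * decay lam T p) ^ 2 := by gcongr
        _ = _ := by unfold rate; ring
    · have e : (timeCoeff M k N Z p) = fun ω => 0 := by
        ext ω; exact Set.indicator_of_notMem (s := {p | scale M k (freq p) ≤ 1 / 4}) hp _
      rw [e]
      refine ⟨by simp, ?_⟩
      simp
      positivity

end Density

section Measurability

variable {Ω : Type*} [MeasurableSpace Ω] {G : ℝ × ℝ → ℝ × ℝ → ℂ} {ζ : Ω → ℝ × ℝ}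

lemma measurable_uncurry_comp (hG : Measurable (Function.uncurry G)) (hζ : Measurable ζ) :
    Measurable (Function.uncurry fun p ω => G p (ζ ω)) :=
  hG.comp (measurable_fst.prodMk (hζ.comp measurable_snd))

lemma measurable_of_uncurry (hG : Measurable (Function.uncurry G)) (p : ℝ × ℝ) : Measurable (G p) :=
  hG.comp (by fun_prop : Measurable fun z : ℝ × ℝ => (p, z))

end Measurability

/-! ### The remainder density in the four frequency regimes -/

section Remainder

variable {Ω : Type*} [mΩ : MeasurableSpace Ω] {P : Measure Ω} {Z : ℕ → Ω → ℝ × ℝ} {ζ : Ω → ℝ × ℝ}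
  {M : Coeffs} {lam k hx hy T : ℝ} {N : ℕ}

/-- The frequency density of the scheme, supported in the frequency box. -/
def schemeDensity (M : Coeffs) (k hx hy : ℝ) (N : ℕ) (Z : ℕ → Ω → ℝ × ℝ) (p : ℝ × ℝ) (ω : Ω) : ℂ :=
  (box hx hy).indicator (fun p => stepProd (ratF M k (symH hx hy p)) Z N ω) p

/-- The frequency density of the leading error in space. -/
def spaceDensity (M : Coeffs) (T hx hy : ℝ) (p z : ℝ × ℝ) : ℂ :=
  (hx ^ 2 : ℝ) * spaceCoeffX M T p z + (hy ^ 2 : ℝ) * spaceCoeffY M T p z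

/-- The frequency density of the error beyond leading order. -/
def remainder (M : Coeffs) (T k hx hy : ℝ) (N : ℕ) (Z : ℕ → Ω → ℝ × ℝ) (ζ : Ω → ℝ × ℝ) (p : ℝ × ℝ) (ω : Ω) : ℂ :=
  schemeDensity M k hx hy N Z p ω - expF M T (symZ p) (ζ ω) - (k : ℂ) * timeCoeff M k N Z p ω -
    spaceDensity M T hx hy p (ζ ω)

lemma measurable_schemeDensity (hZ : ∀ n, Measurable (Z n)) :
    Measurable (Function.uncurry (schemeDensity M k hx hy N Z)) := by
  have h := measurable_stepProd_family (measurable_ratF_symH M k hx hy) hZ N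
  exact h.indicator ((measurableSet_box hx hy).preimage (measurable_fst (β := Ω)))

lemma measurable_spaceDensity : Measurable (Function.uncurry (spaceDensity M T hx hy)) :=
  ((measurable_spaceCoeffX M T).const_mul _).add ((measurable_spaceCoeffY M T).const_mul _)

lemma measurable_remainder (hZ : ∀ n, Measurable (Z n)) (hζ : Measurable ζ) :
    Measurable (Function.uncurry (remainder M T k hx hy N Z ζ)) := by
  have h1 := measurable_uncurry_comp (measurable_expF_symZ M T) hζ
  have h2 := measurable_uncurry_comp (measurable_spaceDensity (M := M) (T := T) (hx := hx) (hy := hy)) hζ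
  have h3 : Measurable (Function.uncurry (schemeDensity M k hx hy N Z)) := measurable_schemeDensity hZ
  have h4 : Measurable (Function.uncurry (timeCoeff M k N Z)) := measurable_timeCoeff hZ
  exact ((h3.sub h1).sub (h4.const_mul _)).sub h2

/-- The mesh parameter in which the leading error is linear. -/
def meshSize (k hx hy : ℝ) : ℝ := k + hx ^ 2 + hy ^ 2

lemma meshSize_pos (hk : 0 < k) : 0 < meshSize k hx hy := by unfold meshSize; positivity

/-- Outside the resolved frequencies the mesh parameter is not small relative to the frequency. -/
lemma one_le_of_not_low (hk : 0 < k) {p : ℝ × ℝ} (h : ¬ scale M k (freq p) ≤ 1 / 4) :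
    1 ≤ 16 * meshSize k hx hy * rate M (freq p) := by
  have h1 := scale_sq M hk.le (freq p)
  have h2 : (1 / 4 : ℝ) ^ 2 ≤ scale M k (freq p) ^ 2 := by
    have := not_le.1 h
    gcongr
  have h3 : k * rate M (freq p) ≤ meshSize k hx hy * rate M (freq p) := by
    have := one_le_rate M (one_le_freq p)
    unfold meshSize
    gcongr
    nlinarith [sq_nonneg hx, sq_nonneg hy]
  unfold rate at *
  linarith

lemma one_le_of_not_mem_Icc {h ξ : ℝ} (hh : 0 < h) (hξ : ξ ∉ Set.Icc (-(Real.pi / h)) (Real.pi / h)) :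
    1 ≤ h ^ 2 * ξ ^ 2 := by
  have h1 : Real.pi / h < |ξ| := by
    by_contra hc
    exact hξ (abs_le.1 (not_lt.1 hc))
  rw [div_lt_iff₀ hh] at h1
  have h2 : 1 ≤ |ξ| * h := by linarith [Real.pi_gt_three]
  calc (1 : ℝ) ≤ (|ξ| * h) ^ 2 := one_le_pow₀ h2
    _ = h ^ 2 * ξ ^ 2 := by rw [mul_pow, sq_abs]; ring

/-- Outside the box one coordinate satisfies `|ξ| * h > π`, so `h ^ 2 * freq p ^ 2` exceeds one, and
`rate` dominates `freq p ^ 2`. -/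
lemma one_le_of_not_mem_box (hk : 0 < k) (hhx : 0 < hx) (hhy : 0 < hy) {p : ℝ × ℝ} (hp : p ∉ box hx hy) :
    1 ≤ 16 * meshSize k hx hy * rate M (freq p) := by
  have hL := one_le_freq p
  have h1 : 1 ≤ meshSize k hx hy * freq p ^ 2 := by
    have hp' : p.1 ∉ Set.Icc (-(Real.pi / hx)) (Real.pi / hx) ∨ p.2 ∉ Set.Icc (-(Real.pi / hy)) (Real.pi / hy) := by
      by_contra hc
      push Not at hc
      exact hp ⟨hc.1, hc.2⟩
    unfold meshSize
    rcases hp' with h | h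
    · refine (one_le_of_not_mem_Icc hhx h).trans (mul_le_mul ?_ (symZ_bounded p).σ (sq_nonneg _) (by positivity))
      nlinarith [sq_nonneg hy]
    · refine (one_le_of_not_mem_Icc hhy h).trans (mul_le_mul ?_ (symZ_bounded p).τ (sq_nonneg _) (by positivity))
      nlinarith [sq_nonneg hx]
  have h2 : freq p ^ 2 ≤ rate M (freq p) := by
    have := M.two_le_size
    unfold rate
    have a : freq p ^ 2 ≤ freq p ^ 4 := pow_le_pow_right₀ hL (by norm_num)
    have b : 1 ≤ M.size ^ 2 := by nlinarith
    have c : 0 ≤ freq p ^ 4 := by positivity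
    nlinarith
  have h3 := mul_le_mul_of_nonneg_left h2 (meshSize_pos (hx := hx) (hy := hy) hk).le
  linarith

/-- The rough bound away from the resolved frequencies. -/
def coarseConst (M : Coeffs) (T : ℝ) : ℝ := 272 * M.size ^ 4 * driftConst M T * CorrGauss.momentConst

/-- The bound for the remainder at the resolved frequencies. -/
def fineConst (M : Coeffs) (T : ℝ) : ℝ :=
  4 * growthConst M T * stepConst ^ 2 * M.size ^ 6 + 6 * driftConst M T ^ 2 * CorrGauss.momentConst

/-- The weight of the second-order error in frequency. -/
def secondWeight (lam T : ℝ) (p : ℝ × ℝ) : ℝ := freq p ^ 24 * decay lam T p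

lemma secondWeight_nonneg (lam T : ℝ) (p : ℝ × ℝ) : 0 ≤ secondWeight lam T p := by
  have := one_le_freq p
  have := decay_nonneg lam T p
  unfold secondWeight; positivity

lemma coarseConst_nonneg (hT : 0 ≤ T) : 0 ≤ coarseConst M T := by
  have := one_le_driftConst M hT
  have := CorrGauss.one_le_momentConst
  unfold coarseConst; positivity

lemma fineConst_nonneg (hT : 0 ≤ T) : 0 ≤ fineConst M T := by
  have := one_le_driftConst M hT
  have := one_le_growthConst M hT
  have := CorrGauss.one_le_momentConst
  unfold fineConst; positivity

/-- At unresolved frequencies smallness in the mesh is bought with powers of the frequency: `1` is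
bounded by the square of `16 * m * R`, and the mesh factor `m` by `16 * m ^ 2 * R ^ 2`. This gives
the constant `272 = 16 ^ 2 + 16`. -/
lemma coarse_le (hk : 0 < k) (hT : 0 ≤ T) {p : ℝ × ℝ} (h : 1 ≤ 16 * meshSize k hx hy * rate M (freq p)) :
    (1 + (hx ^ 2 + hy ^ 2)) * (driftConst M T * (freq p ^ 4 * decay lam T p)) * CorrGauss.momentConst ≤
      coarseConst M T * meshSize k hx hy ^ 2 * secondWeight lam T p := by
  have hL := one_le_freq p
  have hm := meshSize_pos (hx := hx) (hy := hy) hk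
  have hR := one_le_rate M hL
  have hd := decay_nonneg lam T p
  have hD := one_le_driftConst M hT
  have hc := CorrGauss.one_le_momentConst
  have hle : hx ^ 2 + hy ^ 2 ≤ meshSize k hx hy := by unfold meshSize; linarith
  set m := meshSize k hx hy
  set R := rate M (freq p) with hRd
  have h1 : 1 ≤ 256 * (m ^ 2 * R ^ 2) := by nlinarith
  have h2 : m ≤ 16 * (m ^ 2 * R ^ 2) := by
    have a := mul_le_mul_of_nonneg_left h hm.le
    have b : m ^ 2 * R ≤ m ^ 2 * R ^ 2 := mul_le_mul_of_nonneg_left (by nlinarith) (sq_nonneg m)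
    nlinarith
  have h3 : 1 + (hx ^ 2 + hy ^ 2) ≤ 272 * (m ^ 2 * R ^ 2) := by linarith
  have h4 : freq p ^ 12 ≤ freq p ^ 24 := pow_le_pow_right₀ hL (by norm_num)
  calc _ ≤ 272 * (m ^ 2 * R ^ 2) * (driftConst M T * (freq p ^ 4 * decay lam T p)) * CorrGauss.momentConst := by
        gcongr
    _ = coarseConst M T * m ^ 2 * (freq p ^ 12 * decay lam T p) := by
        rw [hRd]; unfold coarseConst rate; ring
    _ ≤ _ := by
        have := coarseConst_nonneg (M := M) hT
        unfold secondWeight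
        gcongr

lemma norm_spaceDensity_le (hM : M.Valid) (hl : StableRate lam M.ρx M.ρy M.ρ) (hT : 0 ≤ T) (p z : ℝ × ℝ) :
    ‖spaceDensity M T hx hy p z‖ ≤
      (hx ^ 2 + hy ^ 2) * (driftConst M T * (freq p ^ 4 * decay lam T p)) * (1 + (|z.1| + |z.2|)) ^ 3 := by
  obtain ⟨h1, h2⟩ := norm_spaceCoeff_le_cube hM hl hT p z
  refine (norm_add_le _ _).trans ?_
  rw [norm_mul, norm_mul, Complex.norm_real, Complex.norm_real, Real.norm_of_nonneg (sq_nonneg hx),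
    Real.norm_of_nonneg (sq_nonneg hy)]
  have a := mul_le_mul_of_nonneg_left h1 (sq_nonneg hx)
  have b := mul_le_mul_of_nonneg_left h2 (sq_nonneg hy)
  linarith

lemma norm_expF_le_cube (hl : StableRate lam M.ρx M.ρy M.ρ) (hT : 0 ≤ T) (p z : ℝ × ℝ) :
    ‖expF M T (symZ p) z‖ ≤ 1 * (driftConst M T * (freq p ^ 4 * decay lam T p)) * (1 + (|z.1| + |z.2|)) ^ 3 := by
  have hd := decay_nonneg lam T p
  have h1 : 1 ≤ driftConst M T * freq p ^ 4 :=
    one_le_mul_of_one_le_of_one_le (one_le_driftConst M hT) (one_le_pow₀ (one_le_freq p))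
  have h2 : 1 ≤ (1 + (|z.1| + |z.2|)) ^ 3 := one_le_pow₀ (by linarith [abs_nonneg z.1, abs_nonneg z.2])
  calc ‖expF M T (symZ p) z‖ ≤ decay lam T p := norm_expF_symZ_le hl hT p z
    _ ≤ (driftConst M T * freq p ^ 4) * (1 + (|z.1| + |z.2|)) ^ 3 * decay lam T p :=
        le_mul_of_one_le_left hd (one_le_mul_of_one_le_of_one_le h1 h2)
    _ = _ := by ring

section Bounds

variable (hM : M.Valid) (hl : StableRate lam M.ρx M.ρy M.ρ) (hZ : GaussSteps P M.ρ Z) (hζ : Measurable ζ)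
  (hν : CorrGauss M.ρ (P.map ζ)) (hk : 0 < k) (hT : 0 < T) (hN : N * k = T) (hhx : 0 < hx) (hhy : 0 < hy)

include hM hl hζ hν hk hT

lemma sqLe_spaceDensity_coarse {p : ℝ × ℝ} (h : 1 ≤ 16 * meshSize k hx hy * rate M (freq p)) :
    SqLe P (fun ω => spaceDensity M T hx hy p (ζ ω))
      ((coarseConst M T * meshSize k hx hy ^ 2 * secondWeight lam T p) ^ 2) := by
  have hd := decay_nonneg lam T p
  have hD := one_le_driftConst M hT.le
  have hc := CorrGauss.one_le_momentConst
  have hL := one_le_freq p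
  refine (sqLe_comp_of_cubic_bound hζ hν (measurable_of_uncurry measurable_spaceDensity p)
    (norm_spaceDensity_le hM hl hT.le p)).mono (pow_le_pow_left₀ (by positivity) ?_ 2)
  refine le_trans ?_ (coarse_le hk hT.le h)
  have hδ : hx ^ 2 + hy ^ 2 ≤ 1 + (hx ^ 2 + hy ^ 2) := by linarith
  exact mul_le_mul_of_nonneg_right (mul_le_mul_of_nonneg_right hδ (by positivity)) (by positivity)

lemma sqLe_exact_add_space_coarse {p : ℝ × ℝ} (h : 1 ≤ 16 * meshSize k hx hy * rate M (freq p)) :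
    SqLe P (fun ω => expF M T (symZ p) (ζ ω) + spaceDensity M T hx hy p (ζ ω))
      ((coarseConst M T * meshSize k hx hy ^ 2 * secondWeight lam T p) ^ 2) := by
  have hd := decay_nonneg lam T p
  have hD := one_le_driftConst M hT.le
  have hc := CorrGauss.one_le_momentConst
  have hL := one_le_freq p
  have hm : Measurable fun z => expF M T (symZ p) z + spaceDensity M T hx hy p z :=
    (measurable_expF M T (symZ p)).add (measurable_of_uncurry measurable_spaceDensity p)
  refine (sqLe_comp_of_cubic_bound hζ hν hm (b := (1 + (hx ^ 2 + hy ^ 2)) *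
    (driftConst M T * (freq p ^ 4 * decay lam T p))) fun z => ?_).mono
    (pow_le_pow_left₀ (by positivity) (coarse_le hk hT.le h) 2)
  refine (norm_add_le _ _).trans ((add_le_add (norm_expF_le_cube hl hT.le p z)
    (norm_spaceDensity_le hM hl hT.le p z)).trans (le_of_eq ?_))
  ring

omit hM hl hζ hν in
lemma decay_le_coarse {p : ℝ × ℝ} (h : 1 ≤ 16 * meshSize k hx hy * rate M (freq p)) :
    decay lam T p ≤ coarseConst M T * meshSize k hx hy ^ 2 * secondWeight lam T p := by
  refine le_trans ?_ (coarse_le hk hT.le h)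
  have hd := decay_nonneg lam T p
  have h1 : 1 ≤ (1 + (hx ^ 2 + hy ^ 2)) * (driftConst M T * freq p ^ 4) * CorrGauss.momentConst :=
    one_le_mul_of_one_le_of_one_le (one_le_mul_of_one_le_of_one_le (by linarith [sq_nonneg hx, sq_nonneg hy])
      (one_le_mul_of_one_le_of_one_le (one_le_driftConst M hT.le) (one_le_pow₀ (one_le_freq p))))
      CorrGauss.one_le_momentConst
  calc decay lam T p ≤ _ * decay lam T p := le_mul_of_one_le_left hd h1
    _ = _ := by ring

include hhx hhy

lemma sqLe_space_taylor {p : ℝ × ℝ} (hp : p ∈ box hx hy) :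
    SqLe P (fun ω => expF M T (symH hx hy p) (ζ ω) - expF M T (symZ p) (ζ ω) - spaceDensity M T hx hy p (ζ ω))
      ((6 * driftConst M T ^ 2 * CorrGauss.momentConst * meshSize k hx hy ^ 2 * secondWeight lam T p) ^ 2) := by
  have hd := decay_nonneg lam T p
  have hD := one_le_driftConst M hT.le
  have hc := CorrGauss.one_le_momentConst
  have hL := one_le_freq p
  have hle : hx ^ 2 + hy ^ 2 ≤ meshSize k hx hy := by unfold meshSize; linarith
  have hm : Measurable fun z => expF M T (symH hx hy p) z - expF M T (symZ p) z - spaceDensity M T hx hy p z :=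
    ((measurable_expF M T _).sub (measurable_expF M T (symZ p))).sub
      (measurable_of_uncurry measurable_spaceDensity p)
  refine (sqLe_comp_of_cubic_bound hζ hν hm (b := 6 * driftConst M T ^ 2 * (hx ^ 2 + hy ^ 2) ^ 2 *
    (freq p ^ 8 * decay lam T p)) fun z => ?_).mono (pow_le_pow_left₀ (by positivity) ?_ 2)
  · have h := norm_expF_symH_taylor_le hM hT.le hhx hhy (norm_expF_symZ_le hl hT.le p z)
      (norm_expF_symH_le hl hT.le hhx hhy hp z)
    have e : expF M T (symH hx hy p) z - expF M T (symZ p) z - spaceDensity M T hx hy p z =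
        expF M T (symH hx hy p) z - expF M T (symZ p) z - (hx ^ 2 : ℝ) * spaceCoeffX M T p z -
          (hy ^ 2 : ℝ) * spaceCoeffY M T p z := by unfold spaceDensity; ring
    rw [e]
    refine h.trans ?_
    have hz : 1 ≤ 1 + (|z.1| + |z.2|) := by linarith [abs_nonneg z.1, abs_nonneg z.2]
    calc _ = 6 * driftConst M T ^ 2 * (hx ^ 2 + hy ^ 2) ^ 2 * (freq p ^ 8 * decay lam T p) *
          (1 + (|z.1| + |z.2|)) ^ 2 := by unfold driftConst; ring
      _ ≤ _ := mul_le_mul_of_nonneg_left (pow_le_pow_right₀ hz (by norm_num)) (by positivity)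
  · have h4 : freq p ^ 8 ≤ freq p ^ 24 := pow_le_pow_right₀ hL (by norm_num)
    calc _ ≤ 6 * driftConst M T ^ 2 * meshSize k hx hy ^ 2 * (freq p ^ 24 * decay lam T p) * CorrGauss.momentConst := by
          gcongr
      _ = _ := by unfold secondWeight; ring

variable [IsProbabilityMeasure P]

include hZ hN

-- The weight `freq p ^ 24` originates here: `8` powers from the Gronwall constant, `12` from `rate
-- ^ 3` and `4` from the distance between the two symbols.
omit hζ hν in
lemma sqLe_mixed {p : ℝ × ℝ} (hp : p ∈ box hx hy) (hs : scale M k (freq p) ≤ 1 / 4) :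
    SqLe P (fun ω => (stepProd (ratF M k (symH hx hy p)) Z N ω - stepProd (expF M k (symH hx hy p)) Z N ω) -
      (stepProd (ratF M k (symZ p)) Z N ω - stepProd (expF M k (symZ p)) Z N ω))
      ((4 * growthConst M T * stepConst ^ 2 * M.size ^ 6 * meshSize k hx hy ^ 2 * secondWeight lam T p) ^ 2) := by
  have h := (lowPair hM hl hk.le hhx hhy hs hp).sqLe_mixed_error (N := N) hZ hk hT.le (by rw [mul_comm]; exact hN.le)
  refine h.mono ?_
  rw [exp_pow_eq_decay_sq hN]
  have hL := one_le_freq p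
  have hd := decay_nonneg lam T p
  have g1 := one_add_growth_le (M := M) hT.le hL
  have g0 := growth_nonneg hT.le (stepConst * rate M (freq p))
  have hG := one_le_growthConst M hT.le
  have hs := le_stepConst
  have hz := M.two_le_size
  have hR := one_le_rate M hL
  have hkm : k * (hx ^ 2 + hy ^ 2) ≤ meshSize k hx hy ^ 2 := by
    unfold meshSize; nlinarith [sq_nonneg hx, sq_nonneg hy, mul_nonneg (sq_nonneg hx) (sq_nonneg hy)]
  set δ := hx ^ 2 + hy ^ 2
  have hδ : 0 < δ := by positivity
  have e1 : (1 + growth T (stepConst * rate M (freq p))) * (stepConst ^ 2 * rate M (freq p) ^ 3) * (k * (δ * freq p ^ 4)) ≤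
      growthConst M T * stepConst ^ 2 * M.size ^ 6 * meshSize k hx hy ^ 2 * freq p ^ 24 := by
    calc _ ≤ (growthConst M T * freq p ^ 8) * (stepConst ^ 2 * rate M (freq p) ^ 3) * (k * (δ * freq p ^ 4)) := by gcongr
      _ = growthConst M T * stepConst ^ 2 * M.size ^ 6 * (k * δ) * freq p ^ 24 := by unfold rate; ring
      _ ≤ _ := by gcongr
  calc _ ≤ 10 * (growthConst M T * stepConst ^ 2 * M.size ^ 6 * meshSize k hx hy ^ 2 * freq p ^ 24) ^ 2 *
        decay lam T p ^ 2 := by gcongr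
    _ ≤ 16 * (growthConst M T * stepConst ^ 2 * M.size ^ 6 * meshSize k hx hy ^ 2 * freq p ^ 24) ^ 2 *
        decay lam T p ^ 2 := by gcongr; norm_num
    _ = _ := by unfold secondWeight; ring

-- Valid on the whole box without any smallness of the step. Each step contracts the second moment
-- either exponentially or by `(1 + lam) / 2 = θ ^ 2`; the sum covers both alternatives.
omit hζ hν hT in
lemma sqLe_scheme {θ : ℝ} (hθ : θ ^ 2 = (1 + lam) / 2) (hθ0 : 0 ≤ θ) {p : ℝ × ℝ} (hp : p ∈ box hx hy) :
    SqLe P (stepProd (ratF M k (symH hx hy p)) Z N) ((decay lam T p + θ ^ N) ^ 2) := by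
  set q := max (Real.exp (-((1 - lam) / 2 * (k * ((symH hx hy p).σ + (symH hx hy p).τ))))) ((1 + lam) / 2) with hq
  have hq0 : 0 ≤ q := le_max_of_le_left (Real.exp_pos _).le
  have h := hZ.sqLe_stepProd (C := ratF M k (symH hx hy p)) (by fun_prop) hq0
    (fun n => integrable_norm_ratF_sq (hZ.law n) _ _)
    (fun n => integral_norm_ratF_sq_pow_le hM (hZ.law n) hl hk.le (symH_s_sq hx hy p) (symH_t_sq hx hy p)) N
  refine h.mono ?_
  have hd := decay_nonneg lam T p
  have ht : 0 ≤ θ ^ N := by positivity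
  have h1 : Real.exp (-((1 - lam) / 2 * (k * ((symH hx hy p).σ + (symH hx hy p).τ)))) ^ N ≤ decay lam T p ^ 2 := by
    rw [← exp_pow_eq_decay_sq hN]
    exact pow_le_pow_left₀ (Real.exp_pos _).le (exp_symH_le hl.lt hk.le hhx hhy hp) N
  have h2 : ((1 + lam) / 2) ^ N = (θ ^ N) ^ 2 := by rw [← hθ, ← pow_mul, ← pow_mul, mul_comm]
  rcases max_choice (Real.exp (-((1 - lam) / 2 * (k * ((symH hx hy p).σ + (symH hx hy p).τ))))) ((1 + lam) / 2) with h3 | h3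
  · rw [hq, h3]; nlinarith
  · rw [hq, h3, h2]; nlinarith

/-- The weight of the remainder density. -/
def remainderWeight (M : Coeffs) (lam T θ k hx hy : ℝ) (N : ℕ) (p : ℝ × ℝ) : ℝ :=
  (2 * fineConst M T + 4 * coarseConst M T) * meshSize k hx hy ^ 2 * secondWeight lam T p +
    (box hx hy).indicator (fun _ => 2 * θ ^ N) p

omit hM hl hZ hζ hν hk hT hN hhx hhy in
lemma remainderWeight_nonneg (hT : 0 ≤ T) {θ : ℝ} (hθ0 : 0 ≤ θ) (p : ℝ × ℝ) :
    0 ≤ remainderWeight M lam T θ k hx hy N p := by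
  have h1 := fineConst_nonneg (M := M) hT
  have h2 := coarseConst_nonneg (M := M) hT
  have h3 := secondWeight_nonneg lam T p
  have h4 : 0 ≤ (box hx hy).indicator (fun _ => 2 * θ ^ N) p := Set.indicator_nonneg (fun _ _ => by positivity) p
  unfold remainderWeight
  positivity

/-- The cases are whether the frequency lies in the box and whether it is low. Only the first needs
the cancellation of leading terms; in the others each surviving term is bounded on its own. -/
lemma densityBound_remainder {θ : ℝ} (hθ : θ ^ 2 = (1 + lam) / 2) (hθ0 : 0 ≤ θ)
    (hX : ∀ᵐ ω ∂P, ∀ p, stepProd (expF M k p) Z N ω = expF M T p (ζ ω)) :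
    DensityBound P (remainder M T k hx hy N Z ζ) (remainderWeight M lam T θ k hx hy N) where
  meas := measurable_remainder hZ.meas hζ
  wmeas := by
    unfold remainderWeight secondWeight
    exact (by fun_prop : Measurable fun p => (2 * fineConst M T + 4 * coarseConst M T) * meshSize k hx hy ^ 2 *
      (freq p ^ 24 * decay lam T p)).add (measurable_const.indicator (measurableSet_box hx hy))
  nonneg := remainderWeight_nonneg hT.le hθ0
  int := by
    refine ((integrable_freq_pow_mul_decay hl.lt hT 24).const_mul _).add ?_
    rw [integrable_indicator_iff (measurableSet_box hx hy)]
    exact integrableOn_const (isCompact_box hx hy).measure_lt_top.ne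
  sq p := by
    have hm := meshSize_pos (hx := hx) (hy := hy) hk
    have h1 := fineConst_nonneg (M := M) hT.le
    have h2 := coarseConst_nonneg (M := M) hT.le
    have h3 := secondWeight_nonneg lam T p
    have h4 : 0 ≤ (box hx hy).indicator (fun _ => 2 * θ ^ N) p := Set.indicator_nonneg (fun _ _ => by positivity) p
    have hw : remainderWeight M lam T θ k hx hy N p = 2 * (fineConst M T * meshSize k hx hy ^ 2 * secondWeight lam T p) +
      4 * (coarseConst M T * meshSize k hx hy ^ 2 * secondWeight lam T p) +
      (box hx hy).indicator (fun _ => 2 * θ ^ N) p := by unfold remainderWeight; ring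
    have hf0 : 0 ≤ fineConst M T * meshSize k hx hy ^ 2 * secondWeight lam T p := by positivity
    have hc0 : 0 ≤ coarseConst M T * meshSize k hx hy ^ 2 * secondWeight lam T p := by positivity
    have mS : ∀ {C : ℝ × ℝ → ℂ}, Measurable C → Measurable (stepProd C Z N) := fun hC =>
      (measurable_past_stepProd hC N).mono (past_le hZ.meas N) le_rfl
    have mD : Measurable fun ω => spaceDensity M T hx hy p (ζ ω) :=
      (measurable_of_uncurry measurable_spaceDensity p).comp hζ
    have mX : Measurable fun ω => expF M T (symZ p) (ζ ω) := (measurable_expF M T _).comp hζ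
    have mXH : Measurable fun ω => expF M T (symH hx hy p) (ζ ω) := (measurable_expF M T _).comp hζ
    have hkk : (k : ℂ) * ((k⁻¹ : ℝ) : ℂ) = 1 := by
      rw [← Complex.ofReal_mul, mul_inv_cancel₀ hk.ne', Complex.ofReal_one]
    by_cases hb : p ∈ box hx hy
    · by_cases hs : scale M k (freq p) ≤ 1 / 4
      -- Resolved frequencies: as the product of exact steps at `symH` is the exact evolution over
      -- `T`, the remainder is the mixed time–space error plus the second-order Taylor remainder in
      -- space.
      · have a1 := sqLe_mixed hM hl hZ hk hT hN hhx hhy hb hs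
        have a2 := sqLe_space_taylor hM hl hζ hν hk hT hhx hhy hb
        have hc := CorrGauss.one_le_momentConst
        have hD := one_le_driftConst M hT.le
        have hG := one_le_growthConst M hT.le
        have := (a1.add_sq a2 (by positivity) (by positivity)
          (((mS (by fun_prop)).sub (mS (by fun_prop))).sub ((mS (by fun_prop)).sub (mS (by fun_prop)))).aestronglyMeasurable
          ((mXH.sub mX).sub mD).aestronglyMeasurable)
        refine (this.congr ?_).mono ?_
        · filter_upwards [hX] with ω hω
          simp only [remainder, schemeDensity, timeCoeff]
          rw [Set.indicator_of_mem hb, Set.indicator_of_mem (s := {p | scale M k (freq p) ≤ 1 / 4}) hs, hω, hω]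
          linear_combination (-(stepProd (ratF M k (symZ p)) Z N ω - expF M T (symZ p) (ζ ω))) * (-hkk)
        · refine pow_le_pow_left₀ (by positivity) ?_ 2
          rw [hw]
          have e : 4 * growthConst M T * stepConst ^ 2 * M.size ^ 6 * meshSize k hx hy ^ 2 * secondWeight lam T p +
            6 * driftConst M T ^ 2 * CorrGauss.momentConst * meshSize k hx hy ^ 2 * secondWeight lam T p =
            fineConst M T * meshSize k hx hy ^ 2 * secondWeight lam T p := by unfold fineConst; ring
          rw [e]
          linarith
      -- In the box but not low: the time coefficient is cut off, and only here does the term `θ ^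
      -- N` of the scheme appear.
      · have hA := one_le_of_not_low (hx := hx) (hy := hy) hk hs
        have a1 := sqLe_scheme hM hl hZ hk hN hhx hhy hθ hθ0 hb
        have a2 := sqLe_exact_add_space_coarse hM hl hζ hν hk hT hA
        have hd := decay_nonneg lam T p
        have := a1.sub_sq a2 (by positivity) hc0 (mS (by fun_prop)).aestronglyMeasurable (mX.add mD).aestronglyMeasurable
        refine (this.congr (ae_of_all _ fun ω => ?_)).mono ?_
        · simp only [remainder, schemeDensity, timeCoeff]
          rw [Set.indicator_of_mem hb, Set.indicator_of_notMem (s := {p | scale M k (freq p) ≤ 1 / 4}) hs]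
          ring
        · refine pow_le_pow_left₀ (by positivity) ?_ 2
          rw [hw, Set.indicator_of_mem hb]
          have := decay_le_coarse (lam := lam) hk hT hA
          linarith
    · have hA := one_le_of_not_mem_box (M := M) hk hhx hhy hb
      by_cases hs : scale M k (freq p) ≤ 1 / 4
      -- Low but outside the box: the scheme has no mass, and the exact evolution plus `k` times the
      -- time coefficient recombine into the scheme at the continuous symbols.
      · have a1 : SqLe P (stepProd (ratF M k (symZ p)) Z N) (decay lam T p ^ 2) := by
          have := (lowPair_self hM hl hk.le hs).sqLe_ratF hZ N
          rwa [exp_pow_eq_decay_sq hN] at this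
        have a2 := sqLe_spaceDensity_coarse hM hl hζ hν hk hT hA
        have hd := decay_nonneg lam T p
        have := a1.add_sq a2 hd hc0 (mS (by fun_prop)).aestronglyMeasurable mD.aestronglyMeasurable
        have hneg : SqLe P (fun ω => -(stepProd (ratF M k (symZ p)) Z N ω + spaceDensity M T hx hy p (ζ ω)))
            ((2 * (decay lam T p + coarseConst M T * meshSize k hx hy ^ 2 * secondWeight lam T p)) ^ 2) := by
          simpa only [SqLe, norm_neg] using this
        refine (hneg.congr ?_).mono ?_
        · filter_upwards [hX] with ω hω
          simp only [remainder, schemeDensity, timeCoeff]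
          rw [Set.indicator_of_notMem hb, Set.indicator_of_mem (s := {p | scale M k (freq p) ≤ 1 / 4}) hs, hω]
          linear_combination (stepProd (ratF M k (symZ p)) Z N ω - expF M T (symZ p) (ζ ω)) * hkk
        · refine pow_le_pow_left₀ (by positivity) ?_ 2
          rw [hw]
          have := decay_le_coarse (lam := lam) hk hT hA
          linarith
      -- Neither low nor in the box: only the exact evolution and its spatial correction remain.
      · have a2 := sqLe_exact_add_space_coarse hM hl hζ hν hk hT hA
        have hneg : SqLe P (fun ω => -(expF M T (symZ p) (ζ ω) + spaceDensity M T hx hy p (ζ ω)))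
            ((coarseConst M T * meshSize k hx hy ^ 2 * secondWeight lam T p) ^ 2) := by
          simpa only [SqLe, norm_neg] using a2
        refine (hneg.congr (ae_of_all _ fun ω => ?_)).mono ?_
        · simp only [remainder, schemeDensity, timeCoeff]
          rw [Set.indicator_of_notMem hb, Set.indicator_of_notMem (s := {p | scale M k (freq p) ≤ 1 / 4}) hs]
          ring
        · refine pow_le_pow_left₀ hc0 ?_ 2
          rw [hw]
          linarith

end Bounds

end Remainder

/-! ### The error expansion at a point -/

section Expansion

variable {Ω : Type*} [mΩ : MeasurableSpace Ω] {P : Measure Ω} [IsProbabilityMeasure P] {Z : ℕ → Ω → ℝ × ℝ}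
  {ζ : Ω → ℝ × ℝ} {M : Coeffs} {lam k hx hy T θ x₀ y₀ : ℝ} {N : ℕ}

lemma gridFT_stepProd_eq_field {Ω : Type*} {Z : ℕ → Ω → ℝ × ℝ} (x y : ℝ) (ω : Ω) :
    (4 * Real.pi ^ 2)⁻¹ * (∫ p in box hx hy, phase x y p * stepProd (ratF M k (symH hx hy p)) Z N ω).re =
      field (schemeDensity M k hx hy N Z) x y ω := by
  unfold field
  rw [← integral_indicator (measurableSet_box hx hy)]
  congr 3
  ext p
  unfold schemeDensity
  by_cases hp : p ∈ box hx hy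
  · rw [Set.indicator_of_mem hp, Set.indicator_of_mem hp]
  · rw [Set.indicator_of_notMem hp, Set.indicator_of_notMem hp, mul_zero]

/-- The error expansion of the scheme, density by density. -/
lemma ae_expansion (hM : M.Valid) (hl : StableRate lam M.ρx M.ρy M.ρ) (hZ : GaussSteps P M.ρ Z) (hζ : Measurable ζ)
    (hν : CorrGauss M.ρ (P.map ζ)) (hk : 0 < k) (hT : 0 < T) (hN : N * k = T) (hhx : 0 < hx) (hhy : 0 < hy)
    (hθ : θ ^ 2 = (1 + lam) / 2) (hθ0 : 0 ≤ θ)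
    (hX : ∀ᵐ ω ∂P, ∀ p, stepProd (expF M k p) Z N ω = expF M T p (ζ ω)) (x y : ℝ) :
    ∀ᵐ ω ∂P, field (schemeDensity M k hx hy N Z) (x - x₀) (y - y₀) ω -
        exactSolution M.μx M.μy M.ρx M.ρy x₀ y₀ T (√T * (ζ ω).1) (√T * (ζ ω).2) x y =
      k * field (timeCoeff M k N Z) (x - x₀) (y - y₀) ω +
        hx ^ 2 * field (fun p ω => spaceCoeffX M T p (ζ ω)) (x - x₀) (y - y₀) ω +
        hy ^ 2 * field (fun p ω => spaceCoeffY M T p (ζ ω)) (x - x₀) (y - y₀) ω +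
        field (remainder M T k hx hy N Z ζ) (x - x₀) (y - y₀) ω := by
  have dX := densityBound_expF hl hT hζ hν
  have d1 := densityBound_timeCoeff hM hl hZ hk hT hN
  have d2 := densityBound_spaceCoeffX hM hl hT hζ hν
  have d3 := densityBound_spaceCoeffY hM hl hT hζ hν
  have d4 := densityBound_remainder hM hl hZ hζ hν hk hT hN hhx hhy hθ hθ0 hX
  filter_upwards [dX.ae_integrable, d1.ae_integrable, d2.ae_integrable, d3.ae_integrable, d4.ae_integrable]
    with ω iX i1 i2 i3 i4
  have jX := dX.integrable_phase_mul iX (x - x₀) (y - y₀)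
  have j1 := (d1.integrable_phase_mul i1 (x - x₀) (y - y₀)).const_mul (k : ℂ)
  have j2 := (d2.integrable_phase_mul i2 (x - x₀) (y - y₀)).const_mul ((hx ^ 2 : ℝ) : ℂ)
  have j3 := (d3.integrable_phase_mul i3 (x - x₀) (y - y₀)).const_mul ((hy ^ 2 : ℝ) : ℂ)
  have j4 := d4.integrable_phase_mul i4 (x - x₀) (y - y₀)
  rw [exactSolution_eq_integral hM hT]
  -- The remainder density is by definition what the other terms leave, so the expansion is
  -- linearity of the integral, legitimate on the event where the exact, leading-error and remainder
  -- densities are integrable.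
  have e : ∫ p, phase (x - x₀) (y - y₀) p * schemeDensity M k hx hy N Z p ω =
      (∫ p, phase (x - x₀) (y - y₀) p * expF M T (symZ p) (ζ ω)) +
      (k : ℂ) * (∫ p, phase (x - x₀) (y - y₀) p * timeCoeff M k N Z p ω) +
      ((hx ^ 2 : ℝ) : ℂ) * (∫ p, phase (x - x₀) (y - y₀) p * spaceCoeffX M T p (ζ ω)) +
      ((hy ^ 2 : ℝ) : ℂ) * (∫ p, phase (x - x₀) (y - y₀) p * spaceCoeffY M T p (ζ ω)) +
      ∫ p, phase (x - x₀) (y - y₀) p * remainder M T k hx hy N Z ζ p ω := by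
    rw [← integral_const_mul, ← integral_const_mul, ← integral_const_mul, ← integral_add' jX j1,
      ← integral_add' (jX.add j1) j2, ← integral_add' ((jX.add j1).add j2) j3,
      ← integral_add' (((jX.add j1).add j2).add j3) j4]
    congr 1
    ext p
    simp only [Pi.add_apply, remainder, spaceDensity]
    ring
  unfold field
  rw [e]
  simp only [Complex.add_re, Complex.re_ofReal_mul]
  ring

end Expansion

/-! ### The deterministic size of the remainder -/

section Rate

variable {M : Coeffs} {lam k hx hy T θ : ℝ} {N : ℕ}

/-- The total mass of the second-order weight. -/
def secondMass (M : Coeffs) (lam T : ℝ) : ℝ :=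
  (2 * fineConst M T + 4 * coarseConst M T) * ∫ p, secondWeight lam T p

lemma secondMass_nonneg (hT : 0 ≤ T) : 0 ≤ secondMass M lam T := by
  have h1 := fineConst_nonneg (M := M) hT
  have h2 := coarseConst_nonneg (M := M) hT
  have h3 : 0 ≤ ∫ p, secondWeight lam T p := integral_nonneg fun p => secondWeight_nonneg lam T p
  unfold secondMass; positivity

/-- The deterministic size of the remainder. -/
def remainderSize (M : Coeffs) (lam T θ k hx hy : ℝ) (N : ℕ) : ℝ :=
  secondMass M lam T * meshSize k hx hy ^ 2 + 8 * Real.pi ^ 2 * (θ ^ N / (hx * hy))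

lemma remainderSize_pos (hT : 0 ≤ T) (hθ : 0 < θ) (hhx : 0 < hx) (hhy : 0 < hy) :
    0 < remainderSize M lam T θ k hx hy N := by
  have := secondMass_nonneg (M := M) (lam := lam) hT
  have := Real.pi_pos
  unfold remainderSize
  positivity

lemma integral_remainderWeight (hl : lam < 1) (hT : 0 < T) (hhx : 0 < hx) (hhy : 0 < hy) :
    ∫ p, remainderWeight M lam T θ k hx hy N p = remainderSize M lam T θ k hx hy N := by
  have hpi := Real.pi_pos
  have hvol : (volume : Measure (ℝ × ℝ)).real (box hx hy) = 4 * Real.pi ^ 2 / (hx * hy) := by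
    unfold box
    rw [Measure.volume_eq_prod, Measure.real, Measure.prod_prod, Real.volume_Icc, Real.volume_Icc, ENNReal.toReal_mul,
      ENNReal.toReal_ofReal (by have : 0 < Real.pi / hx := by positivity
                                linarith),
      ENNReal.toReal_ofReal (by have : 0 < Real.pi / hy := by positivity
                                linarith)]
    field_simp
    ring
  unfold remainderWeight remainderSize secondMass
  rw [integral_add, integral_const_mul, integral_indicator (measurableSet_box hx hy), setIntegral_const, hvol, smul_eq_mul]
  · field_simp
    ring
  · exact (integrable_freq_pow_mul_decay hl hT 24).const_mul _
  · rw [integrable_indicator_iff (measurableSet_box hx hy)]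
    exact integrableOn_const (isCompact_box hx hy).measure_lt_top.ne

/-- With `m` the smaller mesh size, `m ^ (4 + β)` splits into two powers to cancel `hx * hy`, two to
produce the mesh parameter, and `m ^ β` to spare. This is the reason for the exponent in the
timestep condition. -/
lemma rate_div_mesh_le {β C₀ : ℝ} (hC : 0 < C₀) (hk : 0 < k) (hhx : 0 < hx) (hhy : 0 < hy)
    (h : θ ^ N ≤ (2 : ℝ) ^ (-C₀) * (min hx hy) ^ (4 + β)) :
    θ ^ N / (hx * hy) ≤ meshSize k hx hy * (min hx hy) ^ β := by
  set m := min hx hy with hm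
  have hm0 : 0 < m := lt_min hhx hhy
  have h1 : θ ^ N ≤ m ^ (4 + β) := by
    refine h.trans (mul_le_of_le_one_left (by positivity) ?_)
    exact Real.rpow_le_one_of_one_le_of_nonpos (by norm_num) (by linarith)
  have h2 : m ^ (4 + β) = m ^ 4 * m ^ β := by
    rw [Real.rpow_add hm0]; norm_cast
  have mx : m ≤ hx := min_le_left _ _
  have my : m ≤ hy := min_le_right _ _
  rw [div_le_iff₀ (by positivity)]
  have h3 : m ^ 2 ≤ hx * hy := by rw [sq]; exact mul_le_mul mx my hm0.le hhx.le
  have h4 : m ^ 2 ≤ meshSize k hx hy := by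
    have : m ^ 2 ≤ hx ^ 2 := pow_le_pow_left₀ hm0.le mx 2
    unfold meshSize; nlinarith [sq_nonneg hy]
  calc θ ^ N ≤ m ^ 2 * m ^ β * m ^ 2 := by rw [h2] at h1; refine h1.trans (le_of_eq ?_); ring
    _ ≤ meshSize k hx hy * m ^ β * (hx * hy) := by
        have := meshSize_pos (hx := hx) (hy := hy) hk
        gcongr

lemma remainderSize_isLittleO {x₀ y₀ β C₀ : ℝ} (hT : 0 < T) (hθ : 0 < θ) (hβ : 0 < β) (hC : 0 < C₀) :
    (fun d : ℕ × ℝ × ℝ => remainderSize M lam T θ (T / d.1) d.2.1 d.2.2 d.1)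
      =o[refinement x₀ y₀ θ β C₀] fun d => T / d.1 + d.2.1 ^ 2 + d.2.2 ^ 2 := by
  have hK := secondMass_nonneg (M := M) (lam := lam) hT.le
  -- The size of the remainder is at most the mesh parameter times `g`, and `g` tends to zero along
  -- the refinement; positivity of `β` is needed for the second summand.
  set g : ℕ × ℝ × ℝ → ℝ := fun d => secondMass M lam T * (T / d.1 + d.2.1 ^ 2 + d.2.2 ^ 2) +
    8 * Real.pi ^ 2 * (min d.2.1 d.2.2) ^ β with hg
  have l0 : Tendsto (fun d : ℕ × ℝ × ℝ => d.1) (refinement x₀ y₀ θ β C₀) atTop :=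
    tendsto_fst.mono_left inf_le_left
  have l1 : Tendsto (fun d : ℕ × ℝ × ℝ => d.2.1) (refinement x₀ y₀ θ β C₀) (𝓝 0) :=
    ((tendsto_fst.comp tendsto_snd).mono_left inf_le_left).mono_right nhdsWithin_le_nhds
  have l2 : Tendsto (fun d : ℕ × ℝ × ℝ => d.2.2) (refinement x₀ y₀ θ β C₀) (𝓝 0) :=
    ((tendsto_snd.comp tendsto_snd).mono_left inf_le_left).mono_right nhdsWithin_le_nhds
  have l3 : Tendsto (fun d : ℕ × ℝ × ℝ => T / d.1) (refinement x₀ y₀ θ β C₀) (𝓝 0) :=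
    (tendsto_const_div_atTop_nhds_zero_nat T).comp l0
  have hlim : Tendsto g (refinement x₀ y₀ θ β C₀) (𝓝 0) := by
    have a := (((l3.add (l1.pow 2)).add (l2.pow 2)).const_mul (secondMass M lam T)).add
      (((l1.min l2).rpow_const (p := β) (Or.inr hβ.le)).const_mul (8 * Real.pi ^ 2))
    simpa [Real.zero_rpow hβ.ne'] using a
  have hle : ∀ᶠ d in refinement x₀ y₀ θ β C₀, ‖remainderSize M lam T θ (T / d.1) d.2.1 d.2.2 d.1‖ ≤
      ‖g d * (T / d.1 + d.2.1 ^ 2 + d.2.2 ^ 2)‖ := by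
    have : admissible x₀ y₀ θ β C₀ ∈ refinement x₀ y₀ θ β C₀ := mem_inf_of_right (mem_principal_self _)
    filter_upwards [this] with d hd
    obtain ⟨hN, hhx, hhy, -, -, ht⟩ := hd
    have hk : 0 < T / d.1 := by positivity
    have h1 := rate_div_mesh_le hC hk hhx hhy ht
    rw [Real.norm_of_nonneg (remainderSize_pos hT.le hθ hhx hhy).le]
    refine le_trans ?_ (Real.le_norm_self _)
    have h2 := mul_le_mul_of_nonneg_left h1 (by positivity : 0 ≤ 8 * Real.pi ^ 2)
    unfold remainderSize
    simp only [hg]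
    unfold meshSize at *
    linarith
  have hO : (fun d : ℕ × ℝ × ℝ => remainderSize M lam T θ (T / d.1) d.2.1 d.2.2 d.1)
      =O[refinement x₀ y₀ θ β C₀] fun d => g d * (T / d.1 + d.2.1 ^ 2 + d.2.2 ^ 2) :=
    IsBigO.of_bound 1 (by simpa only [one_mul] using hle)
  refine hO.trans_isLittleO ?_
  have := ((isLittleO_one_iff ℝ).2 hlim).mul_isBigO
    (isBigO_refl (fun d : ℕ × ℝ × ℝ => T / d.1 + d.2.1 ^ 2 + d.2.2 ^ 2) (refinement x₀ y₀ θ β C₀))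
  simpa using this

end Rate

/-! ### Uniformly bounded moments -/

section Moments

variable {Ω : Type*} [mΩ : MeasurableSpace Ω] {P : Measure Ω}

lemma boundedMoments_of_sq_le [IsProbabilityMeasure P] {ι : Type*} {F : ι → Ω → ℝ} {c : ℝ} (hc : 0 ≤ c) (hF : ∀ a, MemLp (F a) 2 P)
    (h : ∀ a, ∫ ω, F a ω ^ 2 ∂P ≤ c ^ 2) : BoundedMoments P F :=
  ⟨max c (c ^ 2), fun a => ⟨hF a, (integral_abs_le_of_sq_le (hF a) hc (h a)).trans (le_max_left _ _),
    (h a).trans (le_max_right _ _)⟩⟩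

lemma DensityBound.integral_nonneg {Ξ : ℝ × ℝ → Ω → ℂ} {w : ℝ × ℝ → ℝ} (h : DensityBound P Ξ w) :
    0 ≤ ∫ p, w p := MeasureTheory.integral_nonneg h.nonneg

lemma DensityBound.boundedMoments [IsProbabilityMeasure P] {Ξ : ℝ × ℝ → Ω → ℂ} {w : ℝ × ℝ → ℝ} (h : DensityBound P Ξ w) (x₀ y₀ : ℝ) :
    BoundedMoments P fun a : ℝ × ℝ => field Ξ (a.1 - x₀) (a.2 - y₀) :=
  boundedMoments_of_sq_le h.integral_nonneg (fun _ => h.memLp_field _ _) fun _ => h.integral_field_sq_le _ _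

end Moments

/-! ### The endpoint of the driving motion -/

section Driving

variable {Ω : Type*} [mΩ : MeasurableSpace Ω] {P : Measure Ω} {ρ : ℝ} {Mx My : ℝ≥0 → Ω → ℝ}

/-- A measurable version of the normalised value at time `T` of the driving Brownian motion. -/
lemma exists_endpoint (h : IsCorrelatedBrownian P ρ Mx My) {T : ℝ} (hT : 0 < T) :
    ∃ ζ : Ω → ℝ × ℝ, Measurable ζ ∧ CorrGauss ρ (P.map ζ) ∧
      ∀ᵐ ω ∂P, √T * (ζ ω).1 = Mx T.toNNReal ω ∧ √T * (ζ ω).2 = My T.toNNReal ω := by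
  -- The endpoint is the increment of a single step of length `T`, so the construction for general
  -- steps applies with `k = T`.
  obtain ⟨Z, hZ, hae⟩ := exists_gaussSteps h hT
  refine ⟨Z 0, hZ.meas 0, hZ.law 0, ?_⟩
  have hx := sum_normIncrement h.brownian_x hT one_pos
  have hy := sum_normIncrement h.brownian_y hT one_pos
  filter_upwards [hae, hx, hy] with ω h0 h1 h2
  rw [h0 0]
  simpa using And.intro h1 h2

lemma ae_stepProd_expF_eq (h : IsCorrelatedBrownian P ρ Mx My) (M : Coeffs) {T : ℝ} (hT : 0 < T) {N : ℕ} (hN : 0 < N)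
    {Z : ℕ → Ω → ℝ × ℝ} (hZ : ∀ᵐ ω ∂P, ∀ n, Z n ω = (normIncrement Mx (T / N) ω n, normIncrement My (T / N) ω n))
    {ζ : Ω → ℝ × ℝ} (hζ : ∀ᵐ ω ∂P, √T * (ζ ω).1 = Mx T.toNNReal ω ∧ √T * (ζ ω).2 = My T.toNNReal ω) :
    ∀ᵐ ω ∂P, ∀ p, stepProd (expF M (T / N) p) Z N ω = expF M T p (ζ ω) := by
  filter_upwards [hZ, hζ, sum_normIncrement h.brownian_x hT hN, sum_normIncrement h.brownian_y hT hN]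
    with ω h0 h1 h2 h3 p
  have hN' : (N : ℝ) ≠ 0 := by exact_mod_cast hN.ne'
  refine stepProd_expF_eq M (by field_simp) ?_ ?_ p
  · simp only [h0]; rw [h2, h1.1]
  · simp only [h0]; rw [h3, h1.2]

end Driving

end ZakaiADI

end

/-! ### Assembly of the theorem -/

theorem theorem2p3 (ρx ρy ρxy : ℝ)
    (hρx : 0 ≤ ρx) (hρx_lt : ρx < 1) (hρy : 0 ≤ ρy) (hρy_lt : ρy < 1)
    (hρxy_ge : -1 ≤ ρxy) (hρxy_le : ρxy ≤ 1)
    (hstab_x : 2 * ρx ^ 2 * (1 + 2 * |ρxy|) < 1)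
    (hstab_y : 2 * ρy ^ 2 * (1 + 2 * |ρxy|) < 1)
    (hstab_xy : 2 * ρx * ρy * (3 * ρxy ^ 2 + 2 * |ρxy| + 1) < 1) :
    ∃ θ : ℝ, 0 < θ ∧ θ < 1 ∧
      ∀ (Ω : Type*) [MeasurableSpace Ω] (P : Measure Ω) [IsProbabilityMeasure P]
        (Mx My : ℝ≥0 → Ω → ℝ), ZakaiADI.IsCorrelatedBrownian P ρxy Mx My →
      ∀ (T μx μy x₀ y₀ : ℝ), 0 < T →
      -- the leading error coefficients, as random fields over `(x, y)`; only `E₁` sees `k = T / N`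
      ∃ (E₁ : ℕ → ℝ × ℝ → Ω → ℝ) (E₂ E₃ : ℝ × ℝ → Ω → ℝ),
        ZakaiADI.BoundedMoments P (fun a : ℕ × (ℝ × ℝ) => E₁ a.1 a.2) ∧
        ZakaiADI.BoundedMoments P E₂ ∧
        ZakaiADI.BoundedMoments P E₃ ∧
        ∀ (β C₀ : ℝ), 0 < β → 0 < C₀ →
        -- the deterministic factor `r = o(k, hx ^ 2, hy ^ 2)` and the random factor `R`
        ∃ (r : ℕ × ℝ × ℝ → ℝ) (R : ℕ × ℝ × ℝ → ℤ × ℤ → Ω → ℝ),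
          r =o[ZakaiADI.refinement x₀ y₀ θ β C₀]
            (fun d : ℕ × ℝ × ℝ => T / d.1 + d.2.1 ^ 2 + d.2.2 ^ 2) ∧
          ZakaiADI.BoundedMoments P (fun a : (ℕ × ℝ × ℝ) × (ℤ × ℤ) => R a.1 a.2) ∧
          ∀ (N : ℕ) (hx hy k : ℝ), (N, hx, hy) ∈ ZakaiADI.admissible x₀ y₀ θ β C₀ →
            k = T / N →
            ∀ V : ℕ → ℤ → ℤ → Ω → ℝ,
              (∀ᵐ ω ∂P, ZakaiADI.IsADIPath μx μy ρx ρy x₀ y₀ k hx hy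
                (ZakaiADI.normIncrement Mx k ω) (ZakaiADI.normIncrement My k ω)
                (fun n i j => V n i j ω)) →
              ∀ i j : ℤ, ∀ᵐ ω ∂P,
                V N i j ω - ZakaiADI.exactSolution μx μy ρx ρy x₀ y₀ T
                    (Mx T.toNNReal ω) (My T.toNNReal ω) (i * hx) (j * hy)
                  = k * E₁ N (i * hx, j * hy) ω
                    + hx ^ 2 * E₂ (i * hx, j * hy) ω
                    + hy ^ 2 * E₃ (i * hx, j * hy) ω
                    + r (N, hx, hy) * R (N, hx, hy) (i, j) ω := by
  obtain ⟨lam, hl⟩ := ZakaiADI.exists_stableRate hρx_lt hρy_lt hstab_x hstab_y hstab_xy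
  have hlam0 := hl.pos
  have hlam1 := hl.lt
  have hθ0 : 0 < √((1 + lam) / 2) := Real.sqrt_pos.2 (by linarith)
  have hθsq : √((1 + lam) / 2) ^ 2 = (1 + lam) / 2 := Real.sq_sqrt (by linarith)
  -- The square root converts contraction of second moments into contraction of root mean squares,
  -- and it depends only on the correlations.
  refine ⟨√((1 + lam) / 2), hθ0, by rw [Real.sqrt_lt' one_pos]; linarith, ?_⟩
  set θ := √((1 + lam) / 2)
  intro Ω _ P _ Mx My hB T μx μy x₀ y₀ hT
  let M : ZakaiADI.Coeffs := ⟨μx, μy, ρx, ρy, ρxy⟩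
  have hM : M.Valid := ⟨hρx, hρx_lt, hρy, hρy_lt, hρxy_ge, hρxy_le⟩
  have hlM : ZakaiADI.StableRate lam M.ρx M.ρy M.ρ := hl
  -- The endpoint is fixed before any discretisation, which makes `E₂` and `E₃` independent of `k`,
  -- `hx` and `hy`; the steps `Z N` below depend on `N` only, and so does `E₁`.
  obtain ⟨ζ, hζ, hν, hζT⟩ := ZakaiADI.exists_endpoint hB hT
  have hk : ∀ N : ℕ, 0 < N → 0 < T / N := fun N hN => div_pos hT (by exact_mod_cast hN)
  have hNk : ∀ N : ℕ, 0 < N → N * (T / N) = T := fun N hN => by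
    have : (N : ℝ) ≠ 0 := by exact_mod_cast hN.ne'
    field_simp
  have hZex : ∀ N : ℕ, ∃ Z : ℕ → Ω → ℝ × ℝ, 0 < N → ZakaiADI.GaussSteps P ρxy Z ∧ ∀ᵐ ω ∂P, ∀ n, Z n ω =
      (ZakaiADI.normIncrement Mx (T / N) ω n, ZakaiADI.normIncrement My (T / N) ω n) := fun N => by
    by_cases hN : 0 < N
    · obtain ⟨Z, hZ⟩ := ZakaiADI.exists_gaussSteps hB (hk N hN)
      exact ⟨Z, fun _ => hZ⟩
    · exact ⟨fun _ _ => 0, fun h => absurd h hN⟩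
  choose Z hZ using hZex
  have hX : ∀ N : ℕ, 0 < N → ∀ᵐ ω ∂P, ∀ p,
      ZakaiADI.stepProd (ZakaiADI.expF M (T / N) p) (Z N) N ω = ZakaiADI.expF M T p (ζ ω) :=
    fun N hN => ZakaiADI.ae_stepProd_expF_eq hB M hT hN (hZ N hN).2 hζT
  have d1 := fun (N : ℕ) (hN : 0 < N) => ZakaiADI.densityBound_timeCoeff hM hlM (hZ N hN).1 (hk N hN) hT (hNk N hN)
  have d2 := ZakaiADI.densityBound_spaceCoeffX hM hlM hT hζ hν
  have d3 := ZakaiADI.densityBound_spaceCoeffY hM hlM hT hζ hν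
  have d4 := fun (N : ℕ) (hN : 0 < N) (hx hy : ℝ) (hhx : 0 < hx) (hhy : 0 < hy) =>
    ZakaiADI.densityBound_remainder hM hlM (hZ N hN).1 hζ hν (hk N hN) hT (hNk N hN) hhx hhy hθsq hθ0.le (hX N hN)
  refine ⟨fun N a ω => if 0 < N then
      ZakaiADI.field (ZakaiADI.timeCoeff M (T / N) N (Z N)) (a.1 - x₀) (a.2 - y₀) ω else 0,
    fun a => ZakaiADI.field (fun p ω => ZakaiADI.spaceCoeffX M T p (ζ ω)) (a.1 - x₀) (a.2 - y₀),
    fun a => ZakaiADI.field (fun p ω => ZakaiADI.spaceCoeffY M T p (ζ ω)) (a.1 - x₀) (a.2 - y₀),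
    ?_, d2.boundedMoments x₀ y₀, d3.boundedMoments x₀ y₀, ?_⟩
  -- The weight of the time density is the same for every `N`, so the bound read off at `N = 1`
  -- serves all of them; for `N = 0` the field is set to zero.
  · refine ZakaiADI.boundedMoments_of_sq_le (d1 1 one_pos).integral_nonneg (fun a => ?_) fun a => ?_
    · by_cases hN : 0 < a.1
      · simpa only [hN, if_true] using (d1 a.1 hN).memLp_field _ _
      · simp only [hN, if_false]; exact MemLp.zero'
    · by_cases hN : 0 < a.1
      · simpa only [hN, if_true] using (d1 a.1 hN).integral_field_sq_le _ _
      · simp only [hN, if_false]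
        simpa using sq_nonneg _
  intro β C₀ hβ hC₀
  let good : ℕ × ℝ × ℝ → Prop := fun d => 0 < d.1 ∧ 0 < d.2.1 ∧ 0 < d.2.2
  let r : ℕ × ℝ × ℝ → ℝ := fun d => ZakaiADI.remainderSize M lam T θ (T / d.1) d.2.1 d.2.2 d.1
  have hr : ∀ d, good d → 0 < r d := fun d hd => ZakaiADI.remainderSize_pos hT.le hθ0 hd.2.1 hd.2.2
  classical
  -- The random factor is the remainder field divided by `r`, the integral of its weight, so its
  -- second moment is at most one. It is set to zero for parameters that describe no discretisation.
  refine ⟨r, fun d a ω => if good d then (r d)⁻¹ * ZakaiADI.field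
      (ZakaiADI.remainder M T (T / d.1) d.2.1 d.2.2 d.1 (Z d.1) ζ) (a.1 * d.2.1 - x₀) (a.2 * d.2.2 - y₀) ω else 0,
    ZakaiADI.remainderSize_isLittleO hT hθ0 hβ hC₀, ?_, ?_⟩
  · refine ZakaiADI.boundedMoments_of_sq_le zero_le_one (fun a => ?_) fun a => ?_
    · by_cases hd : good a.1
      · simpa only [hd, if_true] using
          ((d4 a.1.1 hd.1 a.1.2.1 a.1.2.2 hd.2.1 hd.2.2).memLp_field _ _).const_mul _
      · simp only [hd, if_false]; exact MemLp.zero'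
    · by_cases hd : good a.1
      · have h := (d4 a.1.1 hd.1 a.1.2.1 a.1.2.2 hd.2.1 hd.2.2).integral_field_sq_le
          (a.2.1 * a.1.2.1 - x₀) (a.2.2 * a.1.2.2 - y₀)
        rw [ZakaiADI.integral_remainderWeight hlam1 hT hd.2.1 hd.2.2] at h
        simp only [hd, if_true, mul_pow]
        rw [integral_const_mul]
        have hr0 := hr a.1 hd
        calc (r a.1)⁻¹ ^ 2 * _ ≤ (r a.1)⁻¹ ^ 2 * r a.1 ^ 2 := mul_le_mul_of_nonneg_left h (by positivity)
          _ = 1 ^ 2 := by field_simp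
      · simp only [hd, if_false]
        simp
  · rintro N hx hy k ⟨hN, hhx, hhy, ⟨i₀, hi₀⟩, ⟨j₀, hj₀⟩, -⟩ rfl V hV i j
    have hd : good (N, hx, hy) := ⟨hN, hhx, hhy⟩
    filter_upwards [hV, (hZ N hN).2, hζT, ZakaiADI.ae_expansion (x₀ := x₀) (y₀ := y₀) hM hlM (hZ N hN).1 hζ hν (hk N hN) hT
      (hNk N hN) hhx hhy hθsq hθ0.le (hX N hN) (i * hx) (j * hy)] with ω h1 h2 h3 h4
    have h5 := ZakaiADI.IsADIPath.eq_gridFT hM (hk N hN).le hhx hhy hi₀ hj₀ h1 h2 N i j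
    have h6 : V N i j ω = ZakaiADI.field (ZakaiADI.schemeDensity M (T / N) hx hy N (Z N)) (i * hx - x₀) (j * hy - y₀) ω := by
      rw [← ZakaiADI.gridFT_stepProd_eq_field]; exact h5
    rw [h3.1, h3.2] at h4
    rw [h6]
    simp only [hN, hd, if_true]
    rw [mul_inv_cancel_left₀ (hr _ hd).ne']
    exact h4
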